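/- Let $d\ge 1$, $\tau>0$, and let $(X_{\mathbf u})_{\mathbf u\in\mathbb Z^d}$ be a stationary family of real random variables with mean zero and finite variance which satisfies the FKG inequalities (for every finite subfamily, $\mathrm{Cov}(F,G)\ge 0$ for all coordinatewise increasing functions $F,G$ of it with finite second moments) and has finite susceptibility, $v=\sum_{\mathbf u}\mathrm{Cov}(X_{\mathbf 0},X_{\mathbf u})<\infty$. Let $(Z_{\mathbf u})$ be $N(0,\tau)$ random variables, independent of each other and of the family $(X_{\mathbf u})$. For a random variable $U$ with variance $\sigma^2$ and smooth density $f$ let $\rho_U=f'/f$, $J(U)=\mathbb E\rho_U(U)^2$ and $J_{\rm st}(U)=\sigma^2J(U)-1$. For $\mathbf x\in\{1,2,\dots\}^d$ let $|\mathbf x|=\prod_i x_i$, $B_{\mathbf x}=\{\mathbf y\in\mathbb Z^d:1\le y_i\le x_i\text{ for all }i\}$ and $V_{\mathbf x}=|\mathbf x|^{-1/2}\sum_{\mathbf u\in B_{\mathbf x}}(X_{\mathbf u}+Z_{\mathbf u})$, and for $n\ge1$ let $J(n)=\sup\{J_{\rm st}(V_{\mathbf x}):|\mathbf x|=n\}$.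 For a function $\psi$ on $[0,\infty)$ let $\mathcal C_\psi$ be the class of random variables $U$ with finite variance $\sigma^2$ such that $\mathbb E\,U^2\mathbf 1(|U|\ge R\sigma)\le\sigma^2\psi(R)$ for all $R\ge 0$. Assume uniform integrability: there is $\psi$ with $\psi(R)\to0$ as $R\to\infty$ such that $V_{\mathbf x}\in\mathcal C_\psi$ for all $\mathbf x\in\{1,2,\dots\}^d$. Fix such a $\psi$ and a number $K\ge v$. For random variables $S,T$ with mean zero and variances at most $K$ (with any joint law) let $X=S+Z_S$, $Y=T+Z_T$, where $Z_S,Z_T$ are $N(0,\tau)$, independent of $(S,T)$ and of each other, and for $\beta\in[0,1]$ put $$\Delta(X,Y,\beta)=\mathbb E\left(\sqrt\beta\,\rho_X(X)+\sqrt{1-\beta}\,\rho_Y(Y)-\tilde\rho\left(\sqrt\beta X+\sqrt{1-\beta}\,Y\right)\right)^2,$$ where $\tilde\rho$ is the score function of $\sqrt\beta X+\sqrt{1-\beta}\,Y$. Call $\nu:[0,\infty)\to\mathbb R$ admissible if $\nu(\epsilon)\to\nu(0)=0$ as $\epsilon\to0$ and $\beta(1-\beta)J_{\rm st}(X)\le\nu(\Delta(X,Y,\beta))$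 for all such $X,Y\in\mathcal C_\psi$ and all $\beta\in[0,1]$; write $\nu^{-1}(y)=\inf\{\epsilon\ge0:\nu(\epsilon)\ge y\}$. Then admissible functions exist, and for every admissible $\nu$ there is a sequence $d(m)$ with $d(m)\to0$ as $m\to\infty$ such that for all integers $m\ge n\ge1$ $$J(n+m)\le\frac{m}{m+n}J(m)+\frac{n}{m+n}J(n)+d(m)-\nu^{-1}\left(\frac{J(m)\,mn}{(m+n)^2}\right).$$ -/

import Mathlib

open MeasureTheory ProbabilityTheory Filter Topology
open scoped NNReal ENNReal

noncomputable section

namespace FKG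

/-! ### Fisher information of a law on the real line

All quantities attached to a real random variable `U` depend on its law only, so they are defined
for a probability measure `μ` on `ℝ` and used with `μ = P.map U`. They are only used for laws of
the form (law with finite variance) ∗ `N(0, τ)` with `τ > 0`. Such a law has a smooth positive
density, and all expectations below are then finite. -/

/-- The density of a law on `ℝ`, as the derivative of its distribution function. If the law has a
continuous density, this is that density at every point. -/
def density (μ : Measure ℝ) : ℝ → ℝ := deriv fun x => cdf μ x

/-- The score function `ρ = f' / f`, where `f` is the density. -/
def score (μ : Measure ℝ) (x : ℝ) : ℝ := deriv (density μ) x / density μ x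

/-- The Fisher information `J(U) = E ρ(U)²`. -/
def fisherInfo (μ : Measure ℝ) : ℝ := ∫ x, score μ x ^ 2 ∂μ

/-- The standardised Fisher information `J_st(U) = σ² J(U) - 1`, where `σ² = Var U`. -/
def stFisherInfo (μ : Measure ℝ) : ℝ := variance id μ * fisherInfo μ - 1

/-- The class `C_ψ` of laws with finite variance `σ²` such that
`E X² 1(|X| ≥ R σ) ≤ σ² ψ(R)` for all `R ≥ 0`. -/
def MemClass (ψ : ℝ → ℝ) (μ : Measure ℝ) : Prop :=
  MemLp id 2 μ ∧
    ∀ R : ℝ, 0 ≤ R →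
      ∫ x in {x : ℝ | R * √(variance id μ) ≤ |x|}, x ^ 2 ∂μ ≤ variance id μ * ψ R

/-! ### The function `ν` -/

/-- `Δ(X, Y, β) = E (√β ρ_X(X) + √(1-β) ρ_Y(Y) - ρ̃(√β X + √(1-β) Y))²`, as a function of the joint
law `κ` of `(X, Y)`; here `ρ̃` is the score function of `√β X + √(1-β) Y`. -/
def scoreGap (κ : Measure (ℝ × ℝ)) (β : ℝ) : ℝ :=
  ∫ p, (√β * score (κ.map Prod.fst) p.1 + √(1 - β) * score (κ.map Prod.snd) p.2
    - score (κ.map fun q => √β * q.1 + √(1 - β) * q.2) (√β * p.1 + √(1 - β) * p.2)) ^ 2 ∂κ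

/-- The joint law of `(S + Z_S, T + Z_T)`, where `(S, T)` has joint law `μ` and `Z_S`, `Z_T` are
`N(0, τ)`, independent of `(S, T)` and of each other. -/
def perturb (τ : ℝ≥0) (μ : Measure (ℝ × ℝ)) : Measure (ℝ × ℝ) :=
  (μ.prod ((gaussianReal 0 τ).prod (gaussianReal 0 τ))).map fun p => p.1 + p.2

/-- `ν` tends to `0` at `0` (on `[0, ∞)`), and `β (1 - β) J_st(X) ≤ ν (Δ(X, Y, β))` for all
`β ∈ [0, 1]` and all `X = S + Z_S`, `Y = T + Z_T` in the class `C_ψ`, where `S`, `T` are mean zero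
random variables with variance at most `K`, with any joint law `μ`. -/
structure IsModulus (ψ : ℝ → ℝ) (τ : ℝ≥0) (K : ℝ) (ν : ℝ → ℝ) : Prop where
  tendsto_zero : Tendsto ν (𝓝[≥] 0) (𝓝 0)
  le_apply : ∀ μ : Measure (ℝ × ℝ), IsProbabilityMeasure μ →
    MemLp Prod.fst 2 μ → MemLp Prod.snd 2 μ →
    ∫ p, p.1 ∂μ = 0 → ∫ p, p.2 ∂μ = 0 →
    variance Prod.fst μ ≤ K → variance Prod.snd μ ≤ K →
    MemClass ψ ((perturb τ μ).map Prod.fst) → MemClass ψ ((perturb τ μ).map Prod.snd) →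
    ∀ β ∈ Set.Icc (0 : ℝ) 1,
      β * (1 - β) * stFisherInfo ((perturb τ μ).map Prod.fst) ≤ ν (scoreGap (perturb τ μ) β)

/-- The generalized inverse `ν⁻¹(y) = inf {ε ≥ 0 : y ≤ ν(ε)}`. -/
def genInv (ν : ℝ → ℝ) (y : ℝ) : ℝ := sInf {ε : ℝ | 0 ≤ ε ∧ y ≤ ν ε}

/-! ### Random fields on the lattice -/

variable {Ω : Type*} [MeasurableSpace Ω] {d : ℕ}

/-- The law of the field is invariant under all translations of the lattice. -/
def IsStationary (X : (Fin d → ℤ) → Ω → ℝ) (P : Measure Ω) : Prop :=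
  ∀ a : Fin d → ℤ, IdentDistrib (fun ω u => X (u + a) ω) (fun ω u => X u ω) P P

/-- The FKG inequalities: for every finite subfamily and all coordinatewise increasing `F`, `G`
(with finite second moments, so that the covariance exists), `Cov(F(X), G(X)) ≥ 0`. -/
def IsFKG (X : (Fin d → ℤ) → Ω → ℝ) (P : Measure Ω) : Prop :=
  ∀ (s : Finset (Fin d → ℤ)) (F G : (s → ℝ) → ℝ),
    Measurable F → Measurable G → Monotone F → Monotone G →
    MemLp (fun ω => F fun u => X u ω) 2 P → MemLp (fun ω => G fun u => X u ω) 2 P →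
    0 ≤ covariance (fun ω => F fun u => X u ω) (fun ω => G fun u => X u ω) P

/-- The box of lattice points with `1 ≤ y_i ≤ x_i` for all `i`. -/
def box (x : Fin d → ℕ) : Finset (Fin d → ℤ) :=
  Fintype.piFinset fun i => Finset.Icc 1 (x i : ℤ)

/-- The volume `|x| = ∏ x_i` of the box. -/
def vol (x : Fin d → ℕ) : ℕ := ∏ i, x i

/-- The perturbed normalized sum `V_x = (∑_{u ∈ B_x} (X_u + Z_u)) / √|x|`. -/
def boxSum (X Z : (Fin d → ℤ) → Ω → ℝ) (x : Fin d → ℕ) (ω : Ω) : ℝ :=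
  (∑ u ∈ box x, (X u ω + Z u ω)) / √(vol x : ℝ)

/-- `J(n) = sup {J_st(V_x) : |x| = n}`. For `n ≥ 1` and `d ≥ 1` this is the supremum of a nonempty
finite set. -/
def supFisher (X Z : (Fin d → ℤ) → Ω → ℝ) (P : Measure Ω) (n : ℕ) : ℝ :=
  sSup {j : ℝ | ∃ x : Fin d → ℕ, vol x = n ∧ j = stFisherInfo (P.map (boxSum X Z x))}

end FKG

end

/-! The recursive form of the inequality is not where the difficulty lies: the whole right side
except the last term is controlled by letting `d(m)` be the maximum over `n ≤ m` of `J(n+m) +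
ν⁻¹(J(m)mn/(m+n)²)`. Since `J ≥ 0` by Cramér-Rao, the two weighted terms can only help, and
everything reduces to `d(m) → 0`. This needs two facts: `J(k) → 0`, and smallness of `ν⁻¹` at
arguments at most `J(m)`.

The first fact is a central limit theorem (`exists_norm_charFun_normSum_sub_le`). By Newman's
inequality, the characteristic function of a sum of two blocks of an FKG family differs from the
product by at most `4r²` times the covariance of the blocks. A box of large volume has a long side;
it is cut across that side into slabs of thickness `q`. Finite susceptibility makes the covariance
across a cut small compared with the volume of a slab, so the distance to the normal characteristic
function is almost additive over slabs. For one slab it is bounded by a second order expansion at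
zero, uniform by uniform integrability. The latter is known only for the perturbed sums, so the
expansion is made for them and the Gaussian factor is divided out.

Gaussian smoothing upgrades weak convergence to convergence of Fisher information
(`tendsto_fisherInfo`): densities and scores converge pointwise, and Cauchy-Schwarz gives bounds
whose integral is `1/τ` for every law. Hence `J_st` tends to its value at a normal law, which is
zero.

For the second fact, either every normalized sum has vanishing `J_st`, and then the argument of
`ν⁻¹` is at most `0 = ν(0)`; or one of them gives a fixed test law with `J_st > 0`. For that law `Δ
→ 0` as `β → 0` while `β(1-β)J_st` stays positive, so `ν` is bounded below by positive numbers at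
arbitrarily small points.

Admissible functions exist by compactness (`exists_scoreGap_bound`). If `Δ → 0` while `β(1-β)J_st`
stays above `c > 0`, a weak limit of the test laws has `Δ = 0` by Fatou; its scores then satisfy
Cauchy's functional equation and are affine, so `J_st = 0`. Uniform integrability makes the
variances converge, and this contradicts the lower bound. -/

noncomputable section

namespace FKG

section

/-! ### Convolution of a law with a function -/

/-- The convolution `x ↦ ∫ k (x - s) dμ(s)` of a function with a law. -/
def smooth (k : ℝ → ℝ) (μ : Measure ℝ) (x : ℝ) : ℝ := ∫ s, k (x - s) ∂μ

theorem integrable_translate {k : ℝ → ℝ} (hk : Continuous k) {C : ℝ} (hC : ∀ x, |k x| ≤ C)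
    (μ : Measure ℝ) [IsProbabilityMeasure μ] (x : ℝ) : Integrable (fun s => k (x - s)) μ :=
  Integrable.of_bound (by fun_prop) C (.of_forall fun s => hC _)

theorem integrable_weighted_translate {k w : ℝ → ℝ} (hk : Continuous k) (hki : Integrable k)
    {μ : Measure ℝ} [IsProbabilityMeasure μ] (hw : Continuous w) (hwi : Integrable w μ) :
    Integrable (fun p : ℝ × ℝ => w p.1 * k (p.2 - p.1)) (μ.prod volume) := by
  rw [integrable_prod_iff (by fun_prop)]
  refine ⟨.of_forall fun s => (hki.comp_sub_right s).const_mul (w s), ?_⟩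
  have h : (fun s => ∫ x, ‖w s * k (x - s)‖) = fun s => ‖w s‖ * ∫ x, ‖k x‖ := by
    funext s
    simp_rw [norm_mul]
    rw [integral_const_mul, integral_sub_right_eq_self (fun x => ‖k x‖) s]
  rw [h]
  exact hwi.norm.mul_const _

/-- The weight is needed twice: `w = 1` gives the mass of a smoothed kernel, `w = id` the first
moment in `integral_mul_score`. -/
theorem integrable_weighted_smooth {k w : ℝ → ℝ} (hk : Continuous k) (hki : Integrable k)
    {μ : Measure ℝ} [IsProbabilityMeasure μ] (hw : Continuous w) (hwi : Integrable w μ) :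
    Integrable (fun x => ∫ s, w s * k (x - s) ∂μ) :=
  (integrable_weighted_translate hk hki hw hwi).integral_prod_right

theorem integral_weighted_smooth {k w : ℝ → ℝ} (hk : Continuous k) (hki : Integrable k)
    {μ : Measure ℝ} [IsProbabilityMeasure μ] (hw : Continuous w) (hwi : Integrable w μ) :
    ∫ x, ∫ s, w s * k (x - s) ∂μ = (∫ s, w s ∂μ) * ∫ x, k x := by
  rw [← integral_integral_swap (f := fun s x => w s * k (x - s))
    (integrable_weighted_translate hk hki hw hwi)]
  simp_rw [integral_const_mul, integral_sub_right_eq_self (fun x => k x), integral_mul_const]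

theorem integrable_smooth {k : ℝ → ℝ} (hk : Continuous k) (hki : Integrable k)
    (μ : Measure ℝ) [IsProbabilityMeasure μ] : Integrable (smooth k μ) := by
  have h := integrable_weighted_smooth hk hki (μ := μ) (w := fun _ => 1)
    continuous_const (integrable_const _)
  simp only [one_mul] at h
  exact h

theorem integral_smooth {k : ℝ → ℝ} (hk : Continuous k) (hki : Integrable k)
    (μ : Measure ℝ) [IsProbabilityMeasure μ] : ∫ x, smooth k μ x = ∫ x, k x := by
  simpa [smooth] using integral_weighted_smooth hk hki (μ := μ) (w := fun _ => 1)
    continuous_const (integrable_const _)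

theorem tendsto_smooth_const {k : ℝ → ℝ} (hk : Continuous k) {C : ℝ} (hC : ∀ x, |k x| ≤ C)
    {μs : ℕ → ProbabilityMeasure ℝ} {μ : ProbabilityMeasure ℝ} (hμ : Tendsto μs atTop (𝓝 μ))
    (x : ℝ) : Tendsto (fun n => smooth k (μs n) x) atTop (𝓝 (smooth k μ x)) :=
  (ProbabilityMeasure.tendsto_iff_forall_integral_tendsto.1 hμ)
    (BoundedContinuousFunction.ofNormedAddCommGroup (fun s => k (x - s)) (by fun_prop) C
      fun s => hC _)

/-- Moving the point costs at most the modulus of continuity of `k`, uniformly in the law; the rest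
is weak convergence at a fixed point. -/
theorem tendsto_smooth {k : ℝ → ℝ} (hk : UniformContinuous k) {C : ℝ} (hC : ∀ x, |k x| ≤ C)
    {μs : ℕ → ProbabilityMeasure ℝ} {μ : ProbabilityMeasure ℝ} (hμ : Tendsto μs atTop (𝓝 μ))
    {xs : ℕ → ℝ} {x : ℝ} (hx : Tendsto xs atTop (𝓝 x)) :
    Tendsto (fun n => smooth k (μs n) (xs n)) atTop (𝓝 (smooth k μ x)) := by
  have hc := hk.continuous
  have h1 := tendsto_smooth_const hc hC hμ x
  have h2 : Tendsto (fun n => smooth k (μs n) (xs n) - smooth k (μs n) x) atTop (𝓝 0) := by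
    rw [Metric.tendsto_atTop]
    intro ε hε
    obtain ⟨δ, hδ, h⟩ := Metric.uniformContinuous_iff.1 hk (ε / 2) (by positivity)
    obtain ⟨N, hN⟩ := Metric.tendsto_atTop.1 hx δ hδ
    refine ⟨N, fun n hn => ?_⟩
    rw [dist_zero_right, smooth, smooth,
      ← integral_sub (integrable_translate hc hC _ _) (integrable_translate hc hC _ _)]
    have := norm_integral_le_of_norm_le_const (μ := (μs n : Measure ℝ)) (C := ε / 2)
      (f := fun s => k (xs n - s) - k (x - s)) (.of_forall fun s => by
        rw [← dist_eq_norm]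
        refine (h ?_).le
        rw [dist_sub_right]
        exact hN n hn)
    simp only [probReal_univ, mul_one] at this
    linarith
  simpa using h2.add h1

/-! ### The Gaussian kernel and its derivatives -/

/-- The centred Gaussian density with variance `τ`. -/
def ker (τ : ℝ≥0) (x : ℝ) : ℝ := gaussianPDFReal 0 τ x

/-- The derivative of the Gaussian density. -/
def ker' (τ : ℝ≥0) (x : ℝ) : ℝ := -(x / τ) * ker τ x

/-- The square of the Gaussian score times the Gaussian density. -/
def kerSq (τ : ℝ≥0) (x : ℝ) : ℝ := (x / τ) ^ 2 * ker τ x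

variable {τ : ℝ≥0}

theorem ker_eq (τ : ℝ≥0) (x : ℝ) :
    ker τ x = (√(2 * Real.pi * τ))⁻¹ * Real.exp (-x ^ 2 / (2 * τ)) := by
  simp [ker, gaussianPDFReal]

theorem ker_pos (hτ : 0 < τ) (x : ℝ) : 0 < ker τ x := gaussianPDFReal_pos _ _ _ hτ.ne'

theorem continuous_ker (τ : ℝ≥0) : Continuous (ker τ) := by
  simp_rw [funext (ker_eq τ)]
  fun_prop

theorem continuous_ker' (τ : ℝ≥0) : Continuous (ker' τ) := by
  have := continuous_ker τ
  unfold ker'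
  fun_prop

theorem continuous_kerSq (τ : ℝ≥0) : Continuous (kerSq τ) := by
  have := continuous_ker τ
  unfold kerSq
  fun_prop

theorem ker_le (τ : ℝ≥0) (x : ℝ) : ker τ x ≤ ker τ 0 := by
  rw [ker_eq, ker_eq]
  refine mul_le_mul_of_nonneg_left (Real.exp_le_exp.2 ?_) (by positivity)
  rw [neg_div, zero_pow two_ne_zero, neg_zero, zero_div, neg_nonpos]
  positivity

theorem abs_ker_le (hτ : 0 < τ) (x : ℝ) : |ker τ x| ≤ ker τ 0 := by
  rw [abs_of_pos (ker_pos hτ x)]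
  exact ker_le τ x

/-- With `y = x²/(2τ)` this is `y e^{-y} ≤ 1`. -/
theorem sq_mul_ker_le (hτ : 0 < τ) (x : ℝ) : x ^ 2 * ker τ x ≤ 2 * τ * ker τ 0 := by
  have hτ' : (0 : ℝ) < τ := hτ
  rw [ker_eq, ker_eq]
  set c := (√(2 * Real.pi * τ))⁻¹ with hc
  have hc0 : 0 ≤ c := by positivity
  have h1 : x ^ 2 / (2 * τ) * Real.exp (-x ^ 2 / (2 * τ)) ≤ 1 := by
    rw [neg_div, Real.exp_neg, ← div_eq_mul_inv, div_le_one (Real.exp_pos _)]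
    linarith [Real.add_one_le_exp (x ^ 2 / (2 * τ))]
  have h2 : x ^ 2 * (c * Real.exp (-x ^ 2 / (2 * τ)))
      = 2 * τ * c * (x ^ 2 / (2 * τ) * Real.exp (-x ^ 2 / (2 * τ))) := by
    field_simp
  rw [h2]
  simp only [ne_eq, OfNat.ofNat_ne_zero, not_false_eq_true, zero_pow, neg_zero, zero_div,
    Real.exp_zero, mul_one]
  nlinarith [mul_nonneg hτ'.le hc0]

theorem kerSq_nonneg (hτ : 0 < τ) (x : ℝ) : 0 ≤ kerSq τ x :=
  mul_nonneg (sq_nonneg _) (ker_pos hτ x).le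

theorem kerSq_le (hτ : 0 < τ) (x : ℝ) : kerSq τ x ≤ 2 / τ * ker τ 0 := by
  have hτ' : (0 : ℝ) < τ := hτ
  have := sq_mul_ker_le hτ x
  rw [kerSq, div_pow, div_mul_eq_mul_div, div_le_iff₀ (by positivity)]
  calc x ^ 2 * ker τ x ≤ 2 * τ * ker τ 0 := this
    _ = _ := by field_simp

theorem abs_kerSq_le (hτ : 0 < τ) (x : ℝ) : |kerSq τ x| ≤ 2 / τ * ker τ 0 := by
  rw [abs_of_nonneg (kerSq_nonneg hτ x)]
  exact kerSq_le hτ x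

theorem abs_ker'_le (hτ : 0 < τ) (x : ℝ) : |ker' τ x| ≤ (1 + 2 / τ) * ker τ 0 := by
  have h1 := kerSq_le hτ x
  have h2 := ker_le τ x
  -- This is `|u| ≤ 1 + u²` at `u = x/τ`, times the kernel.
  have h3 : |ker' τ x| ≤ ker τ x + kerSq τ x := by
    rw [ker', kerSq, abs_mul, abs_neg, abs_of_pos (ker_pos hτ x), ← sq_abs (x / τ)]
    nlinarith [ker_pos hτ x, sq_nonneg (|x / τ| - 1), sq_nonneg (|x / τ|),
      mul_nonneg (ker_pos hτ x).le (sq_nonneg (|x / τ| - 1)),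
      mul_nonneg (ker_pos hτ x).le (abs_nonneg (x / τ)),
      mul_nonneg (ker_pos hτ x).le (sq_nonneg (|x / τ|))]
  linarith

theorem hasDerivAt_ker (τ : ℝ≥0) (x : ℝ) : HasDerivAt (ker τ) (ker' τ x) x := by
  simp_rw [funext (ker_eq τ)]
  have h : HasDerivAt (fun x : ℝ => -x ^ 2 / (2 * τ)) (-(2 * x) / (2 * τ)) x := by
    simpa using ((hasDerivAt_pow 2 x).neg).div_const (2 * (τ : ℝ))
  refine (h.exp.const_mul (√(2 * Real.pi * τ))⁻¹).congr_deriv ?_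
  rw [ker', ker_eq, neg_div (2 * (τ : ℝ)) (2 * x), mul_div_mul_left _ _ two_ne_zero]
  ring

theorem hasDerivAt_ker' (τ : ℝ≥0) (x : ℝ) :
    HasDerivAt (ker' τ) (kerSq τ x - (1 / τ) * ker τ x) x := by
  have h : HasDerivAt (fun x : ℝ => -(x / τ)) (-(1 / (τ : ℝ))) x :=
    ((hasDerivAt_id x).div_const (τ : ℝ)).neg
  refine (h.mul (hasDerivAt_ker τ x)).congr_deriv ?_
  rw [kerSq, ker']
  ring

theorem uniformContinuous_ker (hτ : 0 < τ) : UniformContinuous (ker τ) := by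
  have hC : 0 ≤ (1 + 2 / (τ : ℝ)) * ker τ 0 := (abs_nonneg _).trans (abs_ker'_le hτ 0)
  refine (lipschitzWith_of_nnnorm_deriv_le (C := Real.toNNReal ((1 + 2 / (τ : ℝ)) * ker τ 0))
    (fun x => (hasDerivAt_ker τ x).differentiableAt) fun x => ?_).uniformContinuous
  rw [(hasDerivAt_ker τ x).deriv, ← NNReal.coe_le_coe, Real.coe_toNNReal _ hC]
  exact abs_ker'_le hτ x

theorem uniformContinuous_ker' (hτ : 0 < τ) : UniformContinuous (ker' τ) := by
  have hb : ∀ x, |kerSq τ x - (1 / τ) * ker τ x| ≤ 2 / τ * ker τ 0 + 1 / τ * ker τ 0 := by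
    intro x
    refine (abs_sub _ _).trans (add_le_add (abs_kerSq_le hτ x) ?_)
    rw [abs_mul, abs_of_nonneg (by positivity : (0 : ℝ) ≤ 1 / τ)]
    gcongr
    exact abs_ker_le hτ x
  refine (lipschitzWith_of_nnnorm_deriv_le (C := Real.toNNReal (2 / τ * ker τ 0 + 1 / τ * ker τ 0))
    (fun x => (hasDerivAt_ker' τ x).differentiableAt) fun x => ?_).uniformContinuous
  rw [(hasDerivAt_ker' τ x).deriv, ← NNReal.coe_le_coe,
    Real.coe_toNNReal _ ((abs_nonneg _).trans (hb 0))]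
  exact hb x

theorem integrable_ker (τ : ℝ≥0) : Integrable (ker τ) := integrable_gaussianPDFReal 0 τ

theorem integral_gaussianReal (hτ : 0 < τ) (f : ℝ → ℝ) :
    ∫ x, f x ∂gaussianReal 0 τ = ∫ x, ker τ x * f x := by
  simp [integral_gaussianReal_eq_integral_smul hτ.ne', ker]

theorem integrable_gaussianReal (hτ : 0 < τ) (f : ℝ → ℝ) :
    Integrable f (gaussianReal 0 τ) ↔ Integrable fun x => f x * ker τ x := by
  rw [gaussianReal_of_var_ne_zero _ hτ.ne',
    integrable_withDensity_iff (measurable_gaussianPDF 0 τ)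
      (.of_forall fun _ => gaussianPDF_lt_top)]
  simp [toReal_gaussianPDF, ker]

theorem memLp_two_gaussianReal (τ : ℝ≥0) : MemLp id 2 (gaussianReal 0 τ) :=
  memLp_id_gaussianReal' 2 (by simp)

theorem integrable_ker' (hτ : 0 < τ) : Integrable (ker' τ) := by
  have h : Integrable id (gaussianReal 0 τ) := (memLp_two_gaussianReal τ).integrable one_le_two
  rw [integrable_gaussianReal hτ] at h
  convert h.const_mul (-(1 / (τ : ℝ))) using 2 with x
  simp only [ker', id]
  ring

theorem integral_ker' (hτ : 0 < τ) : ∫ x, ker' τ x = 0 := by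
  have h := integral_id_gaussianReal (μ := 0) (v := τ)
  rw [integral_gaussianReal hτ] at h
  have : ker' τ = fun x => (-(1 / (τ : ℝ))) * (ker τ x * x) := by
    funext x
    rw [ker']
    ring
  rw [this, integral_const_mul, h, mul_zero]

theorem integrable_sq_mul_ker (hτ : 0 < τ) : Integrable fun x => x ^ 2 * ker τ x := by
  have h : Integrable (fun x => id x ^ 2) (gaussianReal 0 τ) :=
    (memLp_two_gaussianReal τ).integrable_sq
  rwa [integrable_gaussianReal hτ] at h

theorem integral_sq_mul_ker (hτ : 0 < τ) : ∫ x, x ^ 2 * ker τ x = τ := by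
  have h := variance_fun_id_gaussianReal (μ := 0) (v := τ)
  rw [variance_eq_integral (by fun_prop), integral_id_gaussianReal, integral_gaussianReal hτ] at h
  rw [← h]
  congr with x
  ring

theorem integrable_kerSq (hτ : 0 < τ) : Integrable (kerSq τ) := by
  convert (integrable_sq_mul_ker hτ).const_mul (1 / (τ : ℝ) ^ 2) using 2 with x
  rw [kerSq]
  ring

theorem integral_kerSq (hτ : 0 < τ) : ∫ x, kerSq τ x = 1 / τ := by
  have hτ' : (0 : ℝ) < τ := hτ
  have : kerSq τ = fun x => 1 / (τ : ℝ) ^ 2 * (x ^ 2 * ker τ x) := by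
    funext x
    rw [kerSq]
    ring
  rw [this, integral_const_mul, integral_sq_mul_ker hτ]
  field_simp

theorem integrable_mul_ker' (hτ : 0 < τ) : Integrable fun x => x * ker' τ x := by
  convert (integrable_sq_mul_ker hτ).const_mul (-(1 / (τ : ℝ))) using 2 with x
  rw [ker']
  ring

theorem integral_mul_ker' (hτ : 0 < τ) : ∫ x, x * ker' τ x = -1 := by
  have hτ' : (0 : ℝ) < τ := hτ
  have : (fun x => x * ker' τ x) = fun x => -(1 / (τ : ℝ)) * (x ^ 2 * ker τ x) := by
    funext x
    rw [ker']
    ring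
  rw [this, integral_const_mul, integral_sq_mul_ker hτ]
  field_simp

end

section

/-! ### Laws smoothed by a Gaussian -/

/-- Stated for a general group because it serves both the line and the plane. -/
theorem conv_withDensity {G : Type*} [AddCommGroup G] [MeasurableSpace G] [MeasurableAdd₂ G]
    [MeasurableSub₂ G] (m : Measure G) [SFinite m] [m.IsAddRightInvariant] {g : G → ℝ≥0∞}
    (hg : Measurable g) (μ : Measure G) [SFinite μ] [SFinite (m.withDensity g)] :
    μ ∗ m.withDensity g = m.withDensity fun x => ∫⁻ s, g (x - s) ∂μ := by
  have hm : Measurable fun x => ∫⁻ s, g (x - s) ∂μ :=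
    Measurable.lintegral_prod_right' (f := fun p : G × G => g (p.1 - p.2)) (by fun_prop)
  refine Measure.ext_of_lintegral _ fun f hf => ?_
  rw [Measure.lintegral_conv hf, lintegral_withDensity_eq_lintegral_mul _ hm hf]
  have h : ∀ s, ∫⁻ y, f (s + y) ∂m.withDensity g = ∫⁻ x, g (x - s) * f x ∂m := by
    intro s
    rw [lintegral_withDensity_eq_lintegral_mul _ hg (by fun_prop),
      ← lintegral_sub_right_eq_self _ s]
    simp
  simp_rw [h, Pi.mul_apply]
  rw [lintegral_lintegral_swap (by fun_prop)]
  refine lintegral_congr fun x => ?_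
  rw [lintegral_mul_const _ (by fun_prop)]

variable {τ : ℝ≥0}

theorem smooth_ker_pos (hτ : 0 < τ) (μ : Measure ℝ) [IsProbabilityMeasure μ] (x : ℝ) :
    0 < smooth (ker τ) μ x := by
  have hi := integrable_translate (continuous_ker τ) (abs_ker_le hτ) μ x
  rw [smooth, integral_pos_iff_support_of_nonneg (fun s => (ker_pos hτ _).le) hi]
  have : (Function.support fun s => ker τ (x - s)) = Set.univ := by
    ext s
    simp [(ker_pos hτ (x - s)).ne']
  simp [this]

theorem hasDerivAt_smooth_ker (hτ : 0 < τ) (μ : Measure ℝ) [IsProbabilityMeasure μ] (x : ℝ) :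
    HasDerivAt (smooth (ker τ) μ) (smooth (ker' τ) μ x) x := by
  have hc := continuous_ker τ
  have hc' := continuous_ker' τ
  exact (hasDerivAt_integral_of_dominated_loc_of_deriv_le (μ := μ)
    (F := fun x s => ker τ (x - s)) (F' := fun x s => ker' τ (x - s))
    (bound := fun _ => (1 + 2 / τ) * ker τ 0) univ_mem
    (.of_forall fun y => by fun_prop)
    (integrable_translate hc (abs_ker_le hτ) μ x)
    (by fun_prop) (.of_forall fun s y _ => abs_ker'_le hτ _) (integrable_const _)
    (.of_forall fun s y _ => (hasDerivAt_ker τ (y - s)).comp_sub_const y s)).2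

theorem continuous_smooth_ker (hτ : 0 < τ) (μ : Measure ℝ) [IsProbabilityMeasure μ] :
    Continuous (smooth (ker τ) μ) :=
  continuous_iff_continuousAt.2 fun x => (hasDerivAt_smooth_ker hτ μ x).continuousAt

theorem continuous_smooth_ker' (hτ : 0 < τ) (μ : Measure ℝ) [IsProbabilityMeasure μ] :
    Continuous (smooth (ker' τ) μ) := by
  refine continuous_iff_continuousAt.2 fun x => ?_
  refine tendsto_of_seq_tendsto fun u hu => ?_
  exact tendsto_smooth (uniformContinuous_ker' hτ) (abs_ker'_le hτ)
    (μs := fun _ => ⟨μ, inferInstance⟩) (μ := ⟨μ, inferInstance⟩) tendsto_const_nhds hu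

theorem conv_gaussianReal_eq (hτ : 0 < τ) (μ : Measure ℝ) [IsProbabilityMeasure μ] :
    μ ∗ gaussianReal 0 τ = volume.withDensity fun x => ENNReal.ofReal (smooth (ker τ) μ x) := by
  have := gaussianReal_of_var_ne_zero 0 hτ.ne'
  have hs : SFinite ((volume : Measure ℝ).withDensity (gaussianPDF 0 τ)) := by
    rw [← this]; infer_instance
  rw [this, conv_withDensity volume (measurable_gaussianPDF 0 τ) μ]
  congr with x
  exact (ofReal_integral_eq_lintegral_ofReal
    (integrable_translate (continuous_ker τ) (abs_ker_le hτ) μ x)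
    (.of_forall fun s => (ker_pos hτ _).le)).symm

theorem integrable_conv_iff (hτ : 0 < τ) (μ : Measure ℝ) [IsProbabilityMeasure μ] (f : ℝ → ℝ) :
    Integrable f (μ ∗ gaussianReal 0 τ) ↔ Integrable fun x => f x * smooth (ker τ) μ x := by
  rw [conv_gaussianReal_eq hτ, integrable_withDensity_iff
    (continuous_smooth_ker hτ μ).measurable.ennreal_ofReal (.of_forall fun _ => by simp)]
  simp_rw [ENNReal.toReal_ofReal (smooth_ker_pos hτ μ _).le]

theorem integral_conv_eq (hτ : 0 < τ) (μ : Measure ℝ) [IsProbabilityMeasure μ] (f : ℝ → ℝ) :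
    ∫ x, f x ∂(μ ∗ gaussianReal 0 τ) = ∫ x, f x * smooth (ker τ) μ x := by
  rw [conv_gaussianReal_eq hτ, integral_withDensity_eq_integral_toReal_smul
    (continuous_smooth_ker hτ μ).measurable.ennreal_ofReal (.of_forall fun _ => by simp)]
  simp_rw [ENNReal.toReal_ofReal (smooth_ker_pos hτ μ _).le, smul_eq_mul, mul_comm]

/-- The distribution function is a constant plus the integral of a continuous function, so its
derivative is that function at every point and not only almost everywhere. -/
theorem density_conv (hτ : 0 < τ) (μ : Measure ℝ) [IsProbabilityMeasure μ] :
    density (μ ∗ gaussianReal 0 τ) = smooth (ker τ) μ := by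
  have hc := continuous_smooth_ker hτ μ
  have hi := integrable_smooth (continuous_ker τ) (integrable_ker τ) μ
  have hcdf : ∀ x, cdf (μ ∗ gaussianReal 0 τ) x
      = (∫ t in Set.Iic 0, smooth (ker τ) μ t) + ∫ t in (0 : ℝ)..x, smooth (ker τ) μ t := by
    intro x
    rw [← intervalIntegral.integral_Iic_sub_Iic hi.integrableOn hi.integrableOn, cdf_eq_real,
      measureReal_def, conv_gaussianReal_eq hτ, withDensity_apply _ measurableSet_Iic,
      ← ofReal_integral_eq_lintegral_ofReal hi.integrableOn
        (.of_forall fun s => (smooth_ker_pos hτ μ _).le),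
      ENNReal.toReal_ofReal (integral_nonneg fun s => (smooth_ker_pos hτ μ _).le)]
    ring
  funext x
  rw [density, funext hcdf]
  exact ((intervalIntegral.integral_hasDerivAt_right (hc.intervalIntegrable _ _)
    (hc.stronglyMeasurableAtFilter _ _) hc.continuousAt).const_add _).deriv

theorem score_conv (hτ : 0 < τ) (μ : Measure ℝ) [IsProbabilityMeasure μ] (x : ℝ) :
    score (μ ∗ gaussianReal 0 τ) x = smooth (ker' τ) μ x / smooth (ker τ) μ x := by
  rw [score, density_conv hτ, (hasDerivAt_smooth_ker hτ μ x).deriv]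

theorem continuous_score (hτ : 0 < τ) (μ : Measure ℝ) [IsProbabilityMeasure μ] :
    Continuous (score (μ ∗ gaussianReal 0 τ)) := by
  rw [funext (score_conv hτ μ)]
  exact (continuous_smooth_ker' hτ μ).div (continuous_smooth_ker hτ μ)
    fun x => (smooth_ker_pos hτ μ x).ne'

theorem score_mul_density (hτ : 0 < τ) (μ : Measure ℝ) [IsProbabilityMeasure μ] (x : ℝ) :
    score (μ ∗ gaussianReal 0 τ) x * smooth (ker τ) μ x = smooth (ker' τ) μ x := by
  rw [score_conv hτ, div_mul_cancel₀ _ (smooth_ker_pos hτ μ x).ne']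

/-- The Cauchy-Schwarz inequality for the smoothed kernels. -/
theorem score_sq_mul_density_le (hτ : 0 < τ) (μ : Measure ℝ) [IsProbabilityMeasure μ] (x : ℝ) :
    score (μ ∗ gaussianReal 0 τ) x ^ 2 * smooth (ker τ) μ x ≤ smooth (kerSq τ) μ x := by
  set c := score (μ ∗ gaussianReal 0 τ) x with hc
  have h0 := integrable_translate (continuous_ker τ) (abs_ker_le hτ) μ x
  have h1 := integrable_translate (continuous_ker' τ) (abs_ker'_le hτ) μ x
  have h2 := integrable_translate (continuous_kerSq τ) (abs_kerSq_le hτ) μ x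
  -- The integrand is `((x-s)/τ + c)²` times the kernel. Taking `c` to be the score itself is the
  -- optimal choice and gives Cauchy-Schwarz.
  have h : 0 ≤ ∫ s, (kerSq τ (x - s) - 2 * c * ker' τ (x - s) + c ^ 2 * ker τ (x - s)) ∂μ := by
    refine integral_nonneg fun s => ?_
    have : kerSq τ (x - s) - 2 * c * ker' τ (x - s) + c ^ 2 * ker τ (x - s)
        = ((x - s) / τ + c) ^ 2 * ker τ (x - s) := by
      rw [kerSq, ker']
      ring
    simp only [Pi.zero_apply, this]
    exact mul_nonneg (sq_nonneg _) (ker_pos hτ _).le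
  have h3 : Integrable (fun s => kerSq τ (x - s) - 2 * c * ker' τ (x - s)) μ :=
    h2.sub (h1.const_mul (2 * c))
  rw [integral_add h3 (h0.const_mul _), integral_sub h2 (h1.const_mul _),
    integral_const_mul, integral_const_mul] at h
  change 0 ≤ smooth (kerSq τ) μ x - 2 * c * smooth (ker' τ) μ x + c ^ 2 * smooth (ker τ) μ x at h
  rw [← score_mul_density hτ μ x, ← hc] at h
  linarith

theorem integrable_score_sq_mul_density (hτ : 0 < τ) (μ : Measure ℝ) [IsProbabilityMeasure μ] :
    Integrable fun x => score (μ ∗ gaussianReal 0 τ) x ^ 2 * smooth (ker τ) μ x := by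
  have h1 := continuous_score hτ μ
  have h2 := continuous_smooth_ker hτ μ
  refine (integrable_smooth (continuous_kerSq τ) (integrable_kerSq hτ) μ).mono'
    (by fun_prop) (.of_forall fun x => ?_)
  rw [Real.norm_of_nonneg (mul_nonneg (sq_nonneg _) (smooth_ker_pos hτ μ x).le)]
  exact score_sq_mul_density_le hτ μ x

/-! ### Moments of the score and bounds for the Fisher information. -/

theorem memLp_score (hτ : 0 < τ) (μ : Measure ℝ) [IsProbabilityMeasure μ] :
    MemLp (score (μ ∗ gaussianReal 0 τ)) 2 (μ ∗ gaussianReal 0 τ) := by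
  rw [memLp_two_iff_integrable_sq (continuous_score hτ μ).aestronglyMeasurable,
    integrable_conv_iff hτ]
  exact integrable_score_sq_mul_density hτ μ

theorem fisherInfo_conv (hτ : 0 < τ) (μ : Measure ℝ) [IsProbabilityMeasure μ] :
    fisherInfo (μ ∗ gaussianReal 0 τ)
      = ∫ x, score (μ ∗ gaussianReal 0 τ) x ^ 2 * smooth (ker τ) μ x := by
  rw [fisherInfo, integral_conv_eq hτ]

theorem fisherInfo_conv_le (hτ : 0 < τ) (μ : Measure ℝ) [IsProbabilityMeasure μ] :
    fisherInfo (μ ∗ gaussianReal 0 τ) ≤ 1 / τ := by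
  rw [fisherInfo_conv hτ, ← integral_kerSq hτ,
    ← integral_smooth (continuous_kerSq τ) (integrable_kerSq hτ) μ]
  exact integral_mono (integrable_score_sq_mul_density hτ μ)
    (integrable_smooth (continuous_kerSq τ) (integrable_kerSq hτ) μ)
    fun x => score_sq_mul_density_le hτ μ x

theorem integral_score (hτ : 0 < τ) (μ : Measure ℝ) [IsProbabilityMeasure μ] :
    ∫ x, score (μ ∗ gaussianReal 0 τ) x ∂(μ ∗ gaussianReal 0 τ) = 0 := by
  rw [integral_conv_eq hτ]
  simp_rw [score_mul_density hτ]
  rw [integral_smooth (continuous_ker' τ) (integrable_ker' hτ), integral_ker' hτ]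

/-- Write `x = (x-s) + s` under the convolution: the first part contributes `∫ y k'(y) dy = -1`, the
second the mean of `μ` times `∫ k' = 0`. -/
theorem integral_mul_score (hτ : 0 < τ) (μ : Measure ℝ) [IsProbabilityMeasure μ]
    (hμ : Integrable id μ) :
    ∫ x, x * score (μ ∗ gaussianReal 0 τ) x ∂(μ ∗ gaussianReal 0 τ) = -1 := by
  have hc := continuous_ker' τ
  have hk : Continuous fun x => x * ker' τ x := by fun_prop
  have hb : ∀ x, |ker' τ x| ≤ _ := abs_ker'_le hτ
  rw [integral_conv_eq hτ]
  have h : ∀ x, x * score (μ ∗ gaussianReal 0 τ) x * smooth (ker τ) μ x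
      = smooth (fun x => x * ker' τ x) μ x + ∫ s, id s * ker' τ (x - s) ∂μ := by
    intro x
    have hs : Integrable (fun s => id s * ker' τ (x - s)) μ :=
      hμ.mul_bdd (by fun_prop) (.of_forall fun s => hb _)
    have hx : Integrable (fun s => x * ker' τ (x - s)) μ :=
      (integrable_translate hc hb μ x).const_mul x
    rw [mul_assoc, score_mul_density hτ, smooth, smooth, ← integral_const_mul, ← integral_add _ hs]
    · congr with s
      simp only [id]
      ring
    · refine (hx.sub hs).congr (.of_forall fun s => ?_)
      simp only [id, Pi.sub_apply]
      ring
  simp_rw [h]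
  rw [integral_add (integrable_smooth hk (integrable_mul_ker' hτ) μ)
    (integrable_weighted_smooth hc (integrable_ker' hτ) continuous_id hμ),
    integral_smooth hk (integrable_mul_ker' hτ), integral_mul_ker' hτ,
    integral_weighted_smooth hc (integrable_ker' hτ) continuous_id hμ, integral_ker' hτ, mul_zero,
    add_zero]

theorem memLp_conv {μ : Measure ℝ} [IsProbabilityMeasure μ] (hμ : MemLp id 2 μ) :
    MemLp id 2 (μ ∗ gaussianReal 0 τ) := by
  rw [Measure.conv, memLp_map_measure_iff (by fun_prop) (by fun_prop)]
  exact (hμ.comp_fst _).add ((memLp_two_gaussianReal τ).comp_snd μ)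

theorem integral_id_conv {μ : Measure ℝ} [IsProbabilityMeasure μ] (hμ : Integrable id μ) :
    ∫ x, x ∂(μ ∗ gaussianReal 0 τ) = ∫ x, x ∂μ := by
  have hg : Integrable id (gaussianReal 0 τ) := (memLp_two_gaussianReal τ).integrable one_le_two
  have h1 : Integrable (fun p : ℝ × ℝ => p.1) (μ.prod (gaussianReal 0 τ)) := hμ.comp_fst _
  have h2 : Integrable (fun p : ℝ × ℝ => p.2) (μ.prod (gaussianReal 0 τ)) := hg.comp_snd μ
  rw [Measure.conv, integral_map (by fun_prop) (by fun_prop), integral_add h1 h2,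
    integral_fun_fst (fun x => x), integral_fun_snd (fun x => x), integral_id_gaussianReal]
  simp

theorem variance_conv {μ : Measure ℝ} [IsProbabilityMeasure μ] (hμ : MemLp id 2 μ) :
    variance id (μ ∗ gaussianReal 0 τ) = variance id μ + τ := by
  have hg := memLp_two_gaussianReal τ
  rw [Measure.conv, variance_map (by fun_prop) (by fun_prop)]
  have : id ∘ (fun x : ℝ × ℝ => x.1 + x.2) = (fun p => id p.1) + fun p => id p.2 := rfl
  rw [this, (indepFun_prod₀ (μ := μ) (ν := gaussianReal 0 τ) hμ.aemeasurable
    hg.aemeasurable).variance_add (hμ.comp_fst _) (hg.comp_snd μ)]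
  have h1 := variance_map (μ := μ.prod (gaussianReal 0 τ)) (X := id) (Y := Prod.fst)
    (by fun_prop) (by fun_prop)
  have h2 := variance_map (μ := μ.prod (gaussianReal 0 τ)) (X := id) (Y := Prod.snd)
    (by fun_prop) (by fun_prop)
  rw [Measure.map_fst_prod] at h1
  rw [Measure.map_snd_prod] at h2
  simp only [measure_univ, one_smul, variance_id_gaussianReal] at h1 h2
  rw [h1, h2]
  rfl

theorem variance_conv_pos (hτ : 0 < τ) {μ : Measure ℝ} [IsProbabilityMeasure μ]
    (hμ : MemLp id 2 μ) : 0 < variance id (μ ∗ gaussianReal 0 τ) := by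
  rw [variance_conv hμ]
  exact add_pos_of_nonneg_of_pos (variance_nonneg _ _) hτ

/-- The Cramér-Rao inequality. -/
theorem stFisherInfo_nonneg (hτ : 0 < τ) {μ : Measure ℝ} [IsProbabilityMeasure μ]
    (hμ : MemLp id 2 μ) : 0 ≤ stFisherInfo (μ ∗ gaussianReal 0 τ) := by
  set L := μ ∗ gaussianReal 0 τ with hL
  set v := variance id L with hv
  have hv0 : 0 < v := variance_conv_pos hτ hμ
  have hid : MemLp id 2 L := memLp_conv hμ
  have hs : MemLp (score L) 2 L := memLp_score hτ μ
  set a := ∫ x, x ∂L with ha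
  have hidc : MemLp (fun x => x - a) 2 L := hid.sub (memLp_const a)
  have h1 : Integrable (fun x => (x - a) * score L x) L := hidc.integrable_mul hs
  have h1' : Integrable (fun x => x * score L x) L := hid.integrable_mul hs
  have e1 : ∫ x, (x - a) * score L x ∂L = -1 := by
    simp_rw [sub_mul]
    rw [integral_sub h1' ((hs.integrable one_le_two).const_mul a), integral_const_mul,
      integral_score hτ, integral_mul_score hτ μ (hμ.integrable one_le_two)]
    simp
  have e2 : ∫ x, (x - a) ^ 2 ∂L = v := by
    rw [hv, variance_eq_integral (by fun_prop)]
    rfl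
  -- The combination `vρ(x) + (x-a)` vanishes identically for a normal law; its square integrates to
  -- `v(vJ - 1)`.
  have key : 0 ≤ ∫ x, (v * score L x + (x - a)) ^ 2 ∂L := integral_nonneg fun _ => sq_nonneg _
  have e3 : ∫ x, (v * score L x + (x - a)) ^ 2 ∂L = v ^ 2 * fisherInfo L + 2 * v * (-1) + v := by
    have i1 := hs.integrable_sq.const_mul (v ^ 2)
    have i2 := h1.const_mul (2 * v)
    have i3 : Integrable (fun x => v ^ 2 * score L x ^ 2 + 2 * v * ((x - a) * score L x)) L :=
      i1.add i2
    have : ∀ x, (v * score L x + (x - a)) ^ 2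
        = v ^ 2 * score L x ^ 2 + 2 * v * ((x - a) * score L x) + (x - a) ^ 2 := fun x => by ring
    simp_rw [this]
    rw [integral_add i3 hidc.integrable_sq, integral_add i1 i2, integral_const_mul,
      integral_const_mul, e1, e2, fisherInfo]
  rw [e3] at key
  have : 0 ≤ v * (v * fisherInfo L - 1) := by linarith
  exact nonneg_of_mul_nonneg_right this hv0

theorem stFisherInfo_le (hτ : 0 < τ) {μ : Measure ℝ} [IsProbabilityMeasure μ]
    (hμ : MemLp id 2 μ) : stFisherInfo (μ ∗ gaussianReal 0 τ) ≤ variance id μ / τ := by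
  have hτ' : (0 : ℝ) < τ := hτ
  rw [stFisherInfo, variance_conv hμ]
  have := mul_le_mul_of_nonneg_left (fisherInfo_conv_le hτ μ)
    (add_nonneg (variance_nonneg id μ) hτ'.le)
  calc _ ≤ (variance id μ + τ) * (1 / τ) - 1 := by linarith
    _ = _ := by field_simp; ring

/-- A law with an affine score is normal, so its standardised Fisher information vanishes. -/
theorem stFisherInfo_eq_zero_of_affine (hτ : 0 < τ) {μ : Measure ℝ} [IsProbabilityMeasure μ]
    (hμ : MemLp id 2 μ) {a b : ℝ} (h : ∀ x, score (μ ∗ gaussianReal 0 τ) x = a * x + b) :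
    stFisherInfo (μ ∗ gaussianReal 0 τ) = 0 := by
  have hid : MemLp id 2 (μ ∗ gaussianReal 0 τ) := memLp_conv hμ
  have hs := memLp_score hτ μ
  have s0 := integral_score hτ μ
  have s1 := integral_mul_score hτ μ (hμ.integrable one_le_two)
  have hi : Integrable (fun x => x) (μ ∗ gaussianReal 0 τ) := hid.integrable one_le_two
  have hi2 : Integrable (fun x => x ^ 2) (μ ∗ gaussianReal 0 τ) := hid.integrable_sq
  have hxs : Integrable (fun x => x * score (μ ∗ gaussianReal 0 τ) x) (μ ∗ gaussianReal 0 τ) :=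
    hid.integrable_mul hs
  -- For an affine score the identities `E ρ = 0` and `E Uρ = -1` give `aσ² = -1`, while `J = E ρ(aU
  -- + b) = -a`.
  have e0 : a * (∫ x, x ∂(μ ∗ gaussianReal 0 τ)) + b = 0 := by
    refine Eq.trans ?_ s0
    simp_rw [h]
    rw [integral_add (hi.const_mul a) (integrable_const b), integral_const_mul]
    simp
  have e1 : a * (∫ x, x ^ 2 ∂(μ ∗ gaussianReal 0 τ)) + b * ∫ x, x ∂(μ ∗ gaussianReal 0 τ)
      = -1 := by
    refine Eq.trans ?_ s1
    rw [← integral_const_mul, ← integral_const_mul,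
      ← integral_add (hi2.const_mul a) (hi.const_mul b)]
    congr with x
    rw [h]
    ring
  have e2 : fisherInfo (μ ∗ gaussianReal 0 τ) = -a := by
    have : ∀ x, score (μ ∗ gaussianReal 0 τ) x ^ 2 = a * (x * score (μ ∗ gaussianReal 0 τ) x)
        + b * score (μ ∗ gaussianReal 0 τ) x := by
      intro x
      rw [h]
      ring
    simp_rw [fisherInfo, this]
    rw [integral_add (hxs.const_mul a) ((hs.integrable one_le_two).const_mul b),
      integral_const_mul, integral_const_mul, s0, s1]
    ring
  have e3 := variance_eq_sub hid
  simp only [Pi.pow_apply, id] at e3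
  rw [stFisherInfo, e2, e3]
  linear_combination (-1) * e1 + (∫ x, x ∂(μ ∗ gaussianReal 0 τ)) * e0

end

section

/-! ### Continuity of the score and of the Fisher information -/

/-- Dominated convergence for nonnegative functions with converging bounds. -/
theorem tendsto_integral_of_tendsto_bound {α : Type*} [MeasurableSpace α] {m : Measure α}
    {F G : ℕ → α → ℝ} {f g : α → ℝ} (hF : ∀ n, AEStronglyMeasurable (F n) m)
    (hG : ∀ n, Integrable (G n) m) (hg : Integrable g m) (h0 : ∀ n x, 0 ≤ F n x)
    (hFG : ∀ n x, F n x ≤ G n x) (hf : ∀ x, Tendsto (fun n => F n x) atTop (𝓝 (f x)))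
    (hGg : ∀ x, Tendsto (fun n => G n x) atTop (𝓝 (g x)))
    (hint : Tendsto (fun n => ∫ x, G n x ∂m) atTop (𝓝 (∫ x, g x ∂m))) :
    Tendsto (fun n => ∫ x, F n x ∂m) atTop (𝓝 (∫ x, f x ∂m)) := by
  have hg0 : ∀ x, 0 ≤ g x := fun x =>
    ge_of_tendsto' (hGg x) fun n => (h0 n x).trans (hFG n x)
  have hfg : ∀ x, f x ≤ g x := fun x => le_of_tendsto_of_tendsto' (hf x) (hGg x) fun n => hFG n x
  have hFi : ∀ n, Integrable (F n) m := fun n => (hG n).mono' (hF n) (.of_forall fun x => by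
    rw [Real.norm_of_nonneg (h0 n x)]
    exact hFG n x)
  -- `F` splits into `min F g`, dominated by `g`, and a rest at most `(G-g)⁺ = (G-g) + (g-G)⁺`. The
  -- integral of the rest vanishes in the limit by `hint` and because `(g-G)⁺ ≤ g`.
  have hmin : Tendsto (fun n => ∫ x, min (F n x) (g x) ∂m) atTop (𝓝 (∫ x, f x ∂m)) := by
    refine tendsto_integral_of_dominated_convergence g (fun n => ?_) hg
      (fun n => .of_forall fun x => ?_) (.of_forall fun x => ?_)
    · exact (hF n).inf hg.aestronglyMeasurable
    · rw [Real.norm_of_nonneg (le_min (h0 n x) (hg0 x))]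
      exact min_le_right _ _
    · have := (hf x).min (tendsto_const_nhds (x := g x))
      rwa [min_eq_left (hfg x)] at this
  have hneg : Tendsto (fun n => ∫ x, max (g x - G n x) 0 ∂m) atTop (𝓝 0) := by
    suffices h : Tendsto (fun n => ∫ x, max (g x - G n x) 0 ∂m) atTop (𝓝 (∫ _, 0 ∂m)) by
      rwa [integral_zero] at h
    refine tendsto_integral_of_dominated_convergence g (fun n => ?_) hg
      (fun n => .of_forall fun x => ?_) (.of_forall fun x => ?_)
    · exact (hg.sub (hG n)).pos_part.aestronglyMeasurable
    · rw [Real.norm_of_nonneg (le_max_right _ _)]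
      exact max_le (sub_le_self _ ((h0 n x).trans (hFG n x))) (hg0 x)
    · have := ((tendsto_const_nhds (x := g x)).sub (hGg x)).max (tendsto_const_nhds (x := (0 : ℝ)))
      simpa using this
  have hrest : Tendsto (fun n => ∫ x, (F n x - min (F n x) (g x)) ∂m) atTop (𝓝 0) := by
    have hu : Tendsto (fun n => (∫ x, G n x ∂m) - (∫ x, g x ∂m)
        + ∫ x, max (g x - G n x) 0 ∂m) atTop (𝓝 0) := by
      simpa using (hint.sub_const (∫ x, g x ∂m)).add hneg
    refine squeeze_zero (fun n => integral_nonneg fun x => sub_nonneg.2 (min_le_left _ _))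
      (fun n => ?_) hu
    have hi : Integrable (fun x => max (g x - G n x) 0) m := (hg.sub (hG n)).pos_part
    have hi' : Integrable (fun x => G n x - g x) m := (hG n).sub hg
    rw [← integral_sub (hG n) hg, ← integral_add hi' hi]
    refine integral_mono ((hFi n).sub ((hFi n).inf hg)) (hi'.add hi) fun x => ?_
    have h1 := hFG n x
    rcases le_total (F n x) (g x) with h | h
    · simp only [min_eq_left h, sub_self]
      linarith [le_max_left (g x - G n x) 0]
    · simp only [min_eq_right h]
      linarith [le_max_right (g x - G n x) 0]
  have := hmin.add hrest
  rw [add_zero] at this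
  refine this.congr fun n => ?_
  have h1 : Integrable (fun x => min (F n x) (g x)) m := (hFi n).inf hg
  have h2 : Integrable (fun x => F n x - min (F n x) (g x)) m := (hFi n).sub h1
  rw [← integral_add h1 h2]
  congr with x
  ring

variable {τ : ℝ≥0} {μs : ℕ → ProbabilityMeasure ℝ} {μ : ProbabilityMeasure ℝ}

/-- The point varies together with the law because the score of `√β X + √(1-β) Y` is evaluated at a
point that depends on `β`. -/
theorem tendsto_score (hτ : 0 < τ) (hμ : Tendsto μs atTop (𝓝 μ)) {xs : ℕ → ℝ} {x : ℝ}
    (hx : Tendsto xs atTop (𝓝 x)) :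
    Tendsto (fun n => score ((μs n : Measure ℝ) ∗ gaussianReal 0 τ) (xs n)) atTop
      (𝓝 (score ((μ : Measure ℝ) ∗ gaussianReal 0 τ) x)) := by
  simp_rw [score_conv hτ]
  exact (tendsto_smooth (uniformContinuous_ker' hτ) (abs_ker'_le hτ) hμ hx).div
    (tendsto_smooth (uniformContinuous_ker hτ) (abs_ker_le hτ) hμ hx)
    (smooth_ker_pos hτ _ _).ne'

/-- The integrands are bounded by the smoothed `kerSq`. These bounds converge pointwise and all have
integral `1/τ`, which is what `tendsto_integral_of_tendsto_bound` requires. -/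
theorem tendsto_fisherInfo (hτ : 0 < τ) (hμ : Tendsto μs atTop (𝓝 μ)) :
    Tendsto (fun n => fisherInfo ((μs n : Measure ℝ) ∗ gaussianReal 0 τ)) atTop
      (𝓝 (fisherInfo ((μ : Measure ℝ) ∗ gaussianReal 0 τ))) := by
  simp_rw [fisherInfo_conv hτ]
  have hi : ∀ μ : ProbabilityMeasure ℝ, Integrable (smooth (kerSq τ) μ) := fun μ =>
    integrable_smooth (continuous_kerSq τ) (integrable_kerSq hτ) μ
  refine tendsto_integral_of_tendsto_bound (G := fun n => smooth (kerSq τ) (μs n))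
    (fun n => (integrable_score_sq_mul_density hτ _).aestronglyMeasurable) (fun n => hi _) (hi μ)
    (fun n x => mul_nonneg (sq_nonneg _) (smooth_ker_pos hτ _ x).le)
    (fun n x => score_sq_mul_density_le hτ _ x) (fun x => ?_)
    (tendsto_smooth_const (continuous_kerSq τ) (abs_kerSq_le hτ) hμ) ?_
  · exact ((tendsto_score hτ hμ tendsto_const_nhds).pow 2).mul
      (tendsto_smooth_const (continuous_ker τ) (abs_ker_le hτ) hμ x)
  · simp_rw [integral_smooth (continuous_kerSq τ) (integrable_kerSq hτ)]
    exact tendsto_const_nhds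

/-! ### Perturbed joint laws -/

/-- The condition `a² + b² = 1` makes the combined noise `aZ_S + bZ_T` again `N(0, τ)`, so the score
of every such combination falls under the results for smoothed laws. -/
theorem perturb_map (τ : ℝ≥0) (μ : Measure (ℝ × ℝ)) [IsProbabilityMeasure μ] {a b : ℝ}
    (hab : a ^ 2 + b ^ 2 = 1) :
    (perturb τ μ).map (fun p => a * p.1 + b * p.2)
      = μ.map (fun p => a * p.1 + b * p.2) ∗ gaussianReal 0 τ := by
  let L : ℝ × ℝ →L[ℝ] ℝ := a • ContinuousLinearMap.fst ℝ ℝ ℝ + b • ContinuousLinearMap.snd ℝ ℝ ℝ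
  have hL : (fun p : ℝ × ℝ => a * p.1 + b * p.2) = L := by
    funext p
    simp [L]
  have hγ : ((gaussianReal 0 τ).prod (gaussianReal 0 τ)).map L = gaussianReal 0 τ := by
    have h : (L : ℝ × ℝ → ℝ) = (fun p : ℝ × ℝ => p.1 + p.2) ∘ Prod.map (a * ·) (b * ·) := by
      rw [← hL]
      rfl
    rw [h, ← Measure.map_map (by fun_prop) (by fun_prop),
      ← Measure.map_prod_map _ _ (by fun_prop) (by fun_prop)]
    change (gaussianReal 0 τ).map (a * ·) ∗ (gaussianReal 0 τ).map (b * ·) = _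
    rw [gaussianReal_map_const_mul, gaussianReal_map_const_mul, gaussianReal_conv_gaussianReal]
    congr 1
    · simp
    · ext
      push_cast
      rw [← add_mul]
      simp [hab]
  rw [hL]
  change (μ ∗ (gaussianReal 0 τ).prod (gaussianReal 0 τ)).map L = _
  rw [Measure.map_conv_continuousLinearMap, hγ]

theorem perturb_map_fst (τ : ℝ≥0) (μ : Measure (ℝ × ℝ)) [IsProbabilityMeasure μ] :
    (perturb τ μ).map Prod.fst = μ.map Prod.fst ∗ gaussianReal 0 τ := by
  simpa using perturb_map τ μ (a := 1) (b := 0) (by norm_num)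

theorem perturb_map_snd (τ : ℝ≥0) (μ : Measure (ℝ × ℝ)) [IsProbabilityMeasure μ] :
    (perturb τ μ).map Prod.snd = μ.map Prod.snd ∗ gaussianReal 0 τ := by
  simpa using perturb_map τ μ (a := 0) (b := 1) (by norm_num)

/-- The density of a perturbed joint law. -/
def jointDensity (τ : ℝ≥0) (μ : Measure (ℝ × ℝ)) (p : ℝ × ℝ) : ℝ :=
  ∫ q, ker τ (p.1 - q.1) * ker τ (p.2 - q.2) ∂μ

theorem jointDensity_bound (hτ : 0 < τ) (p q : ℝ × ℝ) :
    |ker τ (p.1 - q.1) * ker τ (p.2 - q.2)| ≤ ker τ 0 * ker τ 0 := by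
  rw [abs_mul]
  exact mul_le_mul (abs_ker_le hτ _) (abs_ker_le hτ _) (abs_nonneg _) (ker_pos hτ 0).le

theorem integrable_joint_ker (hτ : 0 < τ) (μ : Measure (ℝ × ℝ)) [IsProbabilityMeasure μ]
    (p : ℝ × ℝ) : Integrable (fun q => ker τ (p.1 - q.1) * ker τ (p.2 - q.2)) μ := by
  have := continuous_ker τ
  exact Integrable.of_bound (by fun_prop) _ (.of_forall fun q => jointDensity_bound hτ p q)

theorem jointDensity_pos (hτ : 0 < τ) (μ : Measure (ℝ × ℝ)) [IsProbabilityMeasure μ]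
    (p : ℝ × ℝ) : 0 < jointDensity τ μ p := by
  have h : ∀ q : ℝ × ℝ, 0 < ker τ (p.1 - q.1) * ker τ (p.2 - q.2) := fun q =>
    mul_pos (ker_pos hτ _) (ker_pos hτ _)
  rw [jointDensity, integral_pos_iff_support_of_nonneg (fun q => (h q).le)
    (integrable_joint_ker hτ μ p)]
  have : (Function.support fun q : ℝ × ℝ => ker τ (p.1 - q.1) * ker τ (p.2 - q.2))
      = Set.univ := by
    ext q
    simp only [Function.mem_support, Set.mem_univ, iff_true]
    exact (h q).ne'
  simp [this]

theorem measurable_jointDensity (τ : ℝ≥0) (μ : Measure (ℝ × ℝ)) [IsProbabilityMeasure μ] :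
    Measurable (jointDensity τ μ) := by
  have := continuous_ker τ
  exact (StronglyMeasurable.integral_prod_right'
    (f := fun r : (ℝ × ℝ) × (ℝ × ℝ) => ker τ (r.1.1 - r.2.1) * ker τ (r.1.2 - r.2.2))
    (by fun_prop)).measurable

theorem perturb_eq_withDensity (hτ : 0 < τ) (μ : Measure (ℝ × ℝ)) [IsProbabilityMeasure μ] :
    perturb τ μ = volume.withDensity fun p => ENNReal.ofReal (jointDensity τ μ p) := by
  have hm := (continuous_ker τ).measurable
  have hg : (gaussianReal 0 τ).prod (gaussianReal 0 τ) = (volume : Measure (ℝ × ℝ)).withDensity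
      fun p => ENNReal.ofReal (ker τ p.1 * ker τ p.2) := by
    rw [gaussianReal_of_var_ne_zero 0 hτ.ne', prod_withDensity (by fun_prop) (by fun_prop)]
    congr with p
    rw [ENNReal.ofReal_mul (ker_pos hτ _).le]
    rfl
  have hs : SFinite ((volume : Measure (ℝ × ℝ)).withDensity
      fun p => ENNReal.ofReal (ker τ p.1 * ker τ p.2)) := by
    rw [← hg]
    infer_instance
  change μ ∗ (gaussianReal 0 τ).prod (gaussianReal 0 τ) = _
  rw [hg, conv_withDensity volume (by fun_prop) μ]
  congr with p
  exact (ofReal_integral_eq_lintegral_ofReal (integrable_joint_ker hτ μ p)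
    (.of_forall fun q => (mul_pos (ker_pos hτ _) (ker_pos hτ _)).le)).symm

theorem tendsto_jointDensity (hτ : 0 < τ) {κs : ℕ → ProbabilityMeasure (ℝ × ℝ)}
    {κ : ProbabilityMeasure (ℝ × ℝ)} (hκ : Tendsto κs atTop (𝓝 κ)) (p : ℝ × ℝ) :
    Tendsto (fun n => jointDensity τ (κs n) p) atTop (𝓝 (jointDensity τ κ p)) := by
  have := continuous_ker τ
  exact (ProbabilityMeasure.tendsto_iff_forall_integral_tendsto.1 hκ)
    (BoundedContinuousFunction.ofNormedAddCommGroup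
      (fun q => ker τ (p.1 - q.1) * ker τ (p.2 - q.2)) (by fun_prop) _
      fun q => jointDensity_bound hτ p q)

/-! ### The score gap -/

/-- The integrand of the score gap. -/
def gapFun (τ : ℝ≥0) (μ : Measure (ℝ × ℝ)) (β : ℝ) (p : ℝ × ℝ) : ℝ :=
  √β * score (μ.map Prod.fst ∗ gaussianReal 0 τ) p.1
    + √(1 - β) * score (μ.map Prod.snd ∗ gaussianReal 0 τ) p.2
    - score (μ.map (fun q => √β * q.1 + √(1 - β) * q.2) ∗ gaussianReal 0 τ)
      (√β * p.1 + √(1 - β) * p.2)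

theorem sqrt_sq_add_sqrt_sq {β : ℝ} (hβ : β ∈ Set.Icc (0 : ℝ) 1) :
    √β ^ 2 + √(1 - β) ^ 2 = 1 := by
  rw [Real.sq_sqrt hβ.1, Real.sq_sqrt (sub_nonneg.2 hβ.2)]
  ring

theorem scoreGap_perturb (τ : ℝ≥0) (μ : Measure (ℝ × ℝ)) [IsProbabilityMeasure μ] {β : ℝ}
    (hβ : β ∈ Set.Icc (0 : ℝ) 1) :
    scoreGap (perturb τ μ) β = ∫ p, gapFun τ μ β p ^ 2 ∂perturb τ μ := by
  rw [scoreGap, perturb_map_fst, perturb_map_snd, perturb_map τ μ (sqrt_sq_add_sqrt_sq hβ)]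
  rfl

theorem scoreGap_nonneg (κ : Measure (ℝ × ℝ)) (β : ℝ) : 0 ≤ scoreGap κ β :=
  integral_nonneg fun _ => sq_nonneg _

theorem isProbabilityMeasure_map_of_continuous {μ : Measure (ℝ × ℝ)} [IsProbabilityMeasure μ]
    {f : ℝ × ℝ → ℝ} (hf : Continuous f) : IsProbabilityMeasure (μ.map f) :=
  Measure.isProbabilityMeasure_map hf.measurable.aemeasurable

theorem continuous_gapFun (hτ : 0 < τ) (μ : Measure (ℝ × ℝ)) [IsProbabilityMeasure μ] (β : ℝ) :
    Continuous (gapFun τ μ β) := by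
  have i1 := isProbabilityMeasure_map_of_continuous (μ := μ) (f := Prod.fst) (by fun_prop)
  have i2 := isProbabilityMeasure_map_of_continuous (μ := μ) (f := Prod.snd) (by fun_prop)
  have i3 := isProbabilityMeasure_map_of_continuous (μ := μ)
    (f := fun q => √β * q.1 + √(1 - β) * q.2) (by fun_prop)
  have h1 := continuous_score hτ (μ.map Prod.fst)
  have h2 := continuous_score hτ (μ.map Prod.snd)
  have h3 := continuous_score hτ (μ.map fun q => √β * q.1 + √(1 - β) * q.2)
  unfold gapFun
  fun_prop

theorem memLp_score_linear (hτ : 0 < τ) (μ : Measure (ℝ × ℝ)) [IsProbabilityMeasure μ] {a b : ℝ}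
    (hab : a ^ 2 + b ^ 2 = 1) :
    MemLp (fun p : ℝ × ℝ => score (μ.map (fun q => a * q.1 + b * q.2) ∗ gaussianReal 0 τ)
      (a * p.1 + b * p.2)) 2 (perturb τ μ) := by
  have i := isProbabilityMeasure_map_of_continuous (μ := μ)
    (f := fun q => a * q.1 + b * q.2) (by fun_prop)
  have h := memLp_score hτ (μ.map fun q => a * q.1 + b * q.2)
  rw [← perturb_map τ μ hab] at h
  rw [← perturb_map τ μ hab]
  exact h.comp_of_map (by fun_prop)

theorem integral_score_linear_sq (hτ : 0 < τ) (μ : Measure (ℝ × ℝ)) [IsProbabilityMeasure μ]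
    {a b : ℝ} (hab : a ^ 2 + b ^ 2 = 1) :
    ∫ p : ℝ × ℝ, score (μ.map (fun q => a * q.1 + b * q.2) ∗ gaussianReal 0 τ)
      (a * p.1 + b * p.2) ^ 2 ∂perturb τ μ
      = fisherInfo (μ.map (fun q => a * q.1 + b * q.2) ∗ gaussianReal 0 τ) := by
  have i := isProbabilityMeasure_map_of_continuous (μ := μ)
    (f := fun q => a * q.1 + b * q.2) (by fun_prop)
  have hc := continuous_score hτ (μ.map fun q => a * q.1 + b * q.2)
  rw [fisherInfo, ← perturb_map τ μ hab, integral_map (by fun_prop)]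
  rw [perturb_map τ μ hab]
  fun_prop

theorem memLp_score_fst (hτ : 0 < τ) (μ : Measure (ℝ × ℝ)) [IsProbabilityMeasure μ] :
    MemLp (fun p : ℝ × ℝ => score (μ.map Prod.fst ∗ gaussianReal 0 τ) p.1) 2 (perturb τ μ) := by
  simpa using memLp_score_linear hτ μ (a := 1) (b := 0) (by norm_num)

theorem memLp_score_snd (hτ : 0 < τ) (μ : Measure (ℝ × ℝ)) [IsProbabilityMeasure μ] :
    MemLp (fun p : ℝ × ℝ => score (μ.map Prod.snd ∗ gaussianReal 0 τ) p.2) 2 (perturb τ μ) := by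
  simpa using memLp_score_linear hτ μ (a := 0) (b := 1) (by norm_num)

theorem integral_score_snd_sq (hτ : 0 < τ) (μ : Measure (ℝ × ℝ)) [IsProbabilityMeasure μ] :
    ∫ p : ℝ × ℝ, score (μ.map Prod.snd ∗ gaussianReal 0 τ) p.2 ^ 2 ∂perturb τ μ
      = fisherInfo (μ.map Prod.snd ∗ gaussianReal 0 τ) := by
  simpa using integral_score_linear_sq hτ μ (a := 0) (b := 1) (by norm_num)

theorem memLp_gapFun (hτ : 0 < τ) (μ : Measure (ℝ × ℝ)) [IsProbabilityMeasure μ] {β : ℝ}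
    (hβ : β ∈ Set.Icc (0 : ℝ) 1) : MemLp (gapFun τ μ β) 2 (perturb τ μ) :=
  (((memLp_score_fst hτ μ).const_mul _).add ((memLp_score_snd hτ μ).const_mul _)).sub
    (memLp_score_linear hτ μ (sqrt_sq_add_sqrt_sq hβ))

/-- Moving the joint law into the integrand leaves a fixed reference measure, so that Fatou's lemma
applies along varying laws. -/
theorem ofReal_scoreGap (hτ : 0 < τ) (μ : Measure (ℝ × ℝ)) [IsProbabilityMeasure μ] {β : ℝ}
    (hβ : β ∈ Set.Icc (0 : ℝ) 1) :
    ENNReal.ofReal (scoreGap (perturb τ μ) β)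
      = ∫⁻ p, ENNReal.ofReal (jointDensity τ μ p * gapFun τ μ β p ^ 2) := by
  have hd := measurable_jointDensity τ μ
  have hc := (continuous_gapFun hτ μ β).measurable
  rw [scoreGap_perturb τ μ hβ, ofReal_integral_eq_lintegral_ofReal
    (memLp_gapFun hτ μ hβ).integrable_sq (.of_forall fun _ => sq_nonneg _)]
  conv_lhs => rw [perturb_eq_withDensity hτ]
  rw [lintegral_withDensity_eq_lintegral_mul _ (by fun_prop) (by fun_prop)]
  refine lintegral_congr fun p => ?_
  rw [ENNReal.ofReal_mul (jointDensity_pos hτ μ p).le]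
  rfl

end

section

/-! ### Weak convergence of smoothed laws and of their moments -/

/-- A probability measure, bundled. -/
def bundle {α : Type*} [MeasurableSpace α] (μ : Measure α) [h : IsProbabilityMeasure μ] :
    ProbabilityMeasure α := ⟨μ, h⟩

@[simp]
theorem coe_bundle {α : Type*} [MeasurableSpace α] (μ : Measure α) [IsProbabilityMeasure μ] :
    (bundle μ : Measure α) = μ := rfl

instance {α β : Type*} [MeasurableSpace α] [TopologicalSpace α] [OpensMeasurableSpace α]
    [MeasurableSpace β] [TopologicalSpace β] [BorelSpace β] (μ : Measure α)
    [IsProbabilityMeasure μ] (f : C(α, β)) : IsProbabilityMeasure (μ.map f) :=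
  Measure.isProbabilityMeasure_map f.continuous.measurable.aemeasurable

theorem tendsto_conv_gaussianReal {τ : ℝ≥0} {μs : ℕ → ProbabilityMeasure ℝ}
    {μ : ProbabilityMeasure ℝ} (hμ : Tendsto μs atTop (𝓝 μ)) :
    Tendsto (fun n => bundle ((μs n : Measure ℝ) ∗ gaussianReal 0 τ)) atTop
      (𝓝 (bundle ((μ : Measure ℝ) ∗ gaussianReal 0 τ))) := by
  rw [ProbabilityMeasure.tendsto_iff_tendsto_charFun] at hμ ⊢
  intro t
  simp_rw [coe_bundle, charFun_conv]
  exact (hμ t).mul_const _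

/-- The linear combination of the coordinates of the plane. -/
def linComb (a b : ℝ) : C(ℝ × ℝ, ℝ) := ⟨fun p => a * p.1 + b * p.2, by fun_prop⟩

/-- Coefficients and law converge jointly: the image law is the image of `δ_{(a,b)} ⊗ κ` under one
fixed continuous map. -/
theorem tendsto_map_linComb {κs : ℕ → ProbabilityMeasure (ℝ × ℝ)} {κ : ProbabilityMeasure (ℝ × ℝ)}
    (hκ : Tendsto κs atTop (𝓝 κ)) {as bs : ℕ → ℝ} {a b : ℝ} (ha : Tendsto as atTop (𝓝 a))
    (hb : Tendsto bs atTop (𝓝 b)) :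
    Tendsto (fun n => bundle ((κs n : Measure (ℝ × ℝ)).map (linComb (as n) (bs n)))) atTop
      (𝓝 (bundle ((κ : Measure (ℝ × ℝ)).map (linComb a b)))) := by
  have hF : Continuous fun q : (ℝ × ℝ) × (ℝ × ℝ) => q.1.1 * q.2.1 + q.1.2 * q.2.2 := by fun_prop
  have hmap : ∀ (a b : ℝ) (κ : ProbabilityMeasure (ℝ × ℝ)),
      ((diracProba (a, b)).prod κ).map hF.measurable.aemeasurable
        = bundle ((κ : Measure (ℝ × ℝ)).map (linComb a b)) := by
    intro a b κ
    apply Subtype.ext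
    change ((Measure.dirac (a, b)).prod (κ : Measure (ℝ × ℝ))).map _ = _
    rw [Measure.dirac_prod, Measure.map_map hF.measurable (by fun_prop)]
    rfl
  simp_rw [← hmap]
  refine ProbabilityMeasure.tendsto_map_of_tendsto_of_continuous _ _ ?_ hF
  have hd : Tendsto (fun n => diracProba (as n, bs n)) atTop (𝓝 (diracProba (a, b))) :=
    (continuous_diracProba.tendsto _).comp (ha.prodMk_nhds hb)
  exact (ProbabilityMeasure.continuous_prod.tendsto (diracProba (a, b), κ)).comp
    (hd.prodMk_nhds hκ)

/-- Fatou's lemma for weak convergence, from the portmanteau inequality for open sets. -/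
theorem integrable_sq_of_tendsto {α : Type*} [MeasurableSpace α] [TopologicalSpace α]
    [OpensMeasurableSpace α] [HasOuterApproxClosed α] {μs : ℕ → ProbabilityMeasure α}
    {μ : ProbabilityMeasure α} (hμ : Tendsto μs atTop (𝓝 μ)) {f : α → ℝ} (hf : Continuous f)
    (h2 : ∀ n, MemLp f 2 (μs n : Measure α)) {M : ℝ}
    (hM : ∀ n, ∫ x, f x ^ 2 ∂(μs n : Measure α) ≤ M) :
    MemLp f 2 (μ : Measure α) := by
  have hm : Measurable f := hf.measurable
  rw [memLp_two_iff_integrable_sq hm.aestronglyMeasurable]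
  refine ⟨by fun_prop, ?_⟩
  rw [hasFiniteIntegral_iff_ofReal (.of_forall fun x => sq_nonneg _)]
  refine lt_of_le_of_lt (lintegral_le_liminf_lintegral_of_forall_isOpen_measure_le_liminf_measure
    (hf.pow 2) (fun x => sq_nonneg _)
    fun G hG => ProbabilityMeasure.le_liminf_measure_open_of_tendsto hμ hG) ?_
  refine lt_of_le_of_lt (liminf_le_of_le (by isBoundedDefault) (fun b hb => ?_))
    (ENNReal.ofReal_lt_top (r := M))
  obtain ⟨n, hn⟩ := hb.exists
  refine hn.trans ?_
  rw [← ofReal_integral_eq_lintegral_ofReal (h2 n).integrable_sq (.of_forall fun x => sq_nonneg _)]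
  exact ENNReal.ofReal_le_ofReal (hM n)

/-- Truncation to the interval `[-R, R]`. -/
def clip (R x : ℝ) : ℝ := max (-R) (min R x)

theorem continuous_clip (R : ℝ) : Continuous (clip R) := by
  unfold clip
  fun_prop

theorem abs_clip_le {R : ℝ} (hR : 0 ≤ R) (x : ℝ) : |clip R x| ≤ R :=
  abs_le.2 ⟨le_max_left _ _, max_le (by linarith) (min_le_left _ _)⟩

theorem clip_of_abs_lt {R x : ℝ} (hx : |x| < R) : clip R x = x := by
  rw [abs_lt] at hx
  rw [clip, min_eq_right hx.2.le, max_eq_right hx.1.le]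

theorem abs_clip_le_abs {R : ℝ} (x : ℝ) (hx : R ≤ |x|) (hR : 0 ≤ R) : |clip R x| ≤ |x| :=
  (abs_clip_le hR x).trans hx

/-- The integrands agree where `|x| < R`. Elsewhere the difference is at most `2 + 2x² ≤ 4x²`,
because `|x| ≥ R ≥ 1`. -/
theorem abs_integral_sub_clip_le {μ : Measure ℝ} [IsProbabilityMeasure μ] (hμ : MemLp id 2 μ)
    {g : ℝ → ℝ} (hg : Continuous g) (hb : ∀ x, |g x| ≤ 1 + x ^ 2) {R : ℝ} (hR : 1 ≤ R) :
    |∫ x, g x ∂μ - ∫ x, g (clip R x) ∂μ| ≤ 4 * ∫ x in {x : ℝ | R ≤ |x|}, x ^ 2 ∂μ := by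
  have hR0 : 0 ≤ R := zero_le_one.trans hR
  have hi2 : Integrable (fun x : ℝ => x ^ 2) μ := hμ.integrable_sq
  have hgi : Integrable g μ := ((integrable_const 1).add hi2).mono' (by fun_prop)
    (.of_forall fun x => hb x)
  have hcl := continuous_clip R
  have hci : Integrable (fun x => g (clip R x)) μ := by
    refine Integrable.of_bound (by fun_prop) (1 + R ^ 2) (.of_forall fun x => ?_)
    refine (hb _).trans ?_
    have := abs_clip_le hR0 x
    rw [← sq_abs (clip R x)]
    gcongr
  have hs : MeasurableSet {x : ℝ | R ≤ |x|} := measurableSet_le (by fun_prop) (by fun_prop)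
  rw [← integral_sub hgi hci, ← integral_const_mul, ← integral_indicator hs]
  refine (abs_integral_le_integral_abs).trans
    (integral_mono (hgi.sub hci).abs ((hi2.const_mul 4).indicator hs) fun x => ?_)
  by_cases hx : R ≤ |x|
  · rw [Set.indicator_of_mem (by exact hx)]
    have h1 := hb x
    have h2 := hb (clip R x)
    have h3 : clip R x ^ 2 ≤ x ^ 2 := sq_le_sq.2 (abs_clip_le_abs x hx hR0)
    have h4 : 1 ≤ x ^ 2 := by
      rw [← sq_abs]
      nlinarith
    refine (abs_sub _ _).trans ?_
    linarith
  · rw [Set.indicator_of_notMem (by exact hx), clip_of_abs_lt (not_le.1 hx), sub_self, abs_zero]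

theorem tendsto_integral_of_uniform_tail {μs : ℕ → ProbabilityMeasure ℝ}
    {μ : ProbabilityMeasure ℝ} (hμ : Tendsto μs atTop (𝓝 μ))
    (h2 : ∀ n, MemLp id 2 (μs n : Measure ℝ)) (h2' : MemLp id 2 (μ : Measure ℝ))
    (htail : ∀ ε > 0, ∃ R, ∀ n, ∫ x in {x : ℝ | R ≤ |x|}, x ^ 2 ∂(μs n : Measure ℝ) ≤ ε)
    {g : ℝ → ℝ} (hg : Continuous g) (hb : ∀ x, |g x| ≤ 1 + x ^ 2) :
    Tendsto (fun n => ∫ x, g x ∂(μs n : Measure ℝ)) atTop (𝓝 (∫ x, g x ∂(μ : Measure ℝ))) := by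
  have hmono : ∀ (ν : Measure ℝ), MemLp id 2 ν → ∀ R S : ℝ, R ≤ S →
      ∫ x in {x : ℝ | S ≤ |x|}, x ^ 2 ∂ν ≤ ∫ x in {x : ℝ | R ≤ |x|}, x ^ 2 ∂ν := by
    intro ν hν R S hRS
    refine setIntegral_mono_set hν.integrable_sq.integrableOn (.of_forall fun x => sq_nonneg _) ?_
    exact .of_forall fun x hx => hRS.trans hx
  rw [Metric.tendsto_atTop]
  intro ε hε
  obtain ⟨R₁, hR₁⟩ := htail (ε / 16) (by positivity)
  have hzero : Tendsto (fun R : ℝ => ∫ x in {x : ℝ | R ≤ |x|}, x ^ 2 ∂(μ : Measure ℝ)) atTop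
      (𝓝 0) := by
    have hs : ∀ R : ℝ, MeasurableSet {x : ℝ | R ≤ |x|} := fun R =>
      measurableSet_le (by fun_prop) (by fun_prop)
    suffices h : Tendsto (fun R : ℝ => ∫ x, {x : ℝ | R ≤ |x|}.indicator (fun x => x ^ 2) x
        ∂(μ : Measure ℝ)) atTop (𝓝 (∫ _, 0 ∂(μ : Measure ℝ))) by
      simpa only [integral_indicator (hs _), integral_zero] using h
    have hi : Integrable (fun x : ℝ => x ^ 2) (μ : Measure ℝ) := h2'.integrable_sq
    refine tendsto_integral_filter_of_dominated_convergence (fun x => x ^ 2)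
      (.of_forall fun R => (hi.indicator (hs R)).aestronglyMeasurable)
      (.of_forall fun R => .of_forall fun x => ?_) hi (.of_forall fun x => ?_)
    · rw [Real.norm_of_nonneg (Set.indicator_nonneg (fun _ _ => sq_nonneg _) _)]
      exact Set.indicator_le_self' (fun _ _ => sq_nonneg _) _
    · refine tendsto_const_nhds.congr' ?_
      filter_upwards [eventually_gt_atTop |x|] with R hR
      rw [Set.indicator_of_notMem]
      simpa using hR
  obtain ⟨R₂, hR₂⟩ := (hzero.eventually (gt_mem_nhds (show 0 < ε / 16 by positivity))).exists
  set R := max 1 (max R₁ R₂) with hR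
  have hR1 : 1 ≤ R := le_max_left _ _
  have hA : ∀ n, |∫ x, g x ∂(μs n : Measure ℝ) - ∫ x, g (clip R x) ∂(μs n : Measure ℝ)|
      ≤ ε / 4 := fun n => by
    have := abs_integral_sub_clip_le (h2 n) hg hb hR1
    have h3 := hmono _ (h2 n) R₁ R ((le_max_left _ _).trans (le_max_right _ _))
    linarith [hR₁ n]
  have hB : |∫ x, g x ∂(μ : Measure ℝ) - ∫ x, g (clip R x) ∂(μ : Measure ℝ)| ≤ ε / 4 := by
    have := abs_integral_sub_clip_le h2' hg hb hR1
    have h3 := hmono _ h2' R₂ R ((le_max_right _ _).trans (le_max_right _ _))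
    linarith
  have hcl := continuous_clip R
  have hC : Tendsto (fun n => ∫ x, g (clip R x) ∂(μs n : Measure ℝ)) atTop
      (𝓝 (∫ x, g (clip R x) ∂(μ : Measure ℝ))) :=
    (ProbabilityMeasure.tendsto_iff_forall_integral_tendsto.1 hμ)
      (BoundedContinuousFunction.ofNormedAddCommGroup (fun x => g (clip R x)) (by fun_prop)
        (1 + R ^ 2) fun x => (hb _).trans (by
          have := abs_clip_le (zero_le_one.trans hR1) x
          rw [← sq_abs (clip R x)]
          gcongr))
  obtain ⟨N, hN⟩ := Metric.tendsto_atTop.1 hC (ε / 4) (by positivity)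
  refine ⟨N, fun n hn => ?_⟩
  have h1 := abs_le.1 (hA n)
  have h2 := abs_le.1 hB
  have h3 := abs_lt.1 (hN n hn)
  rw [Real.dist_eq, abs_lt]
  constructor <;> linarith [h1.1, h1.2, h2.1, h2.2, h3.1, h3.2]

theorem MemClass.exists_tail_le {ψ : ℝ → ℝ} (hψ : Tendsto ψ atTop (𝓝 0)) (V : ℝ) {ε : ℝ}
    (hε : 0 < ε) : ∃ R, ∀ μ : Measure ℝ, MemClass ψ μ → variance id μ ≤ V →
      ∫ x in {x : ℝ | R ≤ |x|}, x ^ 2 ∂μ ≤ ε := by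
  have h : Tendsto (fun R => V * |ψ R|) atTop (𝓝 0) := by
    simpa using (hψ.abs).const_mul V
  obtain ⟨R, hR, hR0⟩ := ((h.eventually (gt_mem_nhds hε)).and (eventually_ge_atTop 0)).exists
  -- The class measures tails in units of `σ`; a threshold in units of `√V ≥ σ` only shrinks the
  -- tail, so one radius serves all these laws.
  refine ⟨R * √V, fun μ hμ hV => ?_⟩
  calc ∫ x in {x : ℝ | R * √V ≤ |x|}, x ^ 2 ∂μ
      ≤ ∫ x in {x : ℝ | R * √(variance id μ) ≤ |x|}, x ^ 2 ∂μ := by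
        refine setIntegral_mono_set hμ.1.integrable_sq.integrableOn
          (.of_forall fun x => sq_nonneg _) (.of_forall fun x hx => ?_)
        exact (mul_le_mul_of_nonneg_left (Real.sqrt_le_sqrt hV) hR0).trans hx
    _ ≤ variance id μ * ψ R := hμ.2 R hR0
    _ ≤ V * |ψ R| := by
        have := variance_nonneg id μ
        refine (mul_le_mul_of_nonneg_left (le_abs_self _) this).trans ?_
        gcongr
    _ ≤ ε := hR.le

/-- Weak convergence alone lets second moments escape to infinity; this is where the compactness
argument uses uniform integrability. -/
theorem tendsto_variance_of_memClass {ψ : ℝ → ℝ} (hψ : Tendsto ψ atTop (𝓝 0)) {V : ℝ}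
    {μs : ℕ → ProbabilityMeasure ℝ} {μ : ProbabilityMeasure ℝ} (hμ : Tendsto μs atTop (𝓝 μ))
    (hc : ∀ n, MemClass ψ (μs n : Measure ℝ)) (hV : ∀ n, variance id (μs n : Measure ℝ) ≤ V)
    (h2 : MemLp id 2 (μ : Measure ℝ)) :
    Tendsto (fun n => variance id (μs n : Measure ℝ)) atTop
      (𝓝 (variance id (μ : Measure ℝ))) := by
  have htail : ∀ ε > 0, ∃ R, ∀ n, ∫ x in {x : ℝ | R ≤ |x|}, x ^ 2 ∂(μs n : Measure ℝ) ≤ ε := by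
    intro ε hε
    obtain ⟨R, hR⟩ := MemClass.exists_tail_le hψ V hε
    exact ⟨R, fun n => hR _ (hc n) (hV n)⟩
  have t1 := tendsto_integral_of_uniform_tail hμ (fun n => (hc n).1) h2 htail
    (g := fun x => x) (by fun_prop) fun x => by
      rw [← sq_abs x]
      nlinarith [sq_nonneg (|x| - 1), abs_nonneg x]
  have t2 := tendsto_integral_of_uniform_tail hμ (fun n => (hc n).1) h2 htail
    (g := fun x => x ^ 2) (by fun_prop) fun x => by
      rw [abs_of_nonneg (sq_nonneg x)]
      linarith
  rw [variance_eq_sub h2]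
  refine (t2.sub (t1.pow 2)).congr fun n => ?_
  rw [variance_eq_sub (hc n).1]
  rfl

/-! ### Tightness -/

theorem isTightMeasureSet_of_sq_le {S : Set (Measure (ℝ × ℝ))} {K : ℝ}
    (hS : ∀ μ ∈ S, IsProbabilityMeasure μ ∧ MemLp Prod.fst 2 μ ∧ MemLp Prod.snd 2 μ ∧
      ∫ p, p.1 ^ 2 ∂μ ≤ K ∧ ∫ p, p.2 ^ 2 ∂μ ≤ K) : IsTightMeasureSet S := by
  refine isTightMeasureSet_of_tendsto_measure_norm_gt ?_
  have hlim : Tendsto (fun r : ℝ => ENNReal.ofReal (2 * K / r ^ 2)) atTop (𝓝 0) := by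
    rw [← ENNReal.ofReal_zero]
    exact ENNReal.tendsto_ofReal (tendsto_const_nhds.div_atTop (tendsto_pow_atTop two_ne_zero))
  refine tendsto_of_tendsto_of_tendsto_of_le_of_le' tendsto_const_nhds hlim
    (.of_forall fun _ => zero_le) ?_
  filter_upwards [eventually_gt_atTop 0] with r hr
  refine iSup₂_le fun μ hμ => ?_
  obtain ⟨hp, h1, h2, hK1, hK2⟩ := hS μ hμ
  have hi : Integrable (fun p : ℝ × ℝ => p.1 ^ 2 + p.2 ^ 2) μ :=
    h1.integrable_sq.add h2.integrable_sq
  have hmk := mul_meas_ge_le_integral_of_nonneg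
    (.of_forall fun p : ℝ × ℝ => add_nonneg (sq_nonneg p.1) (sq_nonneg p.2)) hi (r ^ 2)
  rw [integral_add h1.integrable_sq h2.integrable_sq] at hmk
  have hle : μ {x | r < ‖x‖} ≤ μ {p : ℝ × ℝ | r ^ 2 ≤ p.1 ^ 2 + p.2 ^ 2} := by
    refine measure_mono fun p hp => ?_
    simp only [Set.mem_ofPred_eq, Prod.norm_def, lt_sup_iff, Real.norm_eq_abs] at hp ⊢
    rcases hp with hp | hp
    · have : r ^ 2 ≤ p.1 ^ 2 := by
        rw [← sq_abs p.1]
        gcongr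
      linarith [sq_nonneg p.2]
    · have : r ^ 2 ≤ p.2 ^ 2 := by
        rw [← sq_abs p.2]
        gcongr
      linarith [sq_nonneg p.1]
  refine hle.trans ?_
  rw [← ofReal_measureReal]
  refine ENNReal.ofReal_le_ofReal ?_
  rw [le_div_iff₀ (by positivity)]
  linarith

/-! ### Rigidity of the score identity -/

/-- After rescaling, `F(u) + G(v) = h(u+v)`, hence `F - F(0)` is additive. Being continuous, it is
linear. -/
theorem affine_of_additive_relation {f g h : ℝ → ℝ} (hf : Continuous f) {a b : ℝ} (ha : a ≠ 0)
    (hb : b ≠ 0) (H : ∀ x y, a * f x + b * g y = h (a * x + b * y)) :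
    ∃ c e, ∀ x, f x = c * x + e := by
  set F : ℝ → ℝ := fun u => a * f (u / a) with hF
  set G : ℝ → ℝ := fun v => b * g (v / b) with hG
  have hFG : ∀ u v, F u + G v = h (u + v) := by
    intro u v
    have := H (u / a) (v / b)
    rwa [mul_div_cancel₀ _ ha, mul_div_cancel₀ _ hb] at this
  have hadd : ∀ u v, F (u + v) - F 0 = (F u - F 0) + (F v - F 0) := by
    intro u v
    have h1 := hFG u v
    have h2 := hFG (u + v) 0
    have h3 := hFG v 0
    have h4 := hFG 0 v
    rw [add_zero] at h2 h3
    rw [zero_add] at h4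
    linarith
  let L : ℝ →+ ℝ := ⟨⟨fun u => F u - F 0, by simp⟩, hadd⟩
  have hL : Continuous L := by
    change Continuous fun u => F u - F 0
    fun_prop
  have hlin : ∀ u, F u - F 0 = u * (F 1 - F 0) := by
    intro u
    have := map_real_smul L hL u 1
    simpa [L] using this
  refine ⟨F 1 - F 0, F 0 / a, fun x => ?_⟩
  have := hlin (a * x)
  have hx : F (a * x) = a * f x := by simp only [hF, mul_div_cancel_left₀ _ ha]
  refine mul_left_cancel₀ ha ?_
  rw [mul_add, mul_div_cancel₀ _ ha, ← hx]
  linarith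

end

section

/-! ### Existence of a modulus -/

/-- The joint laws that are tested in the definition of a modulus. -/
structure IsTestLaw (ψ : ℝ → ℝ) (τ : ℝ≥0) (K : ℝ) (μ : Measure (ℝ × ℝ)) : Prop where
  isProbabilityMeasure : IsProbabilityMeasure μ
  memLp_fst : MemLp Prod.fst 2 μ
  memLp_snd : MemLp Prod.snd 2 μ
  integral_fst : ∫ p, p.1 ∂μ = 0
  integral_snd : ∫ p, p.2 ∂μ = 0
  variance_fst : variance Prod.fst μ ≤ K
  variance_snd : variance Prod.snd μ ≤ K
  memClass_fst : MemClass ψ ((perturb τ μ).map Prod.fst)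
  memClass_snd : MemClass ψ ((perturb τ μ).map Prod.snd)

variable {ψ ν : ℝ → ℝ} {τ : ℝ≥0} {K : ℝ} {μ : Measure (ℝ × ℝ)}

instance [IsProbabilityMeasure μ] : IsProbabilityMeasure (μ.map Prod.fst) :=
  Measure.isProbabilityMeasure_map (by fun_prop)

theorem IsTestLaw.memLp_map_fst (h : IsTestLaw ψ τ K μ) : MemLp id 2 (μ.map Prod.fst) := by
  rw [memLp_map_measure_iff (by fun_prop) (by fun_prop)]
  exact h.memLp_fst

theorem IsTestLaw.variance_map_fst (h : IsTestLaw ψ τ K μ) :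
    variance id (μ.map Prod.fst) ≤ K := by
  rw [variance_map (by fun_prop) (by fun_prop)]
  exact h.variance_fst

theorem IsTestLaw.integral_fst_sq (h : IsTestLaw ψ τ K μ) : ∫ p, p.1 ^ 2 ∂μ ≤ K := by
  rw [← variance_of_integral_eq_zero (X := Prod.fst) (by fun_prop) h.integral_fst]
  exact h.variance_fst

theorem IsTestLaw.integral_snd_sq (h : IsTestLaw ψ τ K μ) : ∫ p, p.2 ^ 2 ∂μ ≤ K := by
  rw [← variance_of_integral_eq_zero (X := Prod.snd) (by fun_prop) h.integral_snd]
  exact h.variance_snd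

theorem IsTestLaw.stFisherInfo_nonneg (hτ : 0 < τ) (h : IsTestLaw ψ τ K μ) :
    0 ≤ stFisherInfo ((perturb τ μ).map Prod.fst) := by
  have := h.isProbabilityMeasure
  rw [perturb_map_fst]
  exact FKG.stFisherInfo_nonneg hτ h.memLp_map_fst

theorem IsTestLaw.stFisherInfo_le (hτ : 0 < τ) (h : IsTestLaw ψ τ K μ) :
    stFisherInfo ((perturb τ μ).map Prod.fst) ≤ K / τ := by
  have := h.isProbabilityMeasure
  rw [perturb_map_fst]
  refine (FKG.stFisherInfo_le hτ h.memLp_map_fst).trans ?_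
  gcongr
  exact h.variance_map_fst

theorem tendsto_gapFun (hτ : 0 < τ) {κs : ℕ → ProbabilityMeasure (ℝ × ℝ)}
    {κ : ProbabilityMeasure (ℝ × ℝ)} (hκ : Tendsto κs atTop (𝓝 κ)) {βs : ℕ → ℝ} {β : ℝ}
    (hβ : Tendsto βs atTop (𝓝 β)) (p : ℝ × ℝ) :
    Tendsto (fun n => gapFun τ (κs n) (βs n) p) atTop (𝓝 (gapFun τ κ β p)) := by
  have ha : Tendsto (fun n => √(βs n)) atTop (𝓝 √β) := hβ.sqrt
  have hb : Tendsto (fun n => √(1 - βs n)) atTop (𝓝 √(1 - β)) := (hβ.const_sub 1).sqrt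
  have t1 := tendsto_score hτ (ProbabilityMeasure.tendsto_map_of_tendsto_of_continuous _ _ hκ
    continuous_fst) (tendsto_const_nhds (x := p.1))
  have t2 := tendsto_score hτ (ProbabilityMeasure.tendsto_map_of_tendsto_of_continuous _ _ hκ
    continuous_snd) (tendsto_const_nhds (x := p.2))
  have t3 := tendsto_score hτ (tendsto_map_linComb hκ ha hb)
    ((ha.mul_const p.1).add (hb.mul_const p.2))
  exact ((ha.mul t1).add (hb.mul t2)).sub t3

/-- In the limit of vanishing score gaps, the limit law has affine scores. -/
theorem gapFun_eq_zero_of_tendsto (hτ : 0 < τ) {κs : ℕ → ProbabilityMeasure (ℝ × ℝ)}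
    {κ : ProbabilityMeasure (ℝ × ℝ)} (hκ : Tendsto κs atTop (𝓝 κ)) {βs : ℕ → ℝ} {β : ℝ}
    (hβs : ∀ n, βs n ∈ Set.Icc (0 : ℝ) 1) (hβ : Tendsto βs atTop (𝓝 β))
    (hgap : Tendsto (fun n => scoreGap (perturb τ (κs n : Measure (ℝ × ℝ))) (βs n)) atTop (𝓝 0))
    (p : ℝ × ℝ) : gapFun τ κ β p = 0 := by
  have hm : ∀ (κ : ProbabilityMeasure (ℝ × ℝ)) β, Measurable fun p =>
      ENNReal.ofReal (jointDensity τ κ p * gapFun τ κ β p ^ 2) := fun κ β =>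
    ((measurable_jointDensity τ _).mul
      ((continuous_gapFun hτ _ β).measurable.pow_const 2)).ennreal_ofReal
  -- Fatou's lemma over Lebesgue measure on the plane: densities and scores converge pointwise and
  -- the score gaps tend to zero.
  have hle : ∫⁻ p, ENNReal.ofReal (jointDensity τ κ p * gapFun τ κ β p ^ 2) ≤ 0 := by
    have hlim : ∀ p, liminf (fun n => ENNReal.ofReal
        (jointDensity τ (κs n) p * gapFun τ (κs n) (βs n) p ^ 2)) atTop
        = ENNReal.ofReal (jointDensity τ κ p * gapFun τ κ β p ^ 2) := fun p =>
      (ENNReal.tendsto_ofReal ((tendsto_jointDensity hτ hκ p).mul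
        ((tendsto_gapFun hτ hκ hβ p).pow 2))).liminf_eq
    have h := lintegral_liminf_le (μ := (volume : Measure (ℝ × ℝ))) (u := atTop)
      fun n => hm (κs n) (βs n)
    simp_rw [hlim] at h
    refine h.trans (le_of_eq ?_)
    have h0 := ENNReal.tendsto_ofReal hgap
    rw [ENNReal.ofReal_zero] at h0
    rw [← h0.liminf_eq]
    congr with n
    exact (ofReal_scoreGap hτ _ (hβs n)).symm
  have hae := (lintegral_eq_zero_iff (hm κ β)).1 (le_antisymm hle zero_le)
  have hz : gapFun τ κ β =ᵐ[volume] fun _ => 0 := by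
    filter_upwards [hae] with p hp
    have h1 := ENNReal.ofReal_eq_zero.1 hp
    have h2 := jointDensity_pos hτ (κ : Measure (ℝ × ℝ)) p
    have h3 : gapFun τ κ β p ^ 2 ≤ 0 := by
      by_contra! h
      exact absurd h1 (not_le.2 (mul_pos h2 h))
    exact pow_eq_zero_iff two_ne_zero |>.1 (le_antisymm h3 (sq_nonneg _))
  -- The joint density is positive everywhere, so the gap vanishes almost everywhere, and by
  -- continuity everywhere.
  exact congrFun ((Continuous.ae_eq_iff_eq volume (continuous_gapFun hτ _ β)
    continuous_const).1 hz) p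

/-- Proof by contradiction: bounded second moments make a violating sequence tight, and a limit law
with zero gap and `β(1-β)J_st ≥ c` would have an affine score, hence `J_st = 0`. -/
theorem exists_scoreGap_bound (hτ : 0 < τ) (hψ : Tendsto ψ atTop (𝓝 0)) (K : ℝ) {c : ℝ}
    (hc : 0 < c) : ∃ ε > 0, ∀ μ : Measure (ℝ × ℝ), IsTestLaw ψ τ K μ →
      ∀ β ∈ Set.Icc (0 : ℝ) 1, scoreGap (perturb τ μ) β ≤ ε →
        β * (1 - β) * stFisherInfo ((perturb τ μ).map Prod.fst) ≤ c := by
  have hτ' : (0 : ℝ) < τ := hτ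
  by_contra! hcon
  choose μ' hμ' β' hβ' hgap' hlt' using fun n : ℕ => hcon (1 / ((n : ℝ) + 1)) (by positivity)
  let κ' : ℕ → ProbabilityMeasure (ℝ × ℝ) := fun n => ⟨μ' n, (hμ' n).isProbabilityMeasure⟩
  set S : Set (ProbabilityMeasure (ℝ × ℝ)) := Set.range κ' with hS
  have hcomp : IsCompact (closure S) := by
    refine isCompact_closure_of_isTightMeasureSet (isTightMeasureSet_of_sq_le (K := K) ?_)
    rintro _ ⟨_, ⟨n, rfl⟩, rfl⟩
    exact ⟨(hμ' n).isProbabilityMeasure, (hμ' n).memLp_fst, (hμ' n).memLp_snd,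
      (hμ' n).integral_fst_sq, (hμ' n).integral_snd_sq⟩
  obtain ⟨⟨κ, β⟩, ⟨-, hβ⟩, φ, hφ, hlim⟩ := (hcomp.prod isCompact_Icc).tendsto_subseq
    (x := fun n => (κ' n, β' n)) fun n => ⟨subset_closure ⟨n, rfl⟩, hβ' n⟩
  change β ∈ Set.Icc (0 : ℝ) 1 at hβ
  have hκ : Tendsto (fun n => κ' (φ n)) atTop (𝓝 κ) := hlim.fst_nhds
  have hβlim : Tendsto (fun n => β' (φ n)) atTop (𝓝 β) := hlim.snd_nhds
  have htest : ∀ n, IsTestLaw ψ τ K (κ' n : Measure (ℝ × ℝ)) := hμ'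
  have hgap : Tendsto (fun n => scoreGap (perturb τ (κ' (φ n) : Measure (ℝ × ℝ))) (β' (φ n)))
      atTop (𝓝 0) :=
    (squeeze_zero (fun n => scoreGap_nonneg _ _) hgap'
      tendsto_one_div_add_atTop_nhds_zero_nat).comp hφ.tendsto_atTop
  have hzero := gapFun_eq_zero_of_tendsto hτ hκ (fun n => hβ' (φ n)) hβlim hgap
  have hmar := ProbabilityMeasure.tendsto_map_of_tendsto_of_continuous _ _ hκ continuous_fst
  have hmem : MemLp id 2 ((κ : Measure (ℝ × ℝ)).map Prod.fst) := by
    rw [memLp_map_measure_iff (by fun_prop) (by fun_prop)]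
    exact integrable_sq_of_tendsto hκ continuous_fst (fun n => (htest _).memLp_fst)
      fun n => (htest _).integral_fst_sq
  have hJ : Tendsto (fun n => stFisherInfo
      ((κ' (φ n) : Measure (ℝ × ℝ)).map Prod.fst ∗ gaussianReal 0 τ)) atTop
      (𝓝 (stFisherInfo ((κ : Measure (ℝ × ℝ)).map Prod.fst ∗ gaussianReal 0 τ))) := by
    refine Tendsto.sub_const (Tendsto.mul ?_ (tendsto_fisherInfo hτ hmar)) 1
    refine tendsto_variance_of_memClass (V := K + τ) hψ (tendsto_conv_gaussianReal hmar)
      (fun n => ?_) (fun n => ?_) (memLp_conv hmem)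
    · have := (htest (φ n)).memClass_fst
      rwa [perturb_map_fst] at this
    · change variance id ((κ' (φ n) : Measure (ℝ × ℝ)).map Prod.fst ∗ gaussianReal 0 τ) ≤ _
      rw [variance_conv (htest _).memLp_map_fst]
      linarith [(htest (φ n)).variance_map_fst]
  have hlt : ∀ n, c < β' n * (1 - β' n) *
      stFisherInfo ((κ' n : Measure (ℝ × ℝ)).map Prod.fst ∗ gaussianReal 0 τ) := by
    intro n
    rw [← perturb_map_fst]
    exact hlt' n
  have hprod : Tendsto (fun n => β' (φ n) * (1 - β' (φ n)) * stFisherInfo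
      ((κ' (φ n) : Measure (ℝ × ℝ)).map Prod.fst ∗ gaussianReal 0 τ)) atTop
      (𝓝 (β * (1 - β) *
        stFisherInfo ((κ : Measure (ℝ × ℝ)).map Prod.fst ∗ gaussianReal 0 τ))) :=
    (hβlim.mul (hβlim.const_sub 1)).mul hJ
  have hge : c ≤ β * (1 - β) *
      stFisherInfo ((κ : Measure (ℝ × ℝ)).map Prod.fst ∗ gaussianReal 0 τ) :=
    ge_of_tendsto' hprod fun n => (hlt _).le
  -- Since `c > 0`, the limit `β` is not an endpoint; both coefficients in the functional equation
  -- are therefore nonzero.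
  have hβ0 : 0 < β := by
    rcases hβ.1.lt_or_eq with h | h
    · exact h
    · rw [← h] at hge
      linarith
  have hβ1 : 0 < 1 - β := by
    rcases hβ.2.lt_or_eq with h | h
    · linarith
    · rw [h] at hge
      linarith
  obtain ⟨a, b, hab⟩ := affine_of_additive_relation
    (continuous_score hτ ((κ : Measure (ℝ × ℝ)).map Prod.fst)) (Real.sqrt_pos.2 hβ0).ne'
    (Real.sqrt_pos.2 hβ1).ne' fun x y => sub_eq_zero.1 (hzero (x, y))
  rw [stFisherInfo_eq_zero_of_affine hτ hmem hab, mul_zero] at hge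
  linarith

theorem mul_one_sub_mem {β : ℝ} (hβ : β ∈ Set.Icc (0 : ℝ) 1) :
    0 ≤ β * (1 - β) ∧ β * (1 - β) ≤ 1 :=
  ⟨mul_nonneg hβ.1 (sub_nonneg.2 hβ.2), by nlinarith [hβ.1, hβ.2]⟩

theorem exists_isModulus (hτ : 0 < τ) (hψ : Tendsto ψ atTop (𝓝 0)) (K : ℝ) :
    ∃ ν : ℝ → ℝ, IsModulus ψ τ K ν := by
  -- The smallest candidate is taken: the supremum of `β(1-β)J_st` over test laws with gap at most
  -- `ε`. Adjoining `0` keeps the set nonempty and the supremum nonnegative.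
  set A : ℝ → Set ℝ := fun ε => {y | y = 0 ∨ ∃ μ : Measure (ℝ × ℝ), IsTestLaw ψ τ K μ ∧
    ∃ β ∈ Set.Icc (0 : ℝ) 1, scoreGap (perturb τ μ) β ≤ ε ∧
      y = β * (1 - β) * stFisherInfo ((perturb τ μ).map Prod.fst)} with hA
  have hne : ∀ ε, (A ε).Nonempty := fun ε => ⟨0, Or.inl rfl⟩
  have hbdd : ∀ ε, BddAbove (A ε) := by
    refine fun ε => ⟨max 0 (K / τ), ?_⟩
    rintro y (rfl | ⟨μ, hμ, β, hβ, -, rfl⟩)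
    · exact le_max_left _ _
    · have h1 := mul_one_sub_mem hβ
      have h2 := hμ.stFisherInfo_nonneg hτ
      exact ((mul_le_of_le_one_left h2 h1.2).trans (hμ.stFisherInfo_le hτ)).trans
        (le_max_right _ _)
  refine ⟨fun ε => sSup (A ε), ?_, ?_⟩
  · rw [Metric.tendsto_nhdsWithin_nhds]
    intro c hc
    obtain ⟨ε, hε, h⟩ := exists_scoreGap_bound hτ hψ K (half_pos hc)
    refine ⟨ε, hε, fun x _ hx => ?_⟩
    have hxε : x ≤ ε := by
      rw [Real.dist_eq, sub_zero] at hx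
      exact (le_abs_self x).trans hx.le
    have h0 : 0 ≤ sSup (A x) := le_csSup (hbdd x) (Or.inl rfl)
    have h1 : sSup (A x) ≤ c / 2 := by
      refine csSup_le (hne x) ?_
      rintro y (rfl | ⟨μ, hμ, β, hβ, hg, rfl⟩)
      · positivity
      · exact h μ hμ β hβ (hg.trans hxε)
    rw [Real.dist_eq, sub_zero, abs_of_nonneg h0]
    linarith
  · intro μ h1 h2 h3 h4 h5 h6 h7 h8 h9 β hβ
    exact le_csSup (hbdd _) (Or.inr ⟨μ, ⟨h1, h2, h3, h4, h5, h6, h7, h8, h9⟩, β, hβ, le_rfl, rfl⟩)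

/-! ### The generalized inverse of a modulus near zero -/

/-- At `β = 0` the combination is `Y` itself and the gap is `ρ_Y - ρ_Y = 0`. The limit passes under
the integral because `(a+b-c)² ≤ 3(a²+b²+c²)` and the integrals of this bound converge, by
`tendsto_fisherInfo`. -/
theorem tendsto_scoreGap_zero (hτ : 0 < τ) (μ : Measure (ℝ × ℝ)) [IsProbabilityMeasure μ]
    {βs : ℕ → ℝ} (hβs : ∀ n, βs n ∈ Set.Icc (0 : ℝ) 1) (hβ : Tendsto βs atTop (𝓝 0)) :
    Tendsto (fun n => scoreGap (perturb τ μ) (βs n)) atTop (𝓝 0) := by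
  set f := fun p : ℝ × ℝ => score (μ.map Prod.fst ∗ gaussianReal 0 τ) p.1 with hf
  set g := fun p : ℝ × ℝ => score (μ.map Prod.snd ∗ gaussianReal 0 τ) p.2 with hg
  set w := fun (β : ℝ) (p : ℝ × ℝ) =>
    score (μ.map (fun q => √β * q.1 + √(1 - β) * q.2) ∗ gaussianReal 0 τ)
      (√β * p.1 + √(1 - β) * p.2) with hw
  have hfi : Integrable (fun p => f p ^ 2) (perturb τ μ) := (memLp_score_fst hτ μ).integrable_sq
  have hgi : Integrable (fun p => g p ^ 2) (perturb τ μ) := (memLp_score_snd hτ μ).integrable_sq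
  have hwi : ∀ n, Integrable (fun p => w (βs n) p ^ 2) (perturb τ μ) := fun n =>
    (memLp_score_linear hτ μ (sqrt_sq_add_sqrt_sq (hβs n))).integrable_sq
  have hκ : Tendsto (fun _ : ℕ => bundle μ) atTop (𝓝 (bundle μ)) := tendsto_const_nhds
  have ha : Tendsto (fun n => √(βs n)) atTop (𝓝 0) := by simpa using hβ.sqrt
  have hb : Tendsto (fun n => √(1 - βs n)) atTop (𝓝 1) := by
    simpa using (hβ.const_sub 1).sqrt
  have hmap : linComb 0 1 = (⟨Prod.snd, continuous_snd⟩ : C(ℝ × ℝ, ℝ)) := by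
    ext p
    simp [linComb]
  have hlim := tendsto_map_linComb hκ ha hb
  have hwlim : ∀ p, Tendsto (fun n => w (βs n) p) atTop (𝓝 (g p)) := by
    intro p
    have := tendsto_score hτ hlim ((ha.mul_const p.1).add (hb.mul_const p.2))
    rw [zero_mul, one_mul, zero_add, hmap] at this
    exact this
  have hJ : Tendsto (fun n => ∫ p, w (βs n) p ^ 2 ∂perturb τ μ) atTop
      (𝓝 (∫ p, g p ^ 2 ∂perturb τ μ)) := by
    have := tendsto_fisherInfo hτ hlim
    rw [hmap] at this
    refine (this.congr fun n => ?_).trans_eq ?_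
    · exact (integral_score_linear_sq hτ μ (sqrt_sq_add_sqrt_sq (hβs n))).symm
    · rw [integral_score_snd_sq hτ μ]
      rfl
  have hi3 : ∀ n, Integrable (fun p => βs n * f p ^ 2 + (1 - βs n) * g p ^ 2) (perturb τ μ) :=
    fun n => (hfi.const_mul _).add (hgi.const_mul _)
  have hi4 : ∀ n, Integrable (fun p => (βs n * f p ^ 2 + (1 - βs n) * g p ^ 2) + w (βs n) p ^ 2)
    (perturb τ μ) := fun n => (hi3 n).add (hwi n)
  have hmain : Tendsto (fun n => ∫ p, gapFun τ μ (βs n) p ^ 2 ∂perturb τ μ) atTop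
      (𝓝 (∫ _, 0 ∂perturb τ μ)) := by
    refine tendsto_integral_of_tendsto_bound
      (G := fun n p => 3 * ((βs n * f p ^ 2 + (1 - βs n) * g p ^ 2) + w (βs n) p ^ 2))
      (g := fun p => 3 * (g p ^ 2 + g p ^ 2))
      (fun n => (memLp_gapFun hτ μ (hβs n)).integrable_sq.aestronglyMeasurable)
      (fun n => (hi4 n).const_mul 3) ((hgi.add hgi).const_mul 3) (fun n p => sq_nonneg _)
      (fun n p => ?_) (fun p => ?_) (fun p => ?_) ?_
    · have h1 := Real.sq_sqrt (hβs n).1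
      have h2 := Real.sq_sqrt (sub_nonneg.2 (hβs n).2)
      change (√(βs n) * f p + √(1 - βs n) * g p - w (βs n) p) ^ 2 ≤ _
      have e1 : βs n * f p ^ 2 = (√(βs n) * f p) ^ 2 := by rw [mul_pow, h1]
      have e2 : (1 - βs n) * g p ^ 2 = (√(1 - βs n) * g p) ^ 2 := by rw [mul_pow, h2]
      rw [e1, e2]
      nlinarith [sq_nonneg (√(βs n) * f p - √(1 - βs n) * g p),
        sq_nonneg (√(βs n) * f p + w (βs n) p), sq_nonneg (√(1 - βs n) * g p + w (βs n) p)]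
    · have h1 : Tendsto (fun n => √(βs n) * f p + √(1 - βs n) * g p - w (βs n) p) atTop
          (𝓝 (0 * f p + 1 * g p - g p)) :=
        ((ha.mul_const _).add (hb.mul_const _)).sub (hwlim p)
      have h2 : Tendsto (fun n => gapFun τ μ (βs n) p ^ 2) atTop
          (𝓝 ((0 * f p + 1 * g p - g p) ^ 2)) := h1.pow 2
      simpa using h2
    · have h1 := (((hβ.mul_const (f p ^ 2)).add ((hβ.const_sub 1).mul_const (g p ^ 2))).add
        ((hwlim p).pow 2)).const_mul 3
      simpa using h1
    · have e : ∀ n, ∫ p, 3 * ((βs n * f p ^ 2 + (1 - βs n) * g p ^ 2) + w (βs n) p ^ 2)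
          ∂perturb τ μ = 3 * ((βs n * ∫ p, f p ^ 2 ∂perturb τ μ)
            + (1 - βs n) * (∫ p, g p ^ 2 ∂perturb τ μ) + ∫ p, w (βs n) p ^ 2 ∂perturb τ μ) := by
        intro n
        rw [integral_const_mul, integral_add (hi3 n) (hwi n),
          integral_add (hfi.const_mul _) (hgi.const_mul _), integral_const_mul,
          integral_const_mul]
      simp_rw [e]
      rw [integral_const_mul, integral_add hgi hgi]
      have h1 := (((hβ.mul_const (∫ p, f p ^ 2 ∂perturb τ μ)).add
        ((hβ.const_sub 1).mul_const (∫ p, g p ^ 2 ∂perturb τ μ))).add hJ).const_mul 3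
      simpa using h1
  rw [integral_zero] at hmain
  refine hmain.congr fun n => ?_
  rw [scoreGap_perturb τ μ (hβs n)]

theorem genInv_le {ν : ℝ → ℝ} {y ε : ℝ} (hε : 0 ≤ ε) (h : y ≤ ν ε) : genInv ν y ≤ ε :=
  csInf_le ⟨0, fun _ hx => hx.1⟩ ⟨hε, h⟩

theorem genInv_nonneg (ν : ℝ → ℝ) (y : ℝ) : 0 ≤ genInv ν y :=
  Real.sInf_nonneg fun _ hx => hx.1

/-- The filter `𝓝[≥] 0` contains the point `0` itself, so the limit forces the value. -/
theorem IsModulus.apply_zero (hν : IsModulus ψ τ K ν) : ν 0 = 0 :=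
  tendsto_nhds_unique ((tendsto_pure_nhds ν 0).mono_left le_rfl)
    (hν.tendsto_zero.mono_left (pure_le_nhdsWithin Set.self_mem_Ici))

theorem IsModulus.genInv_of_nonpos (hν : IsModulus ψ τ K ν) {y : ℝ} (hy : y ≤ 0) :
    genInv ν y = 0 :=
  le_antisymm (genInv_le le_rfl (by rwa [hν.apply_zero])) (genInv_nonneg _ _)

/-- If some test law is not normal, the generalized inverse of a modulus is small near zero. -/
theorem IsModulus.exists_genInv_le (hτ : 0 < τ) (hν : IsModulus ψ τ K ν)
    (hμ : IsTestLaw ψ τ K μ) (hJ : 0 < stFisherInfo ((perturb τ μ).map Prod.fst)) {ε : ℝ}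
    (hε : 0 < ε) : ∃ y₀ > 0, ∀ y ≤ y₀, genInv ν y ≤ ε := by
  have := hμ.isProbabilityMeasure
  -- The values `1/(n+2)` lie strictly inside `(0, 1)`, so `β(1-β)J_st` is positive.
  have hβs : ∀ n : ℕ, 1 / ((n : ℝ) + 1 + 1) ∈ Set.Ioo (0 : ℝ) 1 := fun n =>
    ⟨by positivity, by rw [div_lt_one (by positivity)]; linarith [n.cast_nonneg (α := ℝ)]⟩
  have hlim : Tendsto (fun n : ℕ => 1 / ((n : ℝ) + 1 + 1)) atTop (𝓝 0) := by
    have h := (tendsto_one_div_add_atTop_nhds_zero_nat (𝕜 := ℝ)).comp (tendsto_add_atTop_nat 1)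
    refine h.congr fun n => ?_
    simp
  obtain ⟨n, hn⟩ := ((tendsto_scoreGap_zero hτ μ (fun n => Set.Ioo_subset_Icc_self (hβs n))
    hlim).eventually (gt_mem_nhds hε)).exists
  set β := 1 / ((n : ℝ) + 1 + 1) with hβ
  refine ⟨β * (1 - β) * stFisherInfo ((perturb τ μ).map Prod.fst),
    mul_pos (mul_pos (hβs n).1 (sub_pos.2 (hβs n).2)) hJ, fun y hy => ?_⟩
  refine (genInv_le (scoreGap_nonneg _ _) (hy.trans ?_)).trans hn.le
  exact hν.le_apply μ hμ.1 hμ.2 hμ.3 hμ.4 hμ.5 hμ.6 hμ.7 hμ.8 hμ.9 β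
    (Set.Ioo_subset_Icc_self (hβs n))

end

section

/-! ### Characteristic functions -/

theorem charFun_map_eq_cos_add_sin {Ω : Type*} [MeasurableSpace Ω] (P : Measure Ω)
    [IsProbabilityMeasure P] {Y : Ω → ℝ} (hY : Measurable Y) (r : ℝ) :
    charFun (P.map Y) r
      = ((∫ ω, Real.cos (r * Y ω) ∂P : ℝ) : ℂ)
        + ((∫ ω, Real.sin (r * Y ω) ∂P : ℝ) : ℂ) * Complex.I := by
  have hc : Integrable (fun ω => (Real.cos (r * Y ω) : ℂ)) P :=
    Integrable.of_bound (by fun_prop) 1 (.of_forall fun ω => by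
      rw [Complex.norm_real]
      exact Real.abs_cos_le_one _)
  have hs : Integrable (fun ω => (Real.sin (r * Y ω) : ℂ) * Complex.I) P :=
    (Integrable.of_bound (by fun_prop) 1 (.of_forall fun ω => by
      rw [Complex.norm_real]
      exact Real.abs_sin_le_one _)).mul_const _
  rw [charFun_apply_real, integral_map hY.aemeasurable (by fun_prop), ← integral_complex_ofReal,
    ← integral_complex_ofReal, ← integral_mul_const, ← integral_add hc hs]
  congr with ω
  rw [← Complex.ofReal_mul, Complex.exp_mul_I, Complex.ofReal_cos, Complex.ofReal_sin]

theorem norm_exp_I_taylor_le_cube {y : ℝ} (hy : |y| ≤ 1) :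
    ‖Complex.exp (y * Complex.I) - 1 - y * Complex.I + (y : ℂ) ^ 2 / 2‖ ≤ |y| ^ 3 := by
  have hn : ‖(y : ℂ) * Complex.I‖ = |y| := by simp
  have h := Complex.exp_bound (x := (y : ℂ) * Complex.I) (by rwa [hn]) (n := 3) (by norm_num)
  rw [hn] at h
  have e : ∑ m ∈ Finset.range 3, ((y : ℂ) * Complex.I) ^ m / (m.factorial : ℂ)
      = 1 + y * Complex.I - (y : ℂ) ^ 2 / 2 := by
    simp [Finset.sum_range_succ, mul_pow, Nat.factorial]
    ring
  rw [e] at h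
  have e2 : Complex.exp (y * Complex.I) - 1 - y * Complex.I + (y : ℂ) ^ 2 / 2
      = Complex.exp (y * Complex.I) - (1 + y * Complex.I - (y : ℂ) ^ 2 / 2) := by ring
  rw [e2]
  refine h.trans ?_
  have : (0 : ℝ) ≤ |y| ^ 3 := by positivity
  norm_num [Nat.factorial]
  linarith

theorem norm_exp_I_taylor_le_sq (y : ℝ) :
    ‖Complex.exp (y * Complex.I) - 1 - y * Complex.I + (y : ℂ) ^ 2 / 2‖ ≤ 4 * y ^ 2 := by
  rcases le_total |y| 1 with hy | hy
  · refine (norm_exp_I_taylor_le_cube hy).trans ?_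
    rw [← sq_abs y]
    nlinarith [abs_nonneg y, pow_two_nonneg |y|]
  · have h1 : ‖Complex.exp (y * Complex.I)‖ = 1 := Complex.norm_exp_ofReal_mul_I y
    have h2 : ‖(y : ℂ) * Complex.I‖ = |y| := by simp
    have h3 : ‖(y : ℂ) ^ 2 / 2‖ = y ^ 2 / 2 := by simp
    calc _ ≤ ‖Complex.exp (y * Complex.I)‖ + ‖(1 : ℂ)‖ + ‖(y : ℂ) * Complex.I‖
          + ‖(y : ℂ) ^ 2 / 2‖ :=
          (norm_add_le _ _).trans (add_le_add_left ((norm_sub_le _ _).trans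
            (add_le_add_left (norm_sub_le _ _) _)) _)
      _ = 2 + |y| + y ^ 2 / 2 := by
          rw [h1, h2, h3, norm_one]
          ring
      _ ≤ 4 * y ^ 2 := by
          rw [← sq_abs y]
          nlinarith

/-- The second order expansion of the characteristic function at zero, uniformly over a uniformly
integrable class of laws. -/
theorem eventually_charFun_sub_le {ψ : ℝ → ℝ} (hψ : Tendsto ψ atTop (𝓝 0)) (V : ℝ) {ε : ℝ}
    (hε : 0 < ε) : ∀ᶠ t in 𝓝 (0 : ℝ), ∀ μ : Measure ℝ, IsProbabilityMeasure μ → MemClass ψ μ →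
      ∫ x, x ∂μ = 0 → variance id μ ≤ V →
        ‖charFun μ t - (Real.exp (-(t ^ 2 * variance id μ / 2)) : ℝ)‖ ≤ t ^ 2 * ε := by
  -- Error budget, in units of `t²ε`: a quarter from the tail, where the remainder is at most
  -- `4(tx)²`; a quarter from the centre, where it is at most `|tx|³ ≤ |t|R(tx)²`; a quarter from
  -- replacing `1 - t²v/2` by the exponential.
  obtain ⟨R₀, hR₀⟩ := MemClass.exists_tail_le hψ V (show 0 < ε / 16 by positivity)
  set R := max R₀ 0 with hR
  have hlim1 : Tendsto (fun t : ℝ => |t| * R) (𝓝 0) (𝓝 0) :=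
    Continuous.tendsto' (by fun_prop) _ _ (by simp)
  have hlim2 : Tendsto (fun t : ℝ => |t| * R * V) (𝓝 0) (𝓝 0) :=
    Continuous.tendsto' (by fun_prop) _ _ (by simp)
  have hlim3 : Tendsto (fun t : ℝ => t ^ 2 * V) (𝓝 0) (𝓝 0) :=
    Continuous.tendsto' (by fun_prop) _ _ (by simp)
  have hlim4 : Tendsto (fun t : ℝ => t ^ 2 * V ^ 2) (𝓝 0) (𝓝 0) :=
    Continuous.tendsto' (by fun_prop) _ _ (by simp)
  filter_upwards [hlim1.eventually (gt_mem_nhds one_pos),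
    hlim2.eventually (gt_mem_nhds (show 0 < ε / 4 by positivity)),
    hlim3.eventually (gt_mem_nhds one_pos),
    hlim4.eventually (gt_mem_nhds (show 0 < ε / 4 by positivity))] with t ht1 ht2 ht3 ht4 μ hp hμ
    hm hV
  have hv0 := variance_nonneg id μ
  set v := variance id μ with hv
  have hi2 : Integrable (fun x : ℝ => x ^ 2) μ := hμ.1.integrable_sq
  have hi1 : Integrable (fun x : ℝ => x) μ := hμ.1.integrable one_le_two
  have hsq : ∫ x, x ^ 2 ∂μ = v := by
    exact (variance_of_integral_eq_zero (X := id) measurable_id.aemeasurable hm).symm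
  have hs : MeasurableSet {x : ℝ | R ≤ |x|} := measurableSet_le (by fun_prop) (by fun_prop)
  have htail : ∫ x in {x : ℝ | R ≤ |x|}, x ^ 2 ∂μ ≤ ε / 16 := by
    refine le_trans ?_ (hR₀ μ hμ hV)
    exact setIntegral_mono_set hi2.integrableOn (.of_forall fun x => sq_nonneg _)
      (.of_forall fun x hx => (le_max_left _ _).trans hx)
  set G : ℝ → ℂ := fun x => Complex.exp (((t * x : ℝ) : ℂ) * Complex.I) - 1
    - ((t * x : ℝ) : ℂ) * Complex.I + ((t * x : ℝ) : ℂ) ^ 2 / 2 with hG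
  have hie : Integrable (fun x : ℝ => Complex.exp (((t * x : ℝ) : ℂ) * Complex.I)) μ :=
    Integrable.of_bound (by fun_prop) 1 (.of_forall fun x =>
      (Complex.norm_exp_ofReal_mul_I (t * x)).le)
  have hix : Integrable (fun x : ℝ => ((t * x : ℝ) : ℂ) * Complex.I) μ :=
    ((hi1.const_mul t).ofReal).mul_const _
  have hixx : Integrable (fun x : ℝ => ((t * x : ℝ) : ℂ) ^ 2 / 2) μ := by
    have h : Integrable (fun x : ℝ => (((t ^ 2 / 2 * x ^ 2 : ℝ)) : ℂ)) μ :=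
      (hi2.const_mul (t ^ 2 / 2)).ofReal
    refine h.congr (.of_forall fun x => ?_)
    push_cast
    ring
  have hie1 : Integrable (fun x : ℝ => Complex.exp (((t * x : ℝ) : ℂ) * Complex.I) - 1) μ :=
    hie.sub (integrable_const 1)
  have hie2 : Integrable (fun x : ℝ => Complex.exp (((t * x : ℝ) : ℂ) * Complex.I) - 1
      - ((t * x : ℝ) : ℂ) * Complex.I) μ := hie1.sub hix
  have hGint : ∫ x, G x ∂μ = charFun μ t - ((1 - t ^ 2 * v / 2 : ℝ) : ℂ) := by
    rw [hG, integral_add hie2 hixx, integral_sub hie1 hix, integral_sub hie (integrable_const 1)]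
    have e1 : ∫ x : ℝ, ((t * x : ℝ) : ℂ) * Complex.I ∂μ = 0 := by
      rw [integral_mul_const, integral_complex_ofReal, integral_const_mul, hm]
      simp
    have e2 : ∫ x : ℝ, ((t * x : ℝ) : ℂ) ^ 2 / 2 ∂μ = ((t ^ 2 * v / 2 : ℝ) : ℂ) := by
      have : ∀ x : ℝ, ((t * x : ℝ) : ℂ) ^ 2 / 2 = ((t ^ 2 / 2 * x ^ 2 : ℝ) : ℂ) := by
        intro x
        push_cast
        ring
      simp_rw [this]
      rw [integral_complex_ofReal, integral_const_mul, hsq]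
      congr 1
      ring
    have e3 : ∫ x : ℝ, Complex.exp (((t * x : ℝ) : ℂ) * Complex.I) ∂μ = charFun μ t := by
      rw [charFun_apply_real]
      congr with x
      push_cast
      rfl
    rw [e1, e2, e3]
    simp
    ring
  have hGbound : ‖∫ x, G x ∂μ‖ ≤ 4 * t ^ 2 * (ε / 16) + |t| * R * (t ^ 2 * v) := by
    have hdom : Integrable (fun x => 4 * t ^ 2 * {x : ℝ | R ≤ |x|}.indicator (fun x => x ^ 2) x
        + |t| * R * (t ^ 2 * x ^ 2)) μ :=
      ((hi2.indicator hs).const_mul _).add ((hi2.const_mul _).const_mul _)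
    refine (norm_integral_le_of_norm_le hdom (.of_forall fun x => ?_)).trans ?_
    · by_cases hx : R ≤ |x|
      · rw [Set.indicator_of_mem (by exact hx)]
        refine (norm_exp_I_taylor_le_sq (t * x)).trans ?_
        have : 0 ≤ |t| * R * (t ^ 2 * x ^ 2) := by positivity
        linarith [mul_pow t x 2]
      · rw [Set.indicator_of_notMem (by exact hx)]
        have h1 : |t * x| ≤ |t| * R := by
          rw [abs_mul]
          gcongr
          exact (not_le.1 hx).le
        refine (norm_exp_I_taylor_le_cube (h1.trans ht1.le)).trans ?_
        rw [pow_succ, sq_abs, mul_pow]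
        have : 0 ≤ t ^ 2 * x ^ 2 := by positivity
        nlinarith
    · rw [integral_add ((hi2.indicator hs).const_mul _) ((hi2.const_mul _).const_mul _),
        integral_const_mul, integral_const_mul, integral_const_mul, integral_indicator hs, hsq]
      gcongr
  have ha0 : 0 ≤ t ^ 2 * v / 2 := by positivity
  have htv : t ^ 2 * v ≤ t ^ 2 * V := by gcongr
  have hexp : ‖((1 - t ^ 2 * v / 2 : ℝ) : ℂ) - (Real.exp (-(t ^ 2 * v / 2)) : ℝ)‖
      ≤ (t ^ 2 * v / 2) ^ 2 := by
    rw [← Complex.ofReal_sub, Complex.norm_real, Real.norm_eq_abs, abs_sub_comm]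
    have h := Real.abs_exp_sub_one_sub_id_le (x := -(t ^ 2 * v / 2))
      (by rw [abs_neg, abs_of_nonneg ha0]; linarith)
    rw [neg_sq] at h
    convert h using 2
    ring
  have hexp2 : (t ^ 2 * v / 2) ^ 2 ≤ t ^ 2 * (ε / 4) := by
    have h1 : (t ^ 2 * v / 2) ^ 2 ≤ (t ^ 2 * V) ^ 2 := by
      gcongr
      linarith
    refine h1.trans ?_
    calc (t ^ 2 * V) ^ 2 = t ^ 2 * (t ^ 2 * V ^ 2) := by ring
      _ ≤ _ := by gcongr
  have hmid : |t| * R * (t ^ 2 * v) ≤ t ^ 2 * (ε / 4) := by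
    have hR0 : 0 ≤ R := le_max_right _ _
    calc |t| * R * (t ^ 2 * v) = t ^ 2 * (|t| * R * v) := by ring
      _ ≤ t ^ 2 * (|t| * R * V) := by gcongr
      _ ≤ _ := by gcongr
  rw [hGint] at hGbound
  calc _ = ‖(charFun μ t - ((1 - t ^ 2 * v / 2 : ℝ) : ℂ))
        + (((1 - t ^ 2 * v / 2 : ℝ) : ℂ) - (Real.exp (-(t ^ 2 * v / 2)) : ℝ))‖ := by
        congr 1
        ring
    _ ≤ _ := norm_add_le _ _
    _ ≤ (4 * t ^ 2 * (ε / 16) + |t| * R * (t ^ 2 * v)) + (t ^ 2 * v / 2) ^ 2 :=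
        add_le_add hGbound hexp
    _ ≤ t ^ 2 * ε := by
        have : 0 ≤ t ^ 2 * ε := by positivity
        linarith

/-! ### Newman's inequality for associated families -/

variable {Ω : Type*} [MeasurableSpace Ω] {d : ℕ} {X : (Fin d → ℤ) → Ω → ℝ} {P : Measure Ω}

/-- The sum of the coordinates that belong to `s`, as a function of a larger finite subfamily. -/
def subSum (s t : Finset (Fin d → ℤ)) (y : t → ℝ) : ℝ :=
  ∑ u : t, if (u : Fin d → ℤ) ∈ s then y u else 0

theorem subSum_eq {s t : Finset (Fin d → ℤ)} (hst : s ⊆ t) (f : (Fin d → ℤ) → ℝ) :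
    subSum s t (fun u => f u) = ∑ u ∈ s, f u := by
  rw [subSum, Finset.sum_coe_sort t (fun u => if u ∈ s then f u else 0), Finset.sum_ite_mem,
    Finset.inter_eq_right.2 hst]

theorem monotone_subSum (s t : Finset (Fin d → ℤ)) : Monotone (subSum s t) := by
  intro y z h
  refine Finset.sum_le_sum fun u _ => ?_
  split_ifs
  · exact h u
  · exact le_rfl

theorem measurable_subSum (s t : Finset (Fin d → ℤ)) : Measurable (subSum s t) := by
  unfold subSum
  refine Finset.measurable_sum _ fun u _ => ?_
  split_ifs
  · exact measurable_pi_apply u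
  · exact measurable_const

theorem memLp_sum (hvar : ∀ u, MemLp (X u) 2 P) (s : Finset (Fin d → ℤ)) :
    MemLp (fun ω => ∑ u ∈ s, X u ω) 2 P := memLp_finsetSum s fun u _ => hvar u

variable [IsProbabilityMeasure P]

/-- Adding `c x` to a `c`-Lipschitz function makes it increasing, so FKG applies on the subfamily
indexed by `s ∪ t`. -/
theorem IsFKG.covariance_perturbed_nonneg (hX : IsFKG X P) (hvar : ∀ u, MemLp (X u) 2 P)
    (s t : Finset (Fin d → ℤ)) {f g : ℝ → ℝ} {c : ℝ} (hf : Continuous f) (hg : Continuous g)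
    (hf' : ∀ x y, |f x - f y| ≤ c * |x - y|) (hg' : ∀ x y, |g x - g y| ≤ c * |x - y|)
    (hfb : ∀ x, |f x| ≤ 1) (hgb : ∀ x, |g x| ≤ 1) :
    0 ≤ covariance (fun ω => c * (∑ u ∈ s, X u ω) + f (∑ u ∈ s, X u ω))
      (fun ω => c * (∑ u ∈ t, X u ω) + g (∑ u ∈ t, X u ω)) P := by
  have hmono : ∀ {f : ℝ → ℝ}, (∀ x y, |f x - f y| ≤ c * |x - y|) →
      Monotone fun x => c * x + f x := by
    intro f hf x y hxy
    have h := (abs_le.1 (hf x y)).2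
    rw [abs_of_nonpos (sub_nonpos.2 hxy)] at h
    simp only
    linarith
  have hmem : ∀ {f : ℝ → ℝ} (s : Finset (Fin d → ℤ)), Continuous f → (∀ x, |f x| ≤ 1) →
      MemLp (fun ω => c * (∑ u ∈ s, X u ω) + f (∑ u ∈ s, X u ω)) 2 P := by
    intro f s hf hb
    have h := memLp_sum hvar s
    refine (h.const_mul c).add (MemLp.of_bound ?_ 1 (.of_forall fun ω => hb _))
    exact hf.comp_aestronglyMeasurable h.aestronglyMeasurable
  have e1 : ∀ ω, subSum s (s ∪ t) (fun u => X u ω) = ∑ u ∈ s, X u ω := fun ω =>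
    subSum_eq Finset.subset_union_left fun u => X u ω
  have e2 : ∀ ω, subSum t (s ∪ t) (fun u => X u ω) = ∑ u ∈ t, X u ω := fun ω =>
    subSum_eq Finset.subset_union_right fun u => X u ω
  have h := hX (s ∪ t) (fun y => c * subSum s (s ∪ t) y + f (subSum s (s ∪ t) y))
    (fun y => c * subSum t (s ∪ t) y + g (subSum t (s ∪ t) y))
    (((measurable_subSum s _).const_mul c).add (hf.measurable.comp (measurable_subSum s _)))
    (((measurable_subSum t _).const_mul c).add (hg.measurable.comp (measurable_subSum t _)))
    ((hmono hf').comp (monotone_subSum s _)) ((hmono hg').comp (monotone_subSum t _))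
  simp_rw [e1, e2] at h
  exact h (hmem s hf hfb) (hmem t hg hgb)

/-- Apply the previous bound with all four sign choices `±f`, `±g`. Adding the two cases with equal
signs, or the two with opposite signs, cancels the cross terms. -/
theorem IsFKG.abs_covariance_le (hX : IsFKG X P) (hvar : ∀ u, MemLp (X u) 2 P)
    (s t : Finset (Fin d → ℤ)) {f g : ℝ → ℝ} {c : ℝ} (hf : Continuous f) (hg : Continuous g)
    (hf' : ∀ x y, |f x - f y| ≤ c * |x - y|) (hg' : ∀ x y, |g x - g y| ≤ c * |x - y|)
    (hfb : ∀ x, |f x| ≤ 1) (hgb : ∀ x, |g x| ≤ 1) :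
    |covariance (fun ω => f (∑ u ∈ s, X u ω)) (fun ω => g (∑ u ∈ t, X u ω)) P|
      ≤ c ^ 2 * covariance (fun ω => ∑ u ∈ s, X u ω) (fun ω => ∑ u ∈ t, X u ω) P := by
  have hA := memLp_sum hvar s
  have hB := memLp_sum hvar t
  have hfA : MemLp (fun ω => f (∑ u ∈ s, X u ω)) 2 P :=
    MemLp.of_bound (hf.comp_aestronglyMeasurable hA.aestronglyMeasurable) 1
      (.of_forall fun ω => hfb _)
  have hgB : MemLp (fun ω => g (∑ u ∈ t, X u ω)) 2 P :=
    MemLp.of_bound (hg.comp_aestronglyMeasurable hB.aestronglyMeasurable) 1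
      (.of_forall fun ω => hgb _)
  have hcA : MemLp (fun ω => c * ∑ u ∈ s, X u ω) 2 P := hA.const_mul c
  have hcB : MemLp (fun ω => c * ∑ u ∈ t, X u ω) 2 P := hB.const_mul c
  have hneg : ∀ {f : ℝ → ℝ}, (∀ x y, |f x - f y| ≤ c * |x - y|) →
      ∀ x y, |(-f x) - (-f y)| ≤ c * |x - y| := by
    intro f hf x y
    rw [neg_sub_neg, abs_sub_comm]
    exact hf x y
  have hnb : ∀ {f : ℝ → ℝ}, (∀ x, |f x| ≤ 1) → ∀ x, |(-f x)| ≤ 1 := fun h x => by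
    rw [abs_neg]
    exact h x
  have expand : ∀ {f' g' : Ω → ℝ}, MemLp f' 2 P → MemLp g' 2 P →
      covariance (fun ω => c * (∑ u ∈ s, X u ω) + f' ω)
        (fun ω => c * (∑ u ∈ t, X u ω) + g' ω) P
      = c ^ 2 * covariance (fun ω => ∑ u ∈ s, X u ω) (fun ω => ∑ u ∈ t, X u ω) P
        + c * covariance (fun ω => ∑ u ∈ s, X u ω) g' P
        + c * covariance f' (fun ω => ∑ u ∈ t, X u ω) P + covariance f' g' P := by
    intro f' g' hf' hg'
    have h1 := covariance_add_left hcA hf' (hcB.add hg')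
    have h2 := covariance_add_right hcA hcB hg'
    have h3 := covariance_add_right hf' hcB hg'
    rw [h2, h3, covariance_const_mul_left, covariance_const_mul_left, covariance_const_mul_right,
      covariance_const_mul_right] at h1
    refine Eq.trans h1 ?_
    ring
  have k1 := hX.covariance_perturbed_nonneg hvar s t hf hg hf' hg' hfb hgb
  have k2 := hX.covariance_perturbed_nonneg hvar s t (f := fun x => -f x) (g := fun x => -g x)
    hf.neg hg.neg (hneg hf') (hneg hg') (hnb hfb) (hnb hgb)
  have k3 := hX.covariance_perturbed_nonneg hvar s t (g := fun x => -g x) hf hg.neg hf' (hneg hg')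
    hfb (hnb hgb)
  have k4 := hX.covariance_perturbed_nonneg hvar s t (f := fun x => -f x) hf.neg hg (hneg hf') hg'
    (hnb hfb) hgb
  have hfA' : MemLp (fun ω => -f (∑ u ∈ s, X u ω)) 2 P := hfA.neg
  have hgB' : MemLp (fun ω => -g (∑ u ∈ t, X u ω)) 2 P := hgB.neg
  rw [expand hfA hgB] at k1
  rw [expand hfA' hgB'] at k2
  rw [expand hfA hgB'] at k3
  rw [expand hfA' hgB] at k4
  simp only [covariance_fun_neg_left, covariance_fun_neg_right] at k2 k3 k4
  rw [abs_le]
  constructor <;> linarith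

theorem abs_cos_mul_sub_le (r x y : ℝ) : |Real.cos (r * x) - Real.cos (r * y)| ≤ |r| * |x - y| := by
  rw [← abs_mul, mul_sub]
  exact Real.abs_cos_sub_cos_le _ _

theorem abs_sin_mul_sub_le (r x y : ℝ) : |Real.sin (r * x) - Real.sin (r * y)| ≤ |r| * |x - y| := by
  rw [← abs_mul, mul_sub]
  exact Real.abs_sin_sub_sin_le _ _

/-- The characteristic function of a sum of associated variables almost factorizes. -/
theorem IsFKG.norm_charFun_sub_mul_le (hX : IsFKG X P) (hmeas : ∀ u, Measurable (X u))
    (hvar : ∀ u, MemLp (X u) 2 P) (s t : Finset (Fin d → ℤ)) (r : ℝ) :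
    ‖charFun (P.map fun ω => (∑ u ∈ s, X u ω) + ∑ u ∈ t, X u ω) r
      - charFun (P.map fun ω => ∑ u ∈ s, X u ω) r * charFun (P.map fun ω => ∑ u ∈ t, X u ω) r‖
      ≤ 4 * r ^ 2 * covariance (fun ω => ∑ u ∈ s, X u ω) (fun ω => ∑ u ∈ t, X u ω) P := by
  set A := fun ω => ∑ u ∈ s, X u ω with hA
  set B := fun ω => ∑ u ∈ t, X u ω with hB
  have hAm : Measurable A := Finset.measurable_sum _ fun u _ => hmeas u
  have hBm : Measurable B := Finset.measurable_sum _ fun u _ => hmeas u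
  have hcc : Continuous fun x => Real.cos (r * x) := by fun_prop
  have hsc : Continuous fun x => Real.sin (r * x) := by fun_prop
  have b1 : ∀ x, |Real.cos (r * x)| ≤ 1 := fun x => Real.abs_cos_le_one _
  have b2 : ∀ x, |Real.sin (r * x)| ≤ 1 := fun x => Real.abs_sin_le_one _
  have key : ∀ {f g : ℝ → ℝ}, Continuous f → Continuous g →
      (∀ x y, |f x - f y| ≤ |r| * |x - y|) → (∀ x y, |g x - g y| ≤ |r| * |x - y|) →
      (∀ x, |f x| ≤ 1) → (∀ x, |g x| ≤ 1) →
      |∫ ω, f (A ω) * g (B ω) ∂P - (∫ ω, f (A ω) ∂P) * ∫ ω, g (B ω) ∂P|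
        ≤ r ^ 2 * covariance A B P := by
    intro f g hf hg hf' hg' hfb hgb
    have h := hX.abs_covariance_le hvar s t hf hg hf' hg' hfb hgb
    have hfA : MemLp (fun ω => f (A ω)) 2 P :=
      MemLp.of_bound (hf.measurable.comp hAm).aestronglyMeasurable 1 (.of_forall fun ω => hfb _)
    have hgB : MemLp (fun ω => g (B ω)) 2 P :=
      MemLp.of_bound (hg.measurable.comp hBm).aestronglyMeasurable 1 (.of_forall fun ω => hgb _)
    have e := covariance_eq_sub hfA hgB
    rw [sq_abs] at h
    change |covariance (fun ω => f (A ω)) (fun ω => g (B ω)) P| ≤ _ at h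
    rw [e] at h
    exact h
  have hint : ∀ {f g : ℝ → ℝ}, Continuous f → Continuous g → (∀ x, |f x| ≤ 1) →
      (∀ x, |g x| ≤ 1) → Integrable (fun ω => f (A ω) * g (B ω)) P := by
    intro f g hf hg hfb hgb
    refine Integrable.of_bound ((hf.measurable.comp hAm).mul
      (hg.measurable.comp hBm)).aestronglyMeasurable 1 (.of_forall fun ω => ?_)
    rw [norm_mul]
    exact mul_le_one₀ (hfb _) (norm_nonneg _) (hgb _)
  have k1 := key hcc hcc (abs_cos_mul_sub_le r) (abs_cos_mul_sub_le r) b1 b1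
  have k2 := key hsc hsc (abs_sin_mul_sub_le r) (abs_sin_mul_sub_le r) b2 b2
  have k3 := key hcc hsc (abs_cos_mul_sub_le r) (abs_sin_mul_sub_le r) b1 b2
  have k4 := key hsc hcc (abs_sin_mul_sub_le r) (abs_cos_mul_sub_le r) b2 b1
  have ecos : ∫ ω, Real.cos (r * (A ω + B ω)) ∂P
      = (∫ ω, Real.cos (r * A ω) * Real.cos (r * B ω) ∂P)
        - ∫ ω, Real.sin (r * A ω) * Real.sin (r * B ω) ∂P := by
    rw [← integral_sub (hint hcc hcc b1 b1) (hint hsc hsc b2 b2)]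
    congr with ω
    rw [mul_add, Real.cos_add]
  have esin : ∫ ω, Real.sin (r * (A ω + B ω)) ∂P
      = (∫ ω, Real.sin (r * A ω) * Real.cos (r * B ω) ∂P)
        + ∫ ω, Real.cos (r * A ω) * Real.sin (r * B ω) ∂P := by
    rw [← integral_add (hint hsc hcc b2 b1) (hint hcc hsc b1 b2)]
    congr with ω
    rw [mul_add, Real.sin_add]
  have hABm : Measurable fun ω => A ω + B ω := hAm.add hBm
  rw [charFun_map_eq_cos_add_sin P hABm, charFun_map_eq_cos_add_sin P hAm,
    charFun_map_eq_cos_add_sin P hBm, ecos, esin]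
  refine (Complex.norm_le_abs_re_add_abs_im _).trans ?_
  simp only [Complex.sub_re, Complex.add_re, Complex.ofReal_re, Complex.mul_re, Complex.I_re,
    mul_zero, Complex.ofReal_im, Complex.I_im, mul_one, sub_self, add_zero, Complex.add_im,
    Complex.mul_im, zero_add, Complex.sub_im]
  -- The real and the imaginary part each contain two covariances of sines and cosines, each at most
  -- `r²` times the covariance of the sums; hence the constant `4`.
  refine le_trans (add_le_add (b := 2 * (r ^ 2 * covariance A B P))
    (d := 2 * (r ^ 2 * covariance A B P)) ?_ ?_) (by linarith)
  · rw [abs_le] at k1 k2 ⊢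
    constructor <;> linarith [k1.1, k1.2, k2.1, k2.2]
  · rw [abs_le] at k3 k4 ⊢
    constructor <;> linarith [k3.1, k3.2, k4.1, k4.2]

end

section

variable {Ω : Type*} [MeasurableSpace Ω] {d : ℕ} {X Z : (Fin d → ℤ) → Ω → ℝ} {P : Measure Ω}

/-! ### Boxes -/

theorem mem_box_update {x : Fin d → ℕ} {i : Fin d} {n : ℕ} {u : Fin d → ℤ} :
    u ∈ box (Function.update x i n)
      ↔ (1 ≤ u i ∧ u i ≤ n) ∧ ∀ j, j ≠ i → 1 ≤ u j ∧ u j ≤ x j := by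
  rw [box, Fintype.mem_piFinset]
  simp_rw [Finset.mem_Icc]
  exact Function.forall_update_iff x (fun j (k : ℕ) => 1 ≤ u j ∧ u j ≤ k)

/-- The volume of the section of the box orthogonal to the direction `i`. -/
def sectionVol (x : Fin d → ℕ) (i : Fin d) : ℕ := ∏ j ∈ Finset.univ \ {i}, x j

theorem vol_update (x : Fin d → ℕ) (i : Fin d) (n : ℕ) :
    vol (Function.update x i n) = n * sectionVol x i :=
  Finset.prod_update_of_mem (Finset.mem_univ i) x n

theorem vol_eq (x : Fin d → ℕ) (i : Fin d) : vol x = x i * sectionVol x i := by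
  rw [← vol_update x i (x i), Function.update_eq_self]

theorem card_box (x : Fin d → ℕ) : (box x).card = vol x := by
  simp [box, vol]

/-- The second slab of a box that is cut orthogonally to the direction `i`. -/
def slab (x : Fin d → ℕ) (i : Fin d) (q m : ℕ) : Finset (Fin d → ℤ) :=
  (box (Function.update x i m)).map (addRightEmbedding (Pi.single i (q : ℤ)))

theorem sum_box_update_add {M : Type*} [AddCommMonoid M] (x : Fin d → ℕ) (i : Fin d) (q m : ℕ)
    (f : (Fin d → ℤ) → M) :
    ∑ u ∈ box (Function.update x i (q + m)), f u
      = ∑ u ∈ box (Function.update x i q), f u + ∑ u ∈ slab x i q m, f u := by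
  have hmem : ∀ u, u ∈ slab x i q m
      ↔ ((q : ℤ) + 1 ≤ u i ∧ u i ≤ q + m) ∧ ∀ j, j ≠ i → 1 ≤ u j ∧ u j ≤ x j := by
    intro u
    rw [slab, Finset.mem_map]
    constructor
    · rintro ⟨w, hw, rfl⟩
      rw [mem_box_update] at hw
      refine ⟨?_, fun j hj => ?_⟩
      · simp
        omega
      · simpa [Pi.single_eq_of_ne hj] using hw.2 j hj
    · rintro ⟨h1, h2⟩
      refine ⟨u - Pi.single i (q : ℤ), ?_, by simp⟩
      rw [mem_box_update]
      refine ⟨?_, fun j hj => ?_⟩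
      · simp
        omega
      · simpa [Pi.single_eq_of_ne hj] using h2 j hj
  rw [← Finset.sum_union]
  · congr 1
    ext u
    rw [Finset.mem_union, hmem, mem_box_update, mem_box_update]
    push_cast
    constructor
    · rintro ⟨h1, h2⟩
      by_cases h : u i ≤ q
      · exact Or.inl ⟨⟨h1.1, h⟩, h2⟩
      · exact Or.inr ⟨⟨by omega, h1.2⟩, h2⟩
    · rintro (⟨h1, h2⟩ | ⟨h1, h2⟩)
      · exact ⟨by omega, h2⟩
      · exact ⟨by omega, h2⟩
  · rw [Finset.disjoint_left]
    intro u h1 h2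
    rw [mem_box_update] at h1
    rw [hmem] at h2
    omega

theorem le_of_mem_slab {x : Fin d → ℕ} {i : Fin d} {q m : ℕ} {u : Fin d → ℤ}
    (hu : u ∈ slab x i q m) : (q : ℤ) + 1 ≤ u i := by
  rw [slab, Finset.mem_map] at hu
  obtain ⟨w, hw, rfl⟩ := hu
  rw [mem_box_update] at hw
  simp
  omega

/-- The index `h = q - u i` is the depth of a point below the face at which the box is cut; each
depth occurs `sectionVol x i` times. -/
theorem sum_box_update_apply (x : Fin d → ℕ) (i : Fin d) (q : ℕ) (g : ℤ → ℝ) :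
    ∑ u ∈ box (Function.update x i q), g (u i)
      = sectionVol x i * ∑ h ∈ Finset.range q, g (q - h) := by
  have h := Finset.prod_univ_sum (fun j => Finset.Icc 1 ((Function.update x i q j : ℕ) : ℤ))
    (fun j k => if j = i then g k else 1)
  have e1 : ∀ u : Fin d → ℤ, ∏ j, (if j = i then g (u j) else 1) = g (u i) := fun u => by
    rw [Finset.prod_ite_eq' Finset.univ i fun j => g (u j)]
    simp
  simp_rw [e1] at h
  rw [box, ← h, ← Finset.mul_prod_erase Finset.univ _ (Finset.mem_univ i), mul_comm]
  congr 1
  · rw [sectionVol, Finset.sdiff_singleton_eq_erase]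
    push_cast
    refine Finset.prod_congr rfl fun j hj => ?_
    have hj' := Finset.ne_of_mem_erase hj
    simp [hj']
  · simp only [if_true, Function.update_self]
    refine Finset.sum_bij' (fun k _ => (q - k).toNat) (fun h _ => (q : ℤ) - h) ?_ ?_ ?_ ?_ ?_
    · intro k hk
      rw [Finset.mem_Icc] at hk
      rw [Finset.mem_range]
      omega
    · intro h hh
      rw [Finset.mem_range] at hh
      rw [Finset.mem_Icc]
      omega
    · intro k hk
      rw [Finset.mem_Icc] at hk
      omega
    · intro h hh
      omega
    · intro k hk
      rw [Finset.mem_Icc] at hk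
      congr 1
      omega

/-! ### Covariances in a stationary associated field -/

/-- A stationary associated field with mean zero, finite variance and finite susceptibility. -/
structure IsFKGField (X : (Fin d → ℤ) → Ω → ℝ) (P : Measure Ω) : Prop where
  measurable : ∀ u, Measurable (X u)
  stationary : IsStationary X P
  memLp : ∀ u, MemLp (X u) 2 P
  integral_eq_zero : ∀ u, ∫ ω, X u ω ∂P = 0
  isFKG : IsFKG X P
  summable : Summable fun u => covariance (X 0) (X u) P

/-- The covariance function of the field. -/
def covFun (X : (Fin d → ℤ) → Ω → ℝ) (P : Measure Ω) (w : Fin d → ℤ) : ℝ :=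
  covariance (X 0) (X w) P

/-- The part of the susceptibility that comes from the points `w` with `w i ≥ k`. -/
def covTail (X : (Fin d → ℤ) → Ω → ℝ) (P : Measure Ω) (i : Fin d) (k : ℤ) : ℝ :=
  ∑' w, if k ≤ w i then covFun X P w else 0

namespace IsFKGField

theorem covFun_nonneg (h : IsFKGField X P) (w : Fin d → ℤ) : 0 ≤ covFun X P w :=
  h.isFKG {0, w} (fun y => y ⟨0, by simp⟩) (fun y => y ⟨w, by simp⟩) (measurable_pi_apply _)
    (measurable_pi_apply _) (fun _ _ hy => hy _) (fun _ _ hy => hy _) (h.memLp 0) (h.memLp w)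

theorem covariance_eq (h : IsFKGField X P) (u w : Fin d → ℤ) :
    covariance (X u) (X w) P = covFun X P (w - u) := by
  have hs := (h.stationary u).map_eq
  have hm : ∀ a : Fin d → ℤ, AEMeasurable (fun ω v => X (v + a) ω) P := fun a =>
    (measurable_pi_iff.2 fun v => h.measurable _).aemeasurable
  have hm0 : AEMeasurable (fun ω v => X v ω) P :=
    (measurable_pi_iff.2 fun v => h.measurable _).aemeasurable
  have hp : ∀ (v : Fin d → ℤ) (ν : Measure ((Fin d → ℤ) → ℝ)),
      AEStronglyMeasurable (fun y : (Fin d → ℤ) → ℝ => y v) ν := fun v ν =>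
    (measurable_pi_apply v).aestronglyMeasurable
  have e1 := covariance_map_fun (hp 0 _) (hp (w - u) _) (hm u)
  have e2 := covariance_map_fun (hp 0 _) (hp (w - u) _) hm0
  rw [hs, e2] at e1
  simp only [zero_add, sub_add_cancel] at e1
  exact e1.symm

theorem map_sum_map_add (h : IsFKGField X P) (s : Finset (Fin d → ℤ)) (a : Fin d → ℤ) :
    P.map (fun ω => ∑ u ∈ s.map (addRightEmbedding a), X u ω)
      = P.map fun ω => ∑ u ∈ s, X u ω := by
  have hm : Measurable fun y : (Fin d → ℤ) → ℝ => ∑ u ∈ s, y u :=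
    Finset.measurable_sum _ fun u _ => measurable_pi_apply u
  have e := ((h.stationary a).comp hm).map_eq
  simp only [Finset.sum_map, addRightEmbedding_apply]
  exact e

theorem summable_covFun (h : IsFKGField X P) : Summable (covFun X P) := h.summable

theorem summable_covTail (h : IsFKGField X P) (i : Fin d) (k : ℤ) :
    Summable fun w => if k ≤ w i then covFun X P w else 0 := by
  refine Summable.of_nonneg_of_le (fun w => ?_) (fun w => ?_) h.summable_covFun
  · split_ifs
    exacts [h.covFun_nonneg w, le_rfl]
  · split_ifs
    exacts [le_rfl, h.covFun_nonneg w]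

theorem tendsto_covTail (h : IsFKGField X P) (i : Fin d) :
    Tendsto (fun n : ℕ => covTail X P i (n + 1)) atTop (𝓝 0) := by
  have := tendsto_tsum_of_dominated_convergence (𝓕 := atTop)
    (f := fun (n : ℕ) (w : Fin d → ℤ) => if (n : ℤ) + 1 ≤ w i then covFun X P w else 0)
    (g := fun _ => 0) h.summable_covFun (fun w => ?_) (.of_forall fun n w => ?_)
  · rwa [tsum_zero] at this
  · refine tendsto_const_nhds.congr' ?_
    filter_upwards [eventually_ge_atTop (w i).toNat] with n hn
    rw [if_neg]
    omega
  · split_ifs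
    · rw [Real.norm_of_nonneg (h.covFun_nonneg w)]
    · simpa using h.covFun_nonneg w

/-- The tails tend to zero, hence so do their Cesàro means; with finitely many directions, one `q`
works for all. -/
theorem exists_sum_covTail_le (h : IsFKGField X P) {η : ℝ} (hη : 0 < η) :
    ∃ q, 1 ≤ q ∧ ∀ i : Fin d, ∑ k ∈ Finset.range q, covTail X P i (k + 1) ≤ q * η := by
  have hev : ∀ᶠ q : ℕ in atTop, ∀ i : Fin d,
      (q : ℝ)⁻¹ * ∑ k ∈ Finset.range q, covTail X P i (k + 1) < η :=
    eventually_all.2 fun i => (h.tendsto_covTail i).cesaro.eventually (gt_mem_nhds hη)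
  obtain ⟨q, hq, hq1⟩ := (hev.and (eventually_ge_atTop 1)).exists
  refine ⟨q, hq1, fun i => ?_⟩
  have hq0 : (0 : ℝ) < q := by positivity
  have := hq i
  rw [inv_mul_lt_iff₀ hq0] at this
  exact this.le

theorem sum_covFun_sub_le (h : IsFKGField X P) (t : Finset (Fin d → ℤ)) (u : Fin d → ℤ) :
    ∑ w ∈ t, covFun X P (w - u) ≤ ∑' w, covFun X P w := by
  rw [← (Equiv.subRight u).tsum_eq (covFun X P)]
  exact ((Equiv.subRight u).summable_iff.2 h.summable_covFun).sum_le_tsum t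
    fun w _ => h.covFun_nonneg _

theorem sum_covFun_sub_le_covTail (h : IsFKGField X P) {t : Finset (Fin d → ℤ)} {i : Fin d} {k : ℤ}
    (ht : ∀ w ∈ t, k ≤ w i) (u : Fin d → ℤ) :
    ∑ w ∈ t, covFun X P (w - u) ≤ covTail X P i (k - u i) := by
  have hs := h.summable_covTail i (k - u i)
  rw [covTail, ← (Equiv.subRight u).tsum_eq]
  refine le_trans (Finset.sum_le_sum fun w hw => ?_)
    (((Equiv.subRight u).summable_iff.2 hs).sum_le_tsum t fun w _ => ?_)
  · simp [ht w hw]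
  · split_ifs
    exacts [h.covFun_nonneg _, le_rfl]

variable [IsProbabilityMeasure P]

theorem covariance_sum_sum (h : IsFKGField X P) (s t : Finset (Fin d → ℤ)) :
    covariance (fun ω => ∑ u ∈ s, X u ω) (fun ω => ∑ u ∈ t, X u ω) P
      = ∑ u ∈ s, ∑ w ∈ t, covFun X P (w - u) := by
  rw [covariance_fun_sum_fun_sum' (fun u _ => h.memLp u) (fun u _ => h.memLp u)]
  simp_rw [h.covariance_eq]

theorem variance_sum_le (h : IsFKGField X P) (s : Finset (Fin d → ℤ)) :
    variance (fun ω => ∑ u ∈ s, X u ω) P ≤ s.card * ∑' w, covFun X P w := by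
  rw [← covariance_self (memLp_sum h.memLp s).aemeasurable, h.covariance_sum_sum, ← nsmul_eq_mul]
  exact Finset.sum_le_card_nsmul _ _ _ fun u _ => h.sum_covFun_sub_le s u

/-- A point at depth `k` below the cut meets the slab only at displacements of at least `k + 1` in
direction `i`. The bound is independent of the length `m` of the other piece. -/
theorem covariance_box_slab_le (h : IsFKGField X P) (x : Fin d → ℕ) (i : Fin d) (q m : ℕ) :
    covariance (fun ω => ∑ u ∈ box (Function.update x i q), X u ω)
      (fun ω => ∑ u ∈ slab x i q m, X u ω) P
      ≤ sectionVol x i * ∑ k ∈ Finset.range q, covTail X P i (k + 1) := by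
  rw [h.covariance_sum_sum]
  refine (Finset.sum_le_sum fun u _ => h.sum_covFun_sub_le_covTail (k := q + 1)
    (fun w hw => le_of_mem_slab hw) u).trans ?_
  rw [sum_box_update_apply x i q fun z => covTail X P i (q + 1 - z)]
  refine le_of_eq ?_
  congr 1
  refine Finset.sum_congr rfl fun k _ => ?_
  congr 1
  ring

theorem covariance_nonneg (h : IsFKGField X P) (s t : Finset (Fin d → ℤ)) :
    0 ≤ covariance (fun ω => ∑ u ∈ s, X u ω) (fun ω => ∑ u ∈ t, X u ω) P := by
  rw [h.covariance_sum_sum]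
  exact Finset.sum_nonneg fun u _ => Finset.sum_nonneg fun w _ => h.covFun_nonneg _

end IsFKGField

end

section

variable {Ω : Type*} [MeasurableSpace Ω] {d : ℕ} {X Z : (Fin d → ℤ) → Ω → ℝ} {P : Measure Ω}

/-! ### Normalized sums and their normal perturbations -/

/-- The normalized sum of the unperturbed field over a box. -/
def normSum (X : (Fin d → ℤ) → Ω → ℝ) (x : Fin d → ℕ) (ω : Ω) : ℝ :=
  (∑ u ∈ box x, X u ω) / √(vol x : ℝ)

theorem measurable_normSum (hX : ∀ u, Measurable (X u)) (x : Fin d → ℕ) :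
    Measurable (normSum X x) :=
  (Finset.measurable_sum _ fun u _ => hX u).div_const _

theorem charFun_map_div {Y : Ω → ℝ} (hY : Measurable Y) (a r : ℝ) :
    charFun (P.map fun ω => Y ω / a) r = charFun (P.map Y) (r / a) := by
  rw [charFun_apply_real, charFun_apply_real, integral_map (by fun_prop) (by fun_prop),
    integral_map (by fun_prop) (by fun_prop)]
  congr with ω
  push_cast
  ring_nf

theorem variance_normSum (x : Fin d → ℕ) :
    variance (normSum X x) P = variance (fun ω => ∑ u ∈ box x, X u ω) P / vol x := by
  have e : normSum X x = fun ω => (√(vol x : ℝ))⁻¹ * ∑ u ∈ box x, X u ω := by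
    ext ω
    rw [normSum, div_eq_inv_mul]
  rw [e, variance_const_mul, inv_pow, Real.sq_sqrt (by positivity), div_eq_inv_mul]

theorem IsFKGField.memLp_normSum (h : IsFKGField X P) (x : Fin d → ℕ) :
    MemLp (normSum X x) 2 P := by
  refine ((memLp_sum h.memLp (box x)).mul_const (√(vol x : ℝ))⁻¹).ae_eq (.of_forall fun ω => ?_)
  rw [normSum, div_eq_mul_inv]

variable [IsProbabilityMeasure P]

theorem map_sum_gaussianReal {τ : ℝ≥0} (hZ : ∀ u, Measurable (Z u))
    (hlaw : ∀ u, P.map (Z u) = gaussianReal 0 τ) (hind : iIndepFun Z P) (s : Finset (Fin d → ℤ)) :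
    P.map (fun ω => ∑ u ∈ s, Z u ω) = gaussianReal 0 (s.card * τ) := by
  induction s using Finset.induction_on with
  | empty => simp
  | insert a s ha ih =>
    have h := hind.indepFun_finsetSum_of_notMem hZ ha
    have e1 : (∑ u ∈ s, Z u) = fun ω => ∑ u ∈ s, Z u ω := by
      ext ω
      simp
    rw [e1] at h
    have h2 := gaussianReal_add_gaussianReal_of_indepFun h ih (hlaw a)
    rw [Finset.card_insert_of_notMem ha]
    have e2 : (fun ω => ∑ u ∈ insert a s, Z u ω) = (fun ω => ∑ u ∈ s, Z u ω) + Z a := by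
      ext ω
      rw [Finset.sum_insert ha, Pi.add_apply, add_comm]
    rw [e2, h2]
    push_cast
    rw [add_mul, one_mul, add_zero]

theorem map_boxSum {τ : ℝ≥0} (hX : ∀ u, Measurable (X u)) (hZ : ∀ u, Measurable (Z u))
    (hlaw : ∀ u, P.map (Z u) = gaussianReal 0 τ) (hind : iIndepFun Z P)
    (hXZ : IndepFun (fun ω u => X u ω) (fun ω u => Z u ω) P) {x : Fin d → ℕ} (hx : 1 ≤ vol x) :
    P.map (boxSum X Z x) = P.map (normSum X x) ∗ gaussianReal 0 τ := by
  have hm : Measurable fun y : (Fin d → ℤ) → ℝ => (∑ u ∈ box x, y u) / √(vol x : ℝ) :=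
    (Finset.measurable_sum _ fun u _ => measurable_pi_apply u).div_const _
  have hi : IndepFun (normSum X x) (normSum Z x) P := hXZ.comp hm hm
  have hZn : P.map (normSum Z x) = gaussianReal 0 τ := by
    have e : normSum Z x = (fun y => y / √(vol x : ℝ)) ∘ fun ω => ∑ u ∈ box x, Z u ω := rfl
    rw [e, ← Measure.map_map (by fun_prop) (Finset.measurable_sum _ fun u _ => hZ u),
      map_sum_gaussianReal hZ hlaw hind, gaussianReal_map_div_const, card_box]
    congr 1
    · simp
    · have hv : (vol x : ℝ) ≠ 0 := by positivity
      ext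
      simp only [NNReal.coe_div, NNReal.coe_mul, NNReal.coe_natCast, NNReal.coe_mk]
      rw [Real.sq_sqrt (by positivity)]
      field_simp
  rw [← hZn, ← hi.map_add_eq_map_conv_map (measurable_normSum hX x) (measurable_normSum hZ x)]
  congr 1
  ext ω
  simp only [boxSum, normSum, Pi.add_apply]
  rw [Finset.sum_add_distrib, add_div]

namespace IsFKGField

theorem integral_normSum (h : IsFKGField X P) (x : Fin d → ℕ) : ∫ ω, normSum X x ω ∂P = 0 := by
  simp only [normSum]
  rw [integral_div, integral_finsetSum _ fun u _ => (h.memLp u).integrable one_le_two]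
  simp [h.integral_eq_zero]

theorem variance_normSum_le (h : IsFKGField X P) (x : Fin d → ℕ) :
    variance (normSum X x) P ≤ ∑' w, covFun X P w := by
  rw [variance_normSum]
  have hle := h.variance_sum_le (box x)
  rw [card_box] at hle
  refine div_le_of_le_mul₀ (by positivity) (tsum_nonneg h.covFun_nonneg) ?_
  linarith

end IsFKGField

/-! ### The central limit theorem for box sums -/

/-- The distance at `s` between the characteristic function of the sum over the box of `x` and that
of the normal law with the same variance. -/
def charErr (X : (Fin d → ℤ) → Ω → ℝ) (P : Measure Ω) (x : Fin d → ℕ) (s : ℝ) : ℝ :=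
  ‖charFun (P.map fun ω => ∑ u ∈ box x, X u ω) s
    - (Real.exp (-(s ^ 2 * variance (fun ω => ∑ u ∈ box x, X u ω) P / 2)) : ℝ)‖

/-- Of the constant `5`, `4` comes from Newman's inequality and `1` from the cross term `2c` in the
variance, as `1 - e^{-s²c} ≤ s²c`. -/
theorem norm_sub_exp_le {φ a b : ℂ} {s c vq vm : ℝ} (hvq0 : 0 ≤ vq) (hvm0 : 0 ≤ vm) (hc0 : 0 ≤ c)
    (hb : ‖b‖ ≤ 1) (hφ : ‖φ - a * b‖ ≤ 4 * s ^ 2 * c) :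
    ‖φ - (Real.exp (-(s ^ 2 * (vq + 2 * c + vm) / 2)) : ℝ)‖
      ≤ ‖a - (Real.exp (-(s ^ 2 * vq / 2)) : ℝ)‖ + ‖b - (Real.exp (-(s ^ 2 * vm / 2)) : ℝ)‖
        + 5 * s ^ 2 * c := by
  have hEq : Real.exp (-(s ^ 2 * vq / 2)) ≤ 1 := Real.exp_le_one_iff.2 (by
    have : 0 ≤ s ^ 2 * vq / 2 := by positivity
    linarith)
  have hEm : Real.exp (-(s ^ 2 * vm / 2)) ≤ 1 := Real.exp_le_one_iff.2 (by
    have : 0 ≤ s ^ 2 * vm / 2 := by positivity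
    linarith)
  have hEsplit : Real.exp (-(s ^ 2 * (vq + 2 * c + vm) / 2))
      = Real.exp (-(s ^ 2 * vq / 2)) * Real.exp (-(s ^ 2 * vm / 2)) * Real.exp (-(s ^ 2 * c)) := by
    rw [← Real.exp_add, ← Real.exp_add]
    congr 1
    ring
  have hsc : 0 ≤ s ^ 2 * c := by positivity
  have hEc : Real.exp (-(s ^ 2 * c)) ≤ 1 := Real.exp_le_one_iff.2 (by linarith)
  have hEc2 : 1 - s ^ 2 * c ≤ Real.exp (-(s ^ 2 * c)) := by
    have := Real.add_one_le_exp (-(s ^ 2 * c))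
    linarith
  rw [hEsplit]
  set Eq := Real.exp (-(s ^ 2 * vq / 2))
  set Em := Real.exp (-(s ^ 2 * vm / 2))
  set Ec := Real.exp (-(s ^ 2 * c))
  have hEq0 : 0 ≤ Eq := (Real.exp_pos _).le
  have hEm0 : 0 ≤ Em := (Real.exp_pos _).le
  have e3 : φ - ((Eq * Em * Ec : ℝ) : ℂ)
      = (φ - a * b) + ((a - (Eq : ℂ)) * b + (Eq : ℂ) * (b - (Em : ℂ)))
        + ((Eq * Em * (1 - Ec) : ℝ) : ℂ) := by
    push_cast
    ring
  rw [e3]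
  have n1 : ‖(a - (Eq : ℂ)) * b + (Eq : ℂ) * (b - (Em : ℂ))‖ ≤ ‖a - (Eq : ℂ)‖ + ‖b - (Em : ℂ)‖ := by
    refine (norm_add_le _ _).trans ?_
    rw [norm_mul, norm_mul, Complex.norm_real, Real.norm_of_nonneg hEq0]
    exact add_le_add (mul_le_of_le_one_right (norm_nonneg _) hb)
      (mul_le_of_le_one_left (norm_nonneg _) hEq)
  have n2 : ‖((Eq * Em * (1 - Ec) : ℝ) : ℂ)‖ ≤ s ^ 2 * c := by
    have h1 : 0 ≤ 1 - Ec := by linarith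
    rw [Complex.norm_real, Real.norm_of_nonneg (by positivity)]
    have : Eq * Em ≤ 1 := mul_le_one₀ hEq hEm0 hEm
    have : Eq * Em * (1 - Ec) ≤ 1 * (1 - Ec) := by gcongr
    linarith
  refine (norm_add_le _ _).trans ((add_le_add (norm_add_le _ _) le_rfl).trans ?_)
  linarith

namespace IsFKGField

/-- By stationarity the second slab has the law of a box of length `m` at the origin, so the error
is subadditive in the length up to the covariance across the cut. -/
theorem charErr_update_add_le (h : IsFKGField X P) (x : Fin d → ℕ) (i : Fin d) (q m : ℕ) (s : ℝ) :
    charErr X P (Function.update x i (q + m)) s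
      ≤ charErr X P (Function.update x i q) s + charErr X P (Function.update x i m) s
        + 5 * s ^ 2 * (sectionVol x i * ∑ k ∈ Finset.range q, covTail X P i (k + 1)) := by
  have hc0 := h.covariance_nonneg (box (Function.update x i q)) (slab x i q m)
  have hcle := h.covariance_box_slab_le x i q m
  have hchar := h.isFKG.norm_charFun_sub_mul_le h.measurable h.memLp
    (box (Function.update x i q)) (slab x i q m) s
  have hlaw : P.map (fun ω => ∑ u ∈ slab x i q m, X u ω)
      = P.map fun ω => ∑ u ∈ box (Function.update x i m), X u ω := h.map_sum_map_add _ _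
  have hms : ∀ t : Finset (Fin d → ℤ), Measurable fun ω => ∑ u ∈ t, X u ω := fun t =>
    Finset.measurable_sum _ fun u _ => h.measurable u
  have hvar : variance (fun ω => ∑ u ∈ slab x i q m, X u ω) P
      = variance (fun ω => ∑ u ∈ box (Function.update x i m), X u ω) P := by
    have e1 := variance_map (X := id) (μ := P) measurable_id.aemeasurable
      (hms (slab x i q m)).aemeasurable
    have e2 := variance_map (X := id) (μ := P) measurable_id.aemeasurable
      (hms (box (Function.update x i m))).aemeasurable
    rw [hlaw, e2] at e1
    exact e1.symm
  have hsum : ∀ ω, ∑ u ∈ box (Function.update x i (q + m)), X u ω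
      = ∑ u ∈ box (Function.update x i q), X u ω + ∑ u ∈ slab x i q m, X u ω := fun ω =>
    sum_box_update_add x i q m fun u => X u ω
  have hvadd := variance_fun_add (memLp_sum h.memLp (box (Function.update x i q)))
    (memLp_sum h.memLp (slab x i q m))
  have hprob : IsProbabilityMeasure (P.map fun ω => ∑ u ∈ box (Function.update x i m), X u ω) :=
    Measure.isProbabilityMeasure_map (hms _).aemeasurable
  have hA1 := norm_charFun_le_one (μ := P.map fun ω => ∑ u ∈ box (Function.update x i m), X u ω) s
  unfold charErr
  simp_rw [hsum]
  rw [hvadd, hvar]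
  rw [hlaw] at hchar
  refine (norm_sub_exp_le (variance_nonneg _ _) (variance_nonneg _ _) hc0 hA1 hchar).trans ?_
  gcongr

/-- Membership in the class is available only for the perturbed sum. Its characteristic function
carries the Gaussian factor kept on the left. -/
theorem charErr_mul_exp_le {τ : ℝ≥0} (h : IsFKGField X P) {ψ : ℝ → ℝ} {x : Fin d → ℕ}
    (hx : 1 ≤ vol x) (hmem : MemClass ψ (P.map (normSum X x) ∗ gaussianReal 0 τ)) {s ε : ℝ}
    (hL : ∀ μ : Measure ℝ, IsProbabilityMeasure μ → MemClass ψ μ → ∫ x, x ∂μ = 0 →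
      variance id μ ≤ (∑' w, covFun X P w) + τ →
        ‖charFun μ (s * √(vol x : ℝ))
          - (Real.exp (-((s * √(vol x : ℝ)) ^ 2 * variance id μ / 2)) : ℝ)‖
            ≤ (s * √(vol x : ℝ)) ^ 2 * ε) :
    charErr X P x s * Real.exp (-(s ^ 2 * (τ * vol x) / 2)) ≤ s ^ 2 * vol x * ε := by
  have hv : (0 : ℝ) < vol x := by positivity
  have hm := measurable_normSum h.measurable x
  have hms : Measurable fun ω => ∑ u ∈ box x, X u ω :=
    Finset.measurable_sum _ fun u _ => h.measurable u
  have hp : IsProbabilityMeasure (P.map (normSum X x)) :=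
    Measure.isProbabilityMeasure_map hm.aemeasurable
  have h2 : MemLp id 2 (P.map (normSum X x)) := by
    rw [memLp_map_measure_iff (by fun_prop) hm.aemeasurable]
    exact h.memLp_normSum x
  have hvar : variance id (P.map (normSum X x)) = variance (normSum X x) P := by
    rw [variance_map measurable_id.aemeasurable hm.aemeasurable]
    rfl
  have key := hL _ inferInstance hmem (by
    rw [integral_id_conv (h2.integrable one_le_two),
      integral_map hm.aemeasurable (by fun_prop), h.integral_normSum]) (by
    rw [variance_conv h2, hvar]
    gcongr
    exact h.variance_normSum_le x)
  have hchar : charFun (P.map (normSum X x)) (s * √(vol x : ℝ))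
      = charFun (P.map fun ω => ∑ u ∈ box x, X u ω) s := by
    have e := charFun_map_div (P := P) hms (√(vol x : ℝ)) (s * √(vol x : ℝ))
    rwa [mul_div_cancel_right₀ _ (Real.sqrt_pos.2 hv).ne'] at e
  have hsq : (s * √(vol x : ℝ)) ^ 2 = s ^ 2 * vol x := by
    rw [mul_pow, Real.sq_sqrt hv.le]
  rw [charFun_conv, hchar, charFun_gaussianReal, variance_conv h2, hvar, variance_normSum,
    hsq] at key
  have e1 : ((s * √(vol x : ℝ) : ℝ) : ℂ) * ((0 : ℝ) : ℂ) * Complex.I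
      - ((τ : ℝ) : ℂ) * ((s * √(vol x : ℝ) : ℝ) : ℂ) ^ 2 / 2
      = ((-(s ^ 2 * (τ * vol x) / 2) : ℝ) : ℂ) := by
    rw [← Complex.ofReal_pow, hsq]
    push_cast
    ring
  have e2 : -(s ^ 2 * vol x * (variance (fun ω => ∑ u ∈ box x, X u ω) P / vol x + τ) / 2)
      = -(s ^ 2 * variance (fun ω => ∑ u ∈ box x, X u ω) P / 2)
        + -(s ^ 2 * (τ * vol x) / 2) := by
    field_simp
    ring
  rw [e1, e2, Real.exp_add, Complex.ofReal_mul, ← Complex.ofReal_exp, ← sub_mul, norm_mul,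
    Complex.norm_real, Real.norm_of_nonneg (Real.exp_pos _).le] at key
  exact key

/-- Strong induction on the length, removing one slab of thickness `q` at a time. A length `n ≤ q`
puts the argument `s√vol` in the range of the expansion at zero. A cut costs `5s²η` times the volume
of the removed slab, so the total stays proportional to the volume. The Gaussian weight is
multiplicative over the cut and at most one: each piece keeps its own factor and drops the other. -/
theorem charErr_update_mul_exp_le {τ : ℝ≥0} (h : IsFKGField X P) {ψ : ℝ → ℝ} {x : Fin d → ℕ}
    {i : Fin d} (hx : 1 ≤ sectionVol x i)
    (hmem : ∀ x, 1 ≤ vol x → MemClass ψ (P.map (normSum X x) ∗ gaussianReal 0 τ)) {s ε δ η : ℝ}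
    (hδ : 0 ≤ δ) (hη : 0 ≤ η)
    (hL : ∀ t, |t| ≤ δ → ∀ μ : Measure ℝ, IsProbabilityMeasure μ → MemClass ψ μ →
      ∫ x, x ∂μ = 0 → variance id μ ≤ (∑' w, covFun X P w) + τ →
        ‖charFun μ t - (Real.exp (-(t ^ 2 * variance id μ / 2)) : ℝ)‖ ≤ t ^ 2 * ε)
    {q : ℕ} (hq : 1 ≤ q) (hs : s ^ 2 * (q * sectionVol x i) ≤ δ ^ 2)
    (htail : ∑ k ∈ Finset.range q, covTail X P i (k + 1) ≤ q * η) (n : ℕ) (hn : 1 ≤ n) :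
    charErr X P (Function.update x i n) s * Real.exp (-(s ^ 2 * (τ * (n * sectionVol x i)) / 2))
      ≤ s ^ 2 * (n * sectionVol x i) * (ε + 5 * η) := by
  have base : ∀ n, 1 ≤ n → n ≤ q → charErr X P (Function.update x i n) s
      * Real.exp (-(s ^ 2 * (τ * (n * sectionVol x i)) / 2))
        ≤ s ^ 2 * (n * sectionVol x i) * ε := by
    intro n hn hnq
    have hv : 1 ≤ vol (Function.update x i n) := by
      rw [vol_update]
      exact Nat.mul_pos hn hx
    have k := h.charErr_mul_exp_le hv (hmem _ hv) (s := s) (ε := ε) (hL _ (by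
      refine abs_le_of_sq_le_sq ?_ hδ
      rw [mul_pow, Real.sq_sqrt (by positivity), vol_update]
      push_cast
      refine le_trans ?_ hs
      gcongr))
    rw [vol_update] at k
    push_cast at k
    exact k
  induction n using Nat.strong_induction_on with
  | _ n ih =>
    rcases le_or_gt n q with hnq | hnq
    · refine (base n hn hnq).trans ?_
      gcongr
      linarith
    · obtain ⟨m, rfl⟩ := Nat.exists_eq_add_of_lt hnq
      rw [add_assoc]
      set m' := m + 1
      have h1 := base q hq le_rfl
      have h2 := ih m' (by omega) (by omega)
      have h3 := h.charErr_update_add_le x i q m' s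
      have hn1 : 0 ≤ charErr X P (Function.update x i q) s := norm_nonneg _
      have hn2 : 0 ≤ charErr X P (Function.update x i m') s := norm_nonneg _
      push_cast
      set N : ℝ := (sectionVol x i : ℝ)
      have hN : 0 ≤ N := Nat.cast_nonneg _
      have eA : Real.exp (-(s ^ 2 * (τ * ((q + m' : ℝ) * N)) / 2))
          = Real.exp (-(s ^ 2 * (τ * (q * N)) / 2)) * Real.exp (-(s ^ 2 * (τ * (m' * N)) / 2)) := by
        rw [← Real.exp_add]
        congr 1
        ring
      rw [eA]
      have b1 : Real.exp (-(s ^ 2 * (τ * (q * N)) / 2)) ≤ 1 := Real.exp_le_one_iff.2 (by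
        have : 0 ≤ s ^ 2 * (τ * (q * N)) / 2 := by positivity
        linarith)
      have b2 : Real.exp (-(s ^ 2 * (τ * (m' * N)) / 2)) ≤ 1 := Real.exp_le_one_iff.2 (by
        have : 0 ≤ s ^ 2 * (τ * (m' * N)) / 2 := by positivity
        linarith)
      set A := Real.exp (-(s ^ 2 * (τ * (q * N)) / 2))
      set B := Real.exp (-(s ^ 2 * (τ * (m' * N)) / 2))
      have hA0 : 0 ≤ A := (Real.exp_pos _).le
      have hB0 : 0 ≤ B := (Real.exp_pos _).le
      have hAB : A * B ≤ 1 := mul_le_one₀ b1 hB0 b2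
      have h4 : 5 * s ^ 2 * (N * ∑ k ∈ Finset.range q, covTail X P i (k + 1))
          ≤ 5 * s ^ 2 * (N * (q * η)) := by gcongr
      have h5 : 0 ≤ 5 * s ^ 2 * (N * (q * η)) := by positivity
      calc charErr X P (Function.update x i (q + m')) s * (A * B)
          ≤ (charErr X P (Function.update x i q) s + charErr X P (Function.update x i m') s
            + 5 * s ^ 2 * (N * (q * η))) * (A * B) := by
            gcongr
            linarith
        _ = charErr X P (Function.update x i q) s * A * B
            + charErr X P (Function.update x i m') s * B * A
            + 5 * s ^ 2 * (N * (q * η)) * (A * B) := by ring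
        _ ≤ charErr X P (Function.update x i q) s * A + charErr X P (Function.update x i m') s * B
            + 5 * s ^ 2 * (N * (q * η)) := by
            exact add_le_add (add_le_add (mul_le_of_le_one_right (by positivity) b2)
              (mul_le_of_le_one_right (by positivity) b1)) (mul_le_of_le_one_right h5 hAB)
        _ ≤ s ^ 2 * (q * N) * ε + s ^ 2 * (m' * N) * (ε + 5 * η)
            + 5 * s ^ 2 * (N * (q * η)) := by gcongr
        _ = s ^ 2 * ((q + m') * N) * (ε + 5 * η) := by ring

/-- The central limit theorem for normalized sums over boxes of large volume. -/
theorem exists_norm_charFun_normSum_sub_le {τ : ℝ≥0} (h : IsFKGField X P) {ψ : ℝ → ℝ}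
    (hψ : Tendsto ψ atTop (𝓝 0))
    (hmem : ∀ x, 1 ≤ vol x → MemClass ψ (P.map (normSum X x) ∗ gaussianReal 0 τ)) (r : ℝ) {ε : ℝ}
    (hε : 0 < ε) : ∃ M : ℕ, ∀ x, M ≤ vol x →
      ‖charFun (P.map (normSum X x)) r
        - (Real.exp (-(r ^ 2 * variance (normSum X x) P / 2)) : ℝ)‖ ≤ ε := by
  -- The final bound is `r²(ω + 5ω)`, which explains `6`; the exponential pays for dividing out the
  -- Gaussian weight, and `r² + 1` avoids division by zero.
  set ω : ℝ := ε * Real.exp (-(r ^ 2 * τ / 2)) / (6 * (r ^ 2 + 1)) with hω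
  have hω0 : 0 < ω := by positivity
  obtain ⟨δ, hδ, hL⟩ := Metric.eventually_nhds_iff.1
    (eventually_charFun_sub_le hψ ((∑' w, covFun X P w) + τ) hω0)
  obtain ⟨q, hq, htail⟩ := h.exists_sum_covTail_le hω0
  -- A side `x i ≥ H` gives `r²q/x i ≤ (δ/2)²`, so a slab of thickness `q` is in the range of the
  -- expansion; `δ/2` turns the strict neighbourhood condition into a weak one. Volume above
  -- `(H+1)^d` forces such a side, however large the section orthogonal to it.
  obtain ⟨H, hH⟩ := exists_nat_ge (r ^ 2 * q / (δ / 2) ^ 2)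
  refine ⟨(H + 1) ^ d + 1, fun x hx => ?_⟩
  have hv1 : 1 ≤ vol x := le_trans (Nat.le_add_left _ _) hx
  have hside : ∃ i, H + 1 ≤ x i := by
    by_contra! hcon
    have : vol x ≤ (H + 1) ^ d := by
      refine (Finset.prod_le_pow_card _ _ (H + 1) fun i _ => (hcon i).le).trans ?_
      simp
    omega
  obtain ⟨i, hi⟩ := hside
  have hvx := vol_eq x i
  have hsv : 1 ≤ sectionVol x i := by
    by_contra! h0
    have : sectionVol x i = 0 := by omega
    rw [hvx, this] at hv1
    omega
  have hv : (0 : ℝ) < vol x := by positivity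
  have hxi : (0 : ℝ) < x i := by
    have : 0 < x i := by omega
    positivity
  have hsv' : (0 : ℝ) < sectionVol x i := by positivity
  have hs2 : (r / √(vol x : ℝ)) ^ 2 = r ^ 2 / vol x := by rw [div_pow, Real.sq_sqrt hv.le]
  have hvx' : (vol x : ℝ) = x i * sectionVol x i := by exact_mod_cast hvx
  have key := h.charErr_update_mul_exp_le hsv hmem (s := r / √(vol x : ℝ)) (δ := δ / 2) (η := ω)
    (by positivity) hω0.le (fun t ht => hL (by
      rw [Real.dist_eq, sub_zero]
      linarith)) hq (by
    rw [hs2, hvx']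
    have : r ^ 2 / (x i * sectionVol x i) * (q * sectionVol x i) = r ^ 2 * q / x i := by
      field_simp
    rw [this, div_le_iff₀ hxi]
    rw [div_le_iff₀ (by positivity)] at hH
    have hHx : (H : ℝ) ≤ x i := by
      have : H ≤ x i := by omega
      exact_mod_cast this
    nlinarith [sq_nonneg (δ / 2)]) (htail i) (x i) (by omega)
  rw [Function.update_eq_self, ← hvx', hs2] at key
  have e1 : r ^ 2 / (vol x : ℝ) * (τ * vol x) / 2 = r ^ 2 * τ / 2 := by field_simp
  have e2 : r ^ 2 / (vol x : ℝ) * vol x = r ^ 2 := by field_simp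
  rw [e1, e2] at key
  have hms : Measurable fun ω => ∑ u ∈ box x, X u ω :=
    Finset.measurable_sum _ fun u _ => h.measurable u
  have hE : ‖charFun (P.map (normSum X x)) r
        - (Real.exp (-(r ^ 2 * variance (normSum X x) P / 2)) : ℝ)‖
      = charErr X P x (r / √(vol x : ℝ)) := by
    have e := charFun_map_div (P := P) hms (√(vol x : ℝ)) r
    rw [charErr, ← e, variance_normSum, hs2]
    have : r ^ 2 * (variance (fun ω => ∑ u ∈ box x, X u ω) P / vol x)
      = r ^ 2 / vol x * variance (fun ω => ∑ u ∈ box x, X u ω) P := by ring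
    rw [this]
    rfl
  rw [hE]
  have hpos := Real.exp_pos (-(r ^ 2 * τ / 2))
  refine le_of_mul_le_mul_right (key.trans ?_) hpos
  have e3 : r ^ 2 * (ω + 5 * ω)
      = ε * Real.exp (-(r ^ 2 * τ / 2)) * (r ^ 2 / (r ^ 2 + 1)) := by
    rw [hω]
    field_simp
    ring
  rw [e3]
  refine mul_le_of_le_one_right (by positivity) ?_
  rw [div_le_one (by positivity)]
  linarith

end IsFKGField

end

section

variable {Ω : Type*} [MeasurableSpace Ω] {d : ℕ} {X Z : (Fin d → ℤ) → Ω → ℝ} {P : Measure Ω}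
  [IsProbabilityMeasure P] {τ : ℝ≥0} {ψ : ℝ → ℝ}

/-! ### Decay of the standardised Fisher information -/

theorem stFisherInfo_gaussianReal_conv (hτ : 0 < τ) (w : ℝ≥0) :
    stFisherInfo (gaussianReal 0 w ∗ gaussianReal 0 τ) = 0 := by
  have hwτ : 0 < w + τ := by positivity
  -- Seen as a smoothed point mass with variance `w + τ`, the law has the explicit score `-x/(w+τ)`.
  have e : gaussianReal 0 w ∗ gaussianReal 0 τ = Measure.dirac 0 ∗ gaussianReal 0 (w + τ) := by
    rw [gaussianReal_conv_gaussianReal, Measure.dirac_zero_conv, add_zero]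
  refine stFisherInfo_eq_zero_of_affine hτ (memLp_two_gaussianReal w)
    (a := -(1 / ((w + τ : ℝ≥0) : ℝ))) (b := 0) fun x => ?_
  rw [e, score_conv hwτ, smooth, smooth, integral_dirac, integral_dirac, sub_zero, ker',
    mul_div_cancel_right₀ _ (ker_pos hwτ x).ne']
  ring

namespace IsFKGField

/-- The variances need not converge along boxes, so a subsequence with variances tending to some `w
≥ 0` is taken from a violating sequence. The limit law is `N(0, w)`, possibly degenerate, and its
perturbation has `J_st = 0`. -/
theorem exists_stFisherInfo_normSum_le (h : IsFKGField X P) (hτ : 0 < τ)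
    (hψ : Tendsto ψ atTop (𝓝 0))
    (hmem : ∀ x, 1 ≤ vol x → MemClass ψ (P.map (normSum X x) ∗ gaussianReal 0 τ)) {ε : ℝ}
    (hε : 0 < ε) : ∃ M : ℕ, ∀ x, M ≤ vol x →
      stFisherInfo (P.map (normSum X x) ∗ gaussianReal 0 τ) ≤ ε := by
  by_contra! hcon
  choose x hx hlt using hcon
  have hm := fun n => measurable_normSum h.measurable (x n)
  have hp : ∀ n, IsProbabilityMeasure (P.map (normSum X (x n))) := fun n =>
    Measure.isProbabilityMeasure_map (hm n).aemeasurable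
  have hvar : ∀ n, variance id (P.map (normSum X (x n))) = variance (normSum X (x n)) P := by
    intro n
    rw [variance_map measurable_id.aemeasurable (hm n).aemeasurable]
    rfl
  have h2 : ∀ n, MemLp id 2 (P.map (normSum X (x n))) := by
    intro n
    rw [memLp_map_measure_iff (by fun_prop) (hm n).aemeasurable]
    exact h.memLp_normSum (x n)
  obtain ⟨w, hw, φ, hφ, hlim⟩ := isCompact_Icc.tendsto_subseq
    (x := fun n => variance (normSum X (x n)) P) (s := Set.Icc 0 (∑' w, covFun X P w))
    fun n => ⟨variance_nonneg _ _, h.variance_normSum_le (x n)⟩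
  set μs : ℕ → ProbabilityMeasure ℝ := fun n => ⟨P.map (normSum X (x (φ n))), hp _⟩ with hμs
  have hμ : Tendsto μs atTop (𝓝 (bundle (gaussianReal 0 w.toNNReal))) := by
    rw [ProbabilityMeasure.tendsto_iff_tendsto_charFun]
    intro r
    have t1 : Tendsto (fun n => charFun (P.map (normSum X (x (φ n)))) r
        - ((Real.exp (-(r ^ 2 * variance (normSum X (x (φ n))) P / 2)) : ℝ) : ℂ)) atTop (𝓝 0) := by
      rw [tendsto_zero_iff_norm_tendsto_zero, Metric.tendsto_atTop]
      intro η hη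
      obtain ⟨M, hM⟩ := h.exists_norm_charFun_normSum_sub_le hψ hmem r (half_pos hη)
      refine ⟨M, fun n hn => ?_⟩
      rw [Real.dist_eq, sub_zero, abs_norm]
      have := hM (x (φ n)) ((hn.trans (hφ.id_le n)).trans (hx _))
      linarith
    have t2 : Tendsto (fun n =>
        ((Real.exp (-(r ^ 2 * variance (normSum X (x (φ n))) P / 2)) : ℝ) : ℂ)) atTop
        (𝓝 ((Real.exp (-(r ^ 2 * w / 2)) : ℝ) : ℂ)) := by
      have hc : Continuous fun w : ℝ => ((Real.exp (-(r ^ 2 * w / 2)) : ℝ) : ℂ) := by fun_prop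
      exact (hc.tendsto w).comp hlim
    have t3 := t1.add t2
    simp only [sub_add_cancel, zero_add] at t3
    have e : charFun (gaussianReal 0 w.toNNReal) r = ((Real.exp (-(r ^ 2 * w / 2)) : ℝ) : ℂ) := by
      rw [charFun_gaussianReal, Complex.ofReal_exp, Real.coe_toNNReal _ hw.1]
      congr 1
      push_cast
      ring
    rw [coe_bundle, e]
    exact t3
  have hF := tendsto_fisherInfo hτ hμ
  have hJ : Tendsto (fun n => stFisherInfo (P.map (normSum X (x (φ n))) ∗ gaussianReal 0 τ)) atTop
      (𝓝 (stFisherInfo (gaussianReal 0 w.toNNReal ∗ gaussianReal 0 τ))) := by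
    simp_rw [stFisherInfo, variance_conv (h2 _), variance_conv (memLp_two_gaussianReal _), hvar]
    refine (Tendsto.mul (Tendsto.add ?_ tendsto_const_nhds) hF).sub tendsto_const_nhds
    rw [variance_id_gaussianReal, Real.coe_toNNReal _ hw.1]
    exact hlim
  rw [stFisherInfo_gaussianReal_conv hτ] at hJ
  exact absurd (ge_of_tendsto' hJ fun n => (hlt (φ n)).le) (not_le.2 hε)

/-- The joint law in the definition of a modulus is arbitrary, so `S = T` is a legitimate choice. -/
theorem isTestLaw (h : IsFKGField X P) {K : ℝ} (hK : ∑' w, covFun X P w ≤ K) {x : Fin d → ℕ}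
    (hmem : MemClass ψ (P.map (normSum X x) ∗ gaussianReal 0 τ)) :
    IsTestLaw ψ τ K (P.map fun ω => (normSum X x ω, normSum X x ω)) := by
  have hm := measurable_normSum h.measurable x
  have hm2 : Measurable fun ω => (normSum X x ω, normSum X x ω) := hm.prodMk hm
  have hp : IsProbabilityMeasure (P.map fun ω => (normSum X x ω, normSum X x ω)) :=
    Measure.isProbabilityMeasure_map hm2.aemeasurable
  have hv := (h.variance_normSum_le x).trans hK
  refine ⟨hp, ?_, ?_, ?_, ?_, ?_, ?_, ?_, ?_⟩
  · rw [memLp_map_measure_iff (by fun_prop) hm2.aemeasurable]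
    exact h.memLp_normSum x
  · rw [memLp_map_measure_iff (by fun_prop) hm2.aemeasurable]
    exact h.memLp_normSum x
  · rw [integral_map hm2.aemeasurable (by fun_prop)]
    exact h.integral_normSum x
  · rw [integral_map hm2.aemeasurable (by fun_prop)]
    exact h.integral_normSum x
  · rw [variance_map (by fun_prop) hm2.aemeasurable]
    exact hv
  · rw [variance_map (by fun_prop) hm2.aemeasurable]
    exact hv
  · rw [perturb_map_fst, Measure.map_map measurable_fst hm2]
    exact hmem
  · rw [perturb_map_snd, Measure.map_map measurable_snd hm2]
    exact hmem

/-- The generalized inverse of a modulus is small at the standardised Fisher information of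
normalized sums over large boxes. -/
theorem exists_genInv_le (h : IsFKGField X P) (hτ : 0 < τ) (hψ : Tendsto ψ atTop (𝓝 0))
    (hmem : ∀ x, 1 ≤ vol x → MemClass ψ (P.map (normSum X x) ∗ gaussianReal 0 τ)) {K : ℝ}
    (hK : ∑' w, covFun X P w ≤ K) {ν : ℝ → ℝ} (hν : IsModulus ψ τ K ν) {J : ℕ → ℝ}
    (hJ : ∀ m, 1 ≤ m → ∀ a, 0 ≤ a → (∀ x, vol x = m →
      stFisherInfo (P.map (normSum X x) ∗ gaussianReal 0 τ) ≤ a) → J m ≤ a) {ε : ℝ} (hε : 0 < ε) :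
    ∃ M, ∀ m, M ≤ m → ∀ y ≤ J m, genInv ν y ≤ ε := by
  -- If every perturbed sum is already normal there may be no test law forcing `ν` upward, but then
  -- the argument is nonpositive and the inverse is exactly zero.
  by_cases hz : ∀ x, 1 ≤ vol x → stFisherInfo (P.map (normSum X x) ∗ gaussianReal 0 τ) ≤ 0
  · refine ⟨1, fun m hm y hy => ?_⟩
    rw [hν.genInv_of_nonpos (hy.trans (hJ m hm 0 le_rfl fun x hx => hz x (hx ▸ hm)))]
    exact hε.le
  · push Not at hz
    obtain ⟨x, hx, hpos⟩ := hz
    have hm := measurable_normSum h.measurable x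
    have hp : IsProbabilityMeasure (P.map fun ω => (normSum X x ω, normSum X x ω)) :=
      Measure.isProbabilityMeasure_map (hm.prodMk hm).aemeasurable
    obtain ⟨y₀, hy₀, hy⟩ := hν.exists_genInv_le hτ (h.isTestLaw hK (hmem x hx)) (by
      rw [perturb_map_fst, Measure.map_map measurable_fst (hm.prodMk hm)]
      exact hpos) hε
    obtain ⟨M, hM⟩ := h.exists_stFisherInfo_normSum_le hτ hψ hmem hy₀
    refine ⟨max M 1, fun m hm y hym => hy y (hym.trans ?_)⟩
    exact hJ m ((le_max_right _ _).trans hm) y₀ hy₀.le fun x hx =>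
      hM x (hx ▸ (le_max_left _ _).trans hm)

end IsFKGField

end

end FKG

end

/-! ### Assembly of the inequality. -/

theorem corollary2p4 {Ω : Type*} [MeasurableSpace Ω] (P : Measure Ω) [IsProbabilityMeasure P]
    {d : ℕ} (hd : 1 ≤ d) (X Z : (Fin d → ℤ) → Ω → ℝ) (τ : ℝ≥0) (hτ : 0 < τ)
    -- the stationary FKG system, with mean zero, finite variance and finite susceptibility
    (hXmeas : ∀ u, Measurable (X u))
    (hXstat : FKG.IsStationary X P)
    (hXvar : ∀ u, MemLp (X u) 2 P)
    (hXmean : ∀ u, ∫ ω, X u ω ∂P = 0)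
    (hXfkg : FKG.IsFKG X P)
    (hXsus : Summable fun u => covariance (X 0) (X u) P)
    -- the normal perturbations, independent of the system and of each other
    (hZmeas : ∀ u, Measurable (Z u))
    (hZlaw : ∀ u, P.map (Z u) = gaussianReal 0 τ)
    (hZindep : iIndepFun Z P)
    (hXZ : IndepFun (fun ω u => X u ω) (fun ω u => Z u ω) P)
    -- uniform integrability
    (ψ : ℝ → ℝ) (hψ : Tendsto ψ atTop (𝓝 0))
    (hUI : ∀ x : Fin d → ℕ, (∀ i, 1 ≤ x i) → FKG.MemClass ψ (P.map (FKG.boxSum X Z x)))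
    -- a bound for the variances of the unperturbed normalized sums
    (K : ℝ) (hK : ∑' u, covariance (X 0) (X u) P ≤ K) :
    (∃ ν : ℝ → ℝ, FKG.IsModulus ψ τ K ν) ∧
    ∀ ν : ℝ → ℝ, FKG.IsModulus ψ τ K ν →
      ∃ δ : ℕ → ℝ, Tendsto δ atTop (𝓝 0) ∧
        ∀ m n : ℕ, 1 ≤ n → n ≤ m →
          FKG.supFisher X Z P (n + m) ≤
            (m : ℝ) / (m + n) * FKG.supFisher X Z P m
              + (n : ℝ) / (m + n) * FKG.supFisher X Z P n + δ m
              - FKG.genInv ν (FKG.supFisher X Z P m * (m * n) / ((m : ℝ) + n) ^ 2) := by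
  refine ⟨FKG.exists_isModulus hτ hψ K, fun ν hν => ?_⟩
  have h : FKG.IsFKGField X P := ⟨hXmeas, hXstat, hXvar, hXmean, hXfkg, hXsus⟩
  have hmap : ∀ x : Fin d → ℕ, 1 ≤ FKG.vol x →
      P.map (FKG.boxSum X Z x) = P.map (FKG.normSum X x) ∗ gaussianReal 0 τ := fun x hx =>
    FKG.map_boxSum hXmeas hZmeas hZlaw hZindep hXZ hx
  have hmem : ∀ x : Fin d → ℕ, 1 ≤ FKG.vol x →
      FKG.MemClass ψ (P.map (FKG.normSum X x) ∗ gaussianReal 0 τ) := by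
    intro x hx
    rw [← hmap x hx]
    refine hUI x fun i => Nat.one_le_iff_ne_zero.2 fun hi => ?_
    rw [FKG.vol_eq x i, hi, zero_mul] at hx
    omega
  have hnonneg : ∀ x : Fin d → ℕ, 1 ≤ FKG.vol x →
      0 ≤ FKG.stFisherInfo (P.map (FKG.normSum X x) ∗ gaussianReal 0 τ) := by
    intro x hx
    have hm := FKG.measurable_normSum hXmeas x
    have hp : IsProbabilityMeasure (P.map (FKG.normSum X x)) :=
      Measure.isProbabilityMeasure_map hm.aemeasurable
    refine FKG.stFisherInfo_nonneg hτ ?_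
    rw [memLp_map_measure_iff (by fun_prop) hm.aemeasurable]
    exact h.memLp_normSum x
  have hJle : ∀ m, 1 ≤ m → ∀ a : ℝ, 0 ≤ a → (∀ x : Fin d → ℕ, FKG.vol x = m →
      FKG.stFisherInfo (P.map (FKG.normSum X x) ∗ gaussianReal 0 τ) ≤ a) →
        FKG.supFisher X Z P m ≤ a := by
    intro m hm a ha hx
    -- The condition `0 ≤ a` covers an empty set of boxes, whose supremum is `0` by convention.
    refine Real.sSup_le ?_ ha
    rintro j ⟨x, rfl, rfl⟩
    rw [hmap x hm]
    exact hx x rfl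
  have hJ0 : ∀ m, 1 ≤ m → 0 ≤ FKG.supFisher X Z P m := by
    intro m hm
    refine Real.sSup_nonneg ?_
    rintro j ⟨x, rfl, rfl⟩
    rw [hmap x hm]
    exact hnonneg x hm
  set y : ℕ → ℕ → ℝ := fun m n => FKG.supFisher X Z P m * (m * n) / ((m : ℝ) + n) ^ 2 with hy
  set G : ℕ → ℕ → ℝ := fun m n => FKG.supFisher X Z P (n + m) + FKG.genInv ν (y m n) with hG
  -- The error sequence is the largest amount that the last two terms must absorb. The index `n = 0`
  -- is included, which keeps the range nonempty for every `m`.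
  refine ⟨fun m => (Finset.range (m + 1)).sup' ⟨0, by simp⟩ (G m), ?_, fun m n hn hnm => ?_⟩
  · have hG0 : ∀ m, 1 ≤ m → 0 ≤ G m 0 := fun m hm =>
      add_nonneg (hJ0 _ (by omega)) (FKG.genInv_nonneg _ _)
    rw [Metric.tendsto_atTop]
    intro ε hε
    obtain ⟨M₁, hM₁⟩ := h.exists_stFisherInfo_normSum_le hτ hψ hmem (show 0 < ε / 3 by positivity)
    obtain ⟨M₂, hM₂⟩ := h.exists_genInv_le hτ hψ hmem hK hν hJle (show 0 < ε / 3 by positivity)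
    refine ⟨max 1 (max M₁ M₂), fun m hm => ?_⟩
    simp only [ge_iff_le, max_le_iff] at hm
    have hle : (Finset.range (m + 1)).sup' ⟨0, by simp⟩ (G m) ≤ 2 * (ε / 3) := by
      refine Finset.sup'_le _ _ fun n _ => ?_
      have h1 : FKG.supFisher X Z P (n + m) ≤ ε / 3 :=
        hJle _ (by omega) _ (by positivity) fun x hx => hM₁ x (by omega)
      have hm0 : (0 : ℝ) < m := by
        have : 0 < m := by omega
        positivity
      have h2 : FKG.genInv ν (y m n) ≤ ε / 3 := by
        -- Since `mn ≤ (m+n)²` and `J(m) ≥ 0`, the argument of the inverse is at most `J(m)`.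
        refine hM₂ m hm.2.2 _ ?_
        rw [hy]
        simp only
        rw [div_le_iff₀ (by positivity)]
        refine mul_le_mul_of_nonneg_left ?_ (hJ0 m hm.1)
        nlinarith [n.cast_nonneg (α := ℝ)]
      simp only [hG]
      linarith
    have hge : 0 ≤ (Finset.range (m + 1)).sup' ⟨0, by simp⟩ (G m) :=
      (hG0 m hm.1).trans (Finset.le_sup' (G m) (by simp))
    rw [Real.dist_eq, sub_zero, abs_of_nonneg hge]
    linarith
  · have hle : G m n ≤ (Finset.range (m + 1)).sup' ⟨0, by simp⟩ (G m) :=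
      Finset.le_sup' (G m) (by rw [Finset.mem_range]; omega)
    -- The two averaged terms enter only through their nonnegativity.
    have h1 : 0 ≤ (m : ℝ) / (m + n) * FKG.supFisher X Z P m :=
      mul_nonneg (by positivity) (hJ0 m (by omega))
    have h2 : 0 ≤ (n : ℝ) / (m + n) * FKG.supFisher X Z P n :=
      mul_nonneg (by positivity) (hJ0 n hn)
    simp only [hG, hy] at hle
    linarith
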